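/- For a graph $G=(V,E)$ (finite, simple, undirected) with edge weights $\mathbf{w}\colon E\to\{1,\dots,N\}$ and $w,\ell\in\mathbb{N}$, let $\mathcal{M}_{w,\ell}$ be the set of all ordered pairs $(M_1,M_2)$ of matchings in $G$ (sets of pairwise disjoint edges) that are consistent, i.e. $M_1\cap M_2=\emptyset$ and $V(M_1)=V(M_2)$, such that $|M_1|=|M_2|=\ell/2$ and $\mathbf{w}(M_1\cup M_2)=\sum_{e\in M_1\cup M_2}\mathbf{w}(e)=w$ (so $\mathcal{M}_{w,\ell}=\emptyset$ if $\ell$ is odd). An elimination forest for $G$ is a rooted forest $\mathcal{T}$ on the vertex set $V$ such that for each edge $\{u,v\}\in E$ one of $u,v$ is an ancestor of the other in $\mathcal{T}$; its depth is the largest number of vertices on a path from a root to a leaf. **Theorem.** There is a deterministic algorithm that, given a graph $G=(V,E)$ with $n$ vertices, edge weights $\mathbf{w}\colon E\to\{1,\dots,N\}$ with $N=n^{O(1)}$, values $w,\ell\in\mathbb{N}$, and an elimination forest $\mathcal{T}$ for $G$ of depth $\tau$, computes $|\mathcal{M}_{w,\ell}|$ in time $4^{\tau}\cdot n^{O(1)}$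 and polynomial space. Here the algorithm is a program for a random access machine with integer registers and read-only input; each step costs one unit of time, except that multiplying integers of $a$ and $b$ bits costs $1+ab$. Space is the maximum total number of bits of the addresses and contents of the nonzero registers during the run, and polynomial space means polynomial in $n+\log(w+1)+\log(\ell+1)+1$. The time bound does not depend on $w$ and $\ell$. The program is the same for all polynomial bounds on $N$; only the polynomial factors in the time and space bounds depend on the polynomial bound on $N$. -/

import Mathlib

/-! ### Graphs: consistent matchings -/

/-- A matching of `G`, as a set of pairwise disjoint edges of `G`. -/
def IsEdgeMatching {V : Type*} (G : SimpleGraph V) (M : Finset (Sym2 V)) : Prop :=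
  (∀ e ∈ M, e ∈ G.edgeSet) ∧
    ∀ e ∈ M, ∀ f ∈ M, e ≠ f → ∀ v : V, v ∈ e → v ∉ f

/-- The set `V(M)` of all endpoints of edges in `M`. -/
def coveredVertices {V : Type*} (M : Finset (Sym2 V)) : Set V :=
  {v | ∃ e ∈ M, v ∈ e}

/-- `M₁` and `M₂` are consistent: disjoint as edge sets, with the same vertex set. -/
def AreConsistent {V : Type*} (M₁ M₂ : Finset (Sym2 V)) : Prop :=
  Disjoint M₁ M₂ ∧ coveredVertices M₁ = coveredVertices M₂

/-- The set `𝓜_{w,ℓ}` of ordered pairs of consistent matchings of cardinality exactly `ℓ / 2` each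
(a rational number, so that there are none if `ℓ` is odd) and of total weight `w`. -/
def consistentMatchingPairs {V : Type*} [DecidableEq V] (G : SimpleGraph V)
    (wt : Sym2 V → ℕ) (w ℓ : ℕ) : Set (Finset (Sym2 V) × Finset (Sym2 V)) :=
  {P | IsEdgeMatching G P.1 ∧ IsEdgeMatching G P.2 ∧ AreConsistent P.1 P.2 ∧
    2 * P.1.card = ℓ ∧ 2 * P.2.card = ℓ ∧ ∑ e ∈ P.1 ∪ P.2, wt e = w}

/-! ### Elimination forests -/

/-- A rooted forest on a (finite) vertex set `V`, given by its parent function; the roots are the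
nodes without parent, and no node is a proper ancestor of itself. -/
structure RootedForest (V : Type*) where
  parent : V → Option V
  acyclic : ∀ v : V, ¬ Relation.TransGen (fun a b : V => parent b = some a) v v

/-- `u` is an ancestor of `v`, where every node is an ancestor of itself. -/
def RootedForest.IsAncestor {V : Type*} (T : RootedForest V) (u v : V) : Prop :=
  Relation.ReflTransGen (fun a b : V => T.parent b = some a) u v

/-- `T` is an elimination forest for `G`: the endpoints of each edge are comparable in `T`. -/
def RootedForest.IsEliminationForest {V : Type*} (T : RootedForest V) (G : SimpleGraph V) : Prop :=
  ∀ u v : V, G.Adj u v → T.IsAncestor u v ∨ T.IsAncestor v u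

/-- The depth: the largest number of vertices on a path from a root downwards. The vertices on the
path from the root to `v` are exactly the ancestors of `v`. -/
noncomputable def RootedForest.depth {V : Type*} [Fintype V] (T : RootedForest V) : ℕ :=
  Finset.univ.sup fun v : V => Set.ncard {u : V | T.IsAncestor u v}

/-! ### Random access machines

The registers `X 0, X 1, …` hold integers and are all `0` at the start. The input is a read-only
list of natural numbers. Every step has cost `1`, except that a multiplication is charged the bit
cost of the schoolbook method. The space is counted in bits. -/

namespace RAM

/-- The contents of all registers, of which only finitely many are nonzero. -/
abbrev Memory := ℕ →₀ ℤ

/-- The number of bits that are needed to write down the addresses and the contents (with sign) of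
all nonzero registers. -/
noncomputable def Memory.bits (m : Memory) : ℕ :=
  m.sum fun a x => Nat.size a + Nat.size x.natAbs + 1

inductive Instr where
  /-- `X i := c` -/
  | const (i : ℕ) (c : ℤ)
  /-- `X i := X j + X k` -/
  | add (i j k : ℕ)
  /-- `X i := X j - X k` -/
  | sub (i j k : ℕ)
  /-- `X i := X j * X k` -/
  | mul (i j k : ℕ)
  /-- `X i := X (X j)` -/
  | load (i j : ℕ)
  /-- `X (X i) := X j` -/
  | store (i j : ℕ)
  /-- `X i :=` the entry of the input with index `X j` (counted from `0`), or `0` if there is no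
  such entry -/
  | input (i j : ℕ)

/-- The effect of an instruction. A negative address is read as `0`. -/
noncomputable def Instr.apply (inp : List ℕ) : Instr → Memory → Memory
  | .const i c, m => m.update i c
  | .add i j k, m => m.update i (m j + m k)
  | .sub i j k, m => m.update i (m j - m k)
  | .mul i j k, m => m.update i (m j * m k)
  | .load i j, m => m.update i (m (m j).toNat)
  | .store i j, m => m.update (m i).toNat (m j)
  | .input i j, m => m.update i ((inp.getD (m j).toNat 0 : ℕ) : ℤ)

def Instr.cost : Instr → Memory → ℕ
  | .mul _ j k, m => 1 + Nat.size (m j).natAbs * Nat.size (m k).natAbs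
  | _, _ => 1

/-- Programs. The tests of `ite` and `loop` ask whether a register is positive. -/
inductive Program where
  | skip
  | instr (a : Instr)
  | seq (p q : Program)
  /-- if `X i > 0` then `p` else `q` -/
  | ite (i : ℕ) (p q : Program)
  /-- while `X i > 0` do `p` -/
  | loop (i : ℕ) (p : Program)

/-- `Runs inp p m m' t s`: on input `inp`, the program `p` started with memory `m` halts with
memory `m'`, taking time `t`, and `s` is the maximum number of bits of the memory at any moment of
this run. -/
inductive Runs (inp : List ℕ) : Program → Memory → Memory → ℕ → ℕ → Prop
  | skip (m : Memory) : Runs inp .skip m m 1 m.bits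
  | instr (a : Instr) (m : Memory) :
      Runs inp (.instr a) m (a.apply inp m) (a.cost m) (max m.bits (a.apply inp m).bits)
  | seq {p q : Program} {m m' m'' : Memory} {t t' s s' : ℕ}
      (hp : Runs inp p m m' t s) (hq : Runs inp q m' m'' t' s') :
      Runs inp (.seq p q) m m'' (t + t') (max s s')
  | ite_pos {i : ℕ} {p q : Program} {m m' : Memory} {t s : ℕ} (hi : 0 < m i)
      (hp : Runs inp p m m' t s) : Runs inp (.ite i p q) m m' (1 + t) s
  | ite_neg {i : ℕ} {p q : Program} {m m' : Memory} {t s : ℕ} (hi : ¬ 0 < m i)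
      (hq : Runs inp q m m' t s) : Runs inp (.ite i p q) m m' (1 + t) s
  | loop_stop {i : ℕ} {p : Program} {m : Memory} (hi : ¬ 0 < m i) :
      Runs inp (.loop i p) m m 1 m.bits
  | loop_step {i : ℕ} {p : Program} {m m' m'' : Memory} {t t' s s' : ℕ} (hi : 0 < m i)
      (hp : Runs inp p m m' t s) (hl : Runs inp (.loop i p) m' m'' t' s') :
      Runs inp (.loop i p) m m'' (1 + t + t') (max s s')

/-- Programs are deterministic: final memory, time and space are determined by the input. -/
theorem Runs.deterministic {inp : List ℕ} {p : Program} {m m₁ m₂ : Memory} {t₁ t₂ s₁ s₂ : ℕ}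
    (h₁ : Runs inp p m m₁ t₁ s₁) (h₂ : Runs inp p m m₂ t₂ s₂) :
    m₁ = m₂ ∧ t₁ = t₂ ∧ s₁ = s₂ := by
  induction h₁ generalizing m₂ t₂ s₂ with
  | skip m => cases h₂; simp
  | instr a m => cases h₂; simp
  | seq hp hq ihp ihq =>
    cases h₂ with
    | seq hp' hq' =>
      obtain ⟨rfl, rfl, rfl⟩ := ihp hp'
      obtain ⟨rfl, rfl, rfl⟩ := ihq hq'
      simp
  | ite_pos hi hp ih =>
    cases h₂ with
    | ite_pos _ hp' => obtain ⟨rfl, rfl, rfl⟩ := ih hp'; simp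
    | ite_neg hi' _ => exact absurd hi hi'
  | ite_neg hi hq ih =>
    cases h₂ with
    | ite_pos hi' _ => exact absurd hi' hi
    | ite_neg _ hq' => obtain ⟨rfl, rfl, rfl⟩ := ih hq'; simp
  | loop_stop hi =>
    cases h₂ with
    | loop_stop _ => simp
    | loop_step hi' _ _ => exact absurd hi' hi
  | loop_step hi hp hl ihp ihl =>
    cases h₂ with
    | loop_stop hi' => exact absurd hi hi'
    | loop_step _ hp' hl' =>
      obtain ⟨rfl, rfl, rfl⟩ := ihp hp'
      obtain ⟨rfl, rfl, rfl⟩ := ihl hl'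
      simp

end RAM

/-! ### Encoding of instances -/

/-- The input list: `n`, `w`, `ℓ`, then for each vertex its parent in the forest (`0` for a root,
and `u + 1` for the parent `u`), then row by row the weighted adjacency matrix of the graph, whose
entries are `0` for non-edges and the (positive) weight for edges. -/
noncomputable def encodeInstance {n : ℕ} (G : SimpleGraph (Fin n)) (wt : Sym2 (Fin n) → ℕ)
    (w ℓ : ℕ) (T : RootedForest (Fin n)) : List ℕ :=
  open Classical in
  [n, w, ℓ] ++
    (List.ofFn fun v : Fin n =>
      match T.parent v with
      | none => 0
      | some u => (u : ℕ) + 1) ++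
    (List.ofFn fun p : Fin (n * n) =>
      if G.Adj p.divNat p.modNat then wt s(p.divNat, p.modNat) else 0)

/-!
# Counting consistent pairs of matchings with an elimination forest

The algorithm evaluates by a depth-first traversal of the forest the sum, over all contexts (for
each vertex two bits), of the product of the local weights of the vertices. By inclusion-exclusion
this sum counts the pairs of schemes, that is, orientations of the edges of two matchings towards
the root, and its binary expansion records their weights and sizes.
-/

/-! Direct every edge of `G` from a vertex to its ancestor. A matching becomes a labelling: each
covered vertex either picks its partner above it or is marked as picked from below. In a scheme the
marked vertices are exactly those picked by at least one vertex, so there are at least as many picks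
as marks, with equality only if no vertex is picked twice. Two schemes with the same uncovered
vertices encode `V(M₁) = V(M₂)`; since directions are fixed, their edge sets are disjoint as soon as
no vertex makes the same pick in both. If the picks and the marks of both schemes together number
`ℓ` each, then picks and marks agree in each scheme, both are matchings, and both have `ℓ / 2` edges
(`consistentMatchingPairs_eq_image`).

The condition "marked iff picked" is global, and inclusion-exclusion makes it local. Every vertex
gets one bit per scheme telling whether it may be picked; these bits form the context. For a fixed
context the signed sum over all choices is a product over the vertices (`sum_prod_schemeSign`,
`vertexWeight_eq_sum`), and the factor of `v` involves only the bits of `v` and of its ancestors. A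
pick of weight `x` carries the factor `2 ^ (M * (x + M))` and a mark the factor `2 ^ (M * M ^ 2)`,
so a pair of schemes contributes 2 to the power `M * (weight + picks * M + marks * M ^ 2)`
(`sum_prod_vertexWeight`, `sum_choiceExp`). Let `M = 2 * (n + 1) ^ 2 * (s + 1)`, where `s` is the
sum of all matrix entries. Then weight, picks and marks are below `M` and there are fewer than `2 ^
M` pairs, so the wanted number is one digit of the total to the base `2 ^ M` (`sum_pow_digit`,
`exists_sum_prod_vertexWeight`). If `w` or `ℓ` is at least `M`, the number is 0.

As each factor depends only on the path to the root, the sum over all contexts can be nested along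
the forest: once the context of a node and of its ancestors is fixed, the subtrees of its children
contribute independent factors (`IdTree.evalTree_eq_sumOver`). A depth-first traversal tries four
contexts per node, hence handles a node of depth `d` in at most `4 ^ d` rounds, and it keeps two
integers and two bits per node (`IdTree.evalSpec`, `IdTree.reach_final`). These integers have
polynomially many bits.

The rest shows that a concrete program performs this traversal (`Setting.dfsLoop_spec`) and extracts
the digit by binary long division (`Setting.extract_spec`), with a calculus `Ev` that tracks time,
space and result together. -/

set_option linter.unusedSectionVars false

/-! ### A calculus for correctness, time and space of programs. -/

namespace RAM

/-- All nonzero registers have addresses below `A` and contents of at most `B` bits. -/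
def Bdd (A B : ℕ) (m : Memory) : Prop :=
  ∀ a, m a ≠ 0 → a < A ∧ (m a).natAbs < 2 ^ B

theorem Bdd.mono {A B B' : ℕ} (h : B ≤ B') {m : Memory} (hm : Bdd A B m) : Bdd A B' m :=
  fun a ha => ⟨(hm a ha).1, (hm a ha).2.trans_le (Nat.pow_le_pow_right (by norm_num) h)⟩

theorem Bdd.zero (A B : ℕ) : Bdd A B 0 := fun _ ha => absurd rfl ha

theorem Bdd.natAbs_lt {A B : ℕ} {m : Memory} (hm : Bdd A B m) (a : ℕ) :
    (m a).natAbs < 2 ^ B := by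
  by_cases h : m a = 0
  · simp [h]
  · exact (hm a h).2

/-- There are at most `A` nonzero registers. The crude bound of `A` bits for an address suffices,
since `A` will be polynomial. -/
theorem Bdd.bits_le {A B : ℕ} {m : Memory} (hm : Bdd A B m) : m.bits ≤ A * (A + B + 1) := by
  unfold Memory.bits Finsupp.sum
  have hsub : m.support ⊆ Finset.range A := fun a ha =>
    Finset.mem_range.2 (hm a (Finsupp.mem_support_iff.1 ha)).1
  calc ∑ a ∈ m.support, (Nat.size a + Nat.size (m a).natAbs + 1)
      ≤ ∑ a ∈ m.support, (A + B + 1) := by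
        refine Finset.sum_le_sum fun a ha => ?_
        have h := hm a (Finsupp.mem_support_iff.1 ha)
        have h1 : Nat.size a ≤ A := Nat.size_le.2 (h.1.trans Nat.lt_two_pow_self)
        have h2 : Nat.size (m a).natAbs ≤ B := Nat.size_le.2 h.2
        omega
    _ ≤ ∑ a ∈ Finset.range A, (A + B + 1) :=
        Finset.sum_le_sum_of_subset hsub
    _ = A * (A + B + 1) := by simp

theorem upd_apply (m : Memory) (i : ℕ) (v : ℤ) (a : ℕ) :
    (m.update i v) a = if a = i then v else m a := by
  rw [Finsupp.coe_update, Function.update_apply]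

theorem Bdd.update {A B : ℕ} {m : Memory} (hm : Bdd A B m) {i : ℕ} {v : ℤ} (hi : i < A)
    (hv : -(2 ^ B : ℤ) < v ∧ v < 2 ^ B) : Bdd A B (m.update i v) := by
  intro a ha
  rw [upd_apply] at ha ⊢
  split_ifs with h
  · refine ⟨h ▸ hi, ?_⟩
    zify
    exact abs_lt.2 hv
  · rw [if_neg h] at ha
    exact hm a ha

/-- The register that an instruction writes to. -/
def Instr.target : Instr → Memory → ℕ
  | .const i _, _ => i
  | .add i _ _, _ => i
  | .sub i _ _, _ => i
  | .mul i _ _, _ => i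
  | .load i _, _ => i
  | .store i _, m => (m i).toNat
  | .input i _, _ => i

/-- The value that an instruction writes. -/
def Instr.value (inp : List ℕ) : Instr → Memory → ℤ
  | .const _ c, _ => c
  | .add _ j k, m => m j + m k
  | .sub _ j k, m => m j - m k
  | .mul _ j k, m => m j * m k
  | .load _ j, m => m (m j).toNat
  | .store _ j, m => m j
  | .input _ j, m => ((inp.getD (m j).toNat 0 : ℕ) : ℤ)

theorem Instr.apply_eq (inp : List ℕ) (a : Instr) (m : Memory) :
    a.apply inp m = m.update (a.target m) (a.value inp m) := by
  cases a <;> rfl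

/-- `p`, started in `m`, halts after at most `k` steps of cost at most `κ` within the bounds `A`
and `B`, in a memory with property `Q`. -/
def Ev (inp : List ℕ) (A B κ : ℕ) (p : Program) (m : Memory) (k : ℕ) (Q : Memory → Prop) : Prop :=
  ∃ m' t s, Runs inp p m m' t s ∧ t ≤ k * κ ∧ s ≤ A * (A + B + 1) ∧ Bdd A B m' ∧ Q m'

section rules

variable {inp : List ℕ} {A B κ : ℕ}

theorem Ev.mono {p : Program} {m : Memory} {k k' : ℕ} {Q Q' : Memory → Prop}
    (h : Ev inp A B κ p m k Q) (hk : k ≤ k') (hQ : ∀ m', Bdd A B m' → Q m' → Q' m') :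
    Ev inp A B κ p m k' Q' := by
  obtain ⟨m', t, s, hr, ht, hs, hb, hq⟩ := h
  exact ⟨m', t, s, hr, ht.trans (Nat.mul_le_mul_right _ hk), hs, hb, hQ m' hb hq⟩

/-- `B` may grow while `κ` stays the same. This keeps the time independent of `w` and `ℓ` even
though they are loaded into registers. -/
theorem Ev.mono_bound {p : Program} {m : Memory} {k B' κ' : ℕ} {Q : Memory → Prop}
    (h : Ev inp A B κ p m k Q) (hB : B ≤ B') (hκ : κ ≤ κ') : Ev inp A B' κ' p m k Q := by
  obtain ⟨m', t, s, hr, ht, hs, hb, hq⟩ := h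
  exact ⟨m', t, s, hr, ht.trans (Nat.mul_le_mul_left _ hκ),
    hs.trans (Nat.mul_le_mul_left _ (by omega)), hb.mono hB, hq⟩

theorem Ev.skip {m : Memory} {Q : Memory → Prop} (hκ : 1 ≤ κ) (hm : Bdd A B m) (hQ : Q m) :
    Ev inp A B κ .skip m 1 Q :=
  ⟨m, 1, m.bits, .skip m, by omega, hm.bits_le, hm, hQ⟩

theorem Ev.seq {p q : Program} {m : Memory} {k l : ℕ} {Q : Memory → Prop}
    (h : Ev inp A B κ p m k fun m' => Ev inp A B κ q m' l Q) :
    Ev inp A B κ (.seq p q) m (k + l) Q := by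
  obtain ⟨m', t, s, hr, ht, hs, -, m'', t', s', hr', ht', hs', hb, hq⟩ := h
  exact ⟨m'', t + t', max s s', .seq hr hr', by rw [add_mul]; omega, max_le hs hs', hb, hq⟩

theorem Ev.andThen {p q : Program} {m : Memory} {k l : ℕ} {R Q : Memory → Prop}
    (h : Ev inp A B κ p m k R) (hq : ∀ m', Bdd A B m' → R m' → Ev inp A B κ q m' l Q) :
    Ev inp A B κ (.seq p q) m (k + l) Q :=
  Ev.seq (h.mono le_rfl hq)

theorem Ev.ite {i : ℕ} {p q : Program} {m : Memory} {k : ℕ} {Q : Memory → Prop} (hκ : 1 ≤ κ)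
    (h1 : 0 < m i → Ev inp A B κ p m k Q) (h2 : ¬ 0 < m i → Ev inp A B κ q m k Q) :
    Ev inp A B κ (.ite i p q) m (1 + k) Q := by
  by_cases hi : 0 < m i
  · obtain ⟨m', t, s, hr, ht, hs, hb, hq⟩ := h1 hi
    exact ⟨m', 1 + t, s, .ite_pos hi hr, by rw [add_mul]; omega, hs, hb, hq⟩
  · obtain ⟨m', t, s, hr, ht, hs, hb, hq⟩ := h2 hi
    exact ⟨m', 1 + t, s, .ite_neg hi hr, by rw [add_mul]; omega, hs, hb, hq⟩

theorem Ev.loop_stop {i : ℕ} {p : Program} {m : Memory} {Q : Memory → Prop} (hκ : 1 ≤ κ)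
    (hm : Bdd A B m) (hi : ¬ 0 < m i) (hQ : Q m) : Ev inp A B κ (.loop i p) m 1 Q :=
  ⟨m, 1, m.bits, Runs.loop_stop hi, by omega, hm.bits_le, hm, hQ⟩

theorem Ev.loop_step {i : ℕ} {p : Program} {m : Memory} {k l : ℕ} {Q : Memory → Prop}
    (hκ : 1 ≤ κ) (hi : 0 < m i)
    (h : Ev inp A B κ p m k fun m' => Ev inp A B κ (.loop i p) m' l Q) :
    Ev inp A B κ (.loop i p) m (1 + k + l) Q := by
  obtain ⟨m', t, s, hr, ht, hs, -, m'', t', s', hr', ht', hs', hb, hq⟩ := h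
  exact ⟨m'', 1 + t + t', max s s', .loop_step hi hr hr', by rw [add_mul, add_mul]; omega,
    max_le hs hs', hb, hq⟩

/-- The rule for loops whose number of iterations is known in advance. -/
theorem Ev.loop {i : ℕ} {p : Program} {k : ℕ} (I : ℕ → Memory → Prop) (hκ : 1 ≤ κ)
    (h0 : ∀ m, I 0 m → ¬ 0 < m i)
    (hs : ∀ j m, Bdd A B m → I (j + 1) m → 0 < m i ∧ Ev inp A B κ p m k (I j))
    {j : ℕ} {m : Memory} (hm : Bdd A B m) (hI : I j m) :
    Ev inp A B κ (.loop i p) m (j * (k + 1) + 1) (I 0) := by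
  induction j generalizing m with
  | zero => exact (Ev.loop_stop hκ hm (h0 m hI) hI).mono (by omega) fun _ _ h => h
  | succ j ih =>
    obtain ⟨hi, hb⟩ := hs j m hm hI
    refine (Ev.loop_step (l := j * (k + 1) + 1) hκ hi
      (hb.mono le_rfl fun m' hm' h' => ih hm' h')).mono (by ring_nf; omega) fun _ _ h => h

/-- Only multiplications cost more than 1, and their factors have at most `B` bits. This is where
the condition on `κ` in the specifications comes from. -/
theorem Instr.cost_le {B : ℕ} (hκ : 1 + B * B ≤ κ) (a : Instr) (m : Memory) (hm : Bdd A B m) :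
    a.cost m ≤ κ := by
  cases a with
  | mul i j k =>
    refine le_trans ?_ hκ
    exact Nat.add_le_add_left (Nat.mul_le_mul (Nat.size_le.2 (hm.natAbs_lt j))
      (Nat.size_le.2 (hm.natAbs_lt k))) 1
  | _ => exact le_trans (Nat.le_add_right 1 (B * B)) hκ

/-- A sequence of instructions. -/
def block : List Instr → Program
  | [] => .skip
  | a :: l => .seq (.instr a) (block l)

/-- The memory after a sequence of instructions. -/
noncomputable def blockRun (inp : List ℕ) : List Instr → Memory → Memory
  | [], m => m
  | a :: l, m => blockRun inp l (m.update (a.target m) (a.value inp m))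

/-- All writes of a sequence of instructions respect the bounds `A` and `B`. -/
def blockOk (inp : List ℕ) (A B : ℕ) : List Instr → Memory → Prop
  | [], _ => True
  | a :: l, m => (a.target m < A ∧ -(2 ^ B : ℤ) < a.value inp m ∧ a.value inp m < 2 ^ B) ∧
      blockOk inp A B l (m.update (a.target m) (a.value inp m))

/-- For straight-line code everything reduces to unfolding `blockOk` (no overflow) and `blockRun`
(the result), which the simplifier can do. -/
theorem Ev.block {l : List Instr} {m : Memory} {Q : Memory → Prop} (hκ : 1 ≤ κ)
    (hc : ∀ a ∈ l, ∀ m, Bdd A B m → a.cost m ≤ κ) (hm : Bdd A B m)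
    (hok : blockOk inp A B l m) (hQ : Q (blockRun inp l m)) :
    Ev inp A B κ (block l) m (l.length + 1) Q := by
  induction l generalizing m with
  | nil => exact Ev.skip hκ hm hQ
  | cons a l ih =>
    obtain ⟨⟨h1, h2⟩, h3⟩ := hok
    have hm' := hm.update h1 h2
    have h := ih (fun b hb => hc b (List.mem_cons_of_mem _ hb)) hm' h3 hQ
    refine (Ev.seq (k := 1) (l := l.length + 1) ⟨_, _, _, .instr a m, ?_, ?_, ?_, ?_⟩).mono
      (by simp only [List.length_cons]; omega) fun _ _ h => h
    · rw [one_mul]; exact hc a (List.mem_cons_self ..) m hm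
    · rw [Instr.apply_eq]; exact max_le hm.bits_le hm'.bits_le
    · rw [Instr.apply_eq]; exact hm'
    · rw [Instr.apply_eq]; exact h

end rules

end RAM

/-! ### Summation over the values of a function on a list of points -/

/-- The sum of `F` over all functions that arise from `c` by changing the values on `l`. -/
def sumOver {S : Type*} [Fintype S] : List ℕ → ((ℕ → S) → ℤ) → (ℕ → S) → ℤ
  | [], F, c => F c
  | v :: l, F, c => ∑ s : S, sumOver l F (Function.update c v s)

/-- `F` does not depend on the values at the points of `l`. -/
def IndepOf {S : Type*} (l : List ℕ) (F : (ℕ → S) → ℤ) : Prop :=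
  ∀ c c' : ℕ → S, (∀ x, x ∉ l → c x = c' x) → F c = F c'

section sumOver

variable {S : Type*} [Fintype S]

/-- Points of `l` are overwritten by the summation, so only the points of `D` outside `l` still
matter. -/
theorem sumOver_congr_ctx {F : (ℕ → S) → ℤ} {D : Set ℕ}
    (hF : ∀ c c' : ℕ → S, (∀ x ∈ D, c x = c' x) → F c = F c') (l : List ℕ) (c c' : ℕ → S)
    (h : ∀ x ∈ D, x ∉ l → c x = c' x) : sumOver l F c = sumOver l F c' := by
  induction l generalizing c c' with
  | nil => exact hF c c' fun x hx => h x hx (by simp)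
  | cons v l ih =>
    refine Finset.sum_congr rfl fun s _ => ih _ _ fun x hx hxl => ?_
    by_cases hxv : x = v
    · simp [hxv]
    · rw [Function.update_of_ne hxv, Function.update_of_ne hxv]
      exact h x hx (by simp [hxv, hxl])

theorem sumOver_mul_left {F G : (ℕ → S) → ℤ} (l : List ℕ) (hF : IndepOf l F) (c : ℕ → S) :
    sumOver l (fun c => F c * G c) c = F c * sumOver l G c := by
  induction l generalizing c with
  | nil => rfl
  | cons v l ih =>
    simp only [sumOver]
    rw [Finset.mul_sum]
    refine Finset.sum_congr rfl fun s _ => ?_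
    rw [ih fun c c' h => hF c c' fun x hx => h x fun hxl => hx (List.mem_cons_of_mem _ hxl)]
    congr 1
    refine hF _ _ fun x hx => Function.update_of_ne ?_ _ _
    rintro rfl
    exact hx (List.mem_cons_self ..)

/-- The distributive law: neither factor sees the summation variables of the other one. -/
theorem sumOver_append_mul {F G : (ℕ → S) → ℤ} (l₁ l₂ : List ℕ) (hF : IndepOf l₂ F)
    (hG : IndepOf l₁ G) (c : ℕ → S) :
    sumOver (l₁ ++ l₂) (fun c => F c * G c) c = sumOver l₁ F c * sumOver l₂ G c := by
  induction l₁ generalizing c with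
  | nil => exact sumOver_mul_left l₂ hF c
  | cons v l ih =>
    simp only [sumOver, List.cons_append]
    rw [Finset.sum_mul]
    refine Finset.sum_congr rfl fun s _ => ?_
    rw [ih fun c c' h => hG c c' fun x hx => h x fun hxl => hx (List.mem_cons_of_mem _ hxl)]
    congr 1
    refine sumOver_congr_ctx (D := {x | x ≠ v}) (fun c c' h => ?_) l₂ _ _ fun x hx _ =>
      Function.update_of_ne hx _ _
    exact hG c c' fun x hx => h x fun hxv => hx (by simp [hxv])

theorem IndepOf.prod {l : List ℕ} {G : ℕ → (ℕ → S) → ℤ} (L : List ℕ)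
    (hG : ∀ b ∈ L, IndepOf l (G b)) : IndepOf l fun c => (L.map (G · c)).prod := by
  intro c c' h
  show (L.map (G · c)).prod = (L.map (G · c')).prod
  rw [List.map_congr_left fun b hb => hG b hb c c' h]

/-- This is the factorization over the children of a node, with `sub b` the subtree of a child `b`
and `G b` the product of the weights in it. -/
theorem sumOver_flatMap_prod (L : List ℕ) (sub : ℕ → List ℕ) (G : ℕ → (ℕ → S) → ℤ)
    (hL : L.Nodup)
    (h : ∀ b ∈ L, ∀ b' ∈ L, b ≠ b' → IndepOf (sub b) (G b')) (c : ℕ → S) :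
    sumOver (L.flatMap sub) (fun c => (L.map (G · c)).prod) c =
      (L.map fun b => sumOver (sub b) (G b) c).prod := by
  induction L with
  | nil => rfl
  | cons b L ih =>
    rw [List.nodup_cons] at hL
    simp only [List.flatMap_cons, List.map_cons, List.prod_cons]
    rw [sumOver_append_mul (F := G b) (G := fun c => (L.map (G · c)).prod)]
    · rw [ih hL.2 fun b hb b' hb' => h b (List.mem_cons_of_mem _ hb) b' (List.mem_cons_of_mem _ hb')]
    · intro c c' hcc
      revert hcc
      intro hcc
      -- Independence of each block gives independence of their union by changing the context one
      -- block at a time, through the hybrid `c''`.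
      have key : ∀ (L' : List ℕ), (∀ b' ∈ L', b' ∈ L) → ∀ c c' : ℕ → S,
          (∀ x, x ∉ L'.flatMap sub → c x = c' x) → G b c = G b c' := by
        intro L'
        induction L' with
        | nil => intro _ c c' h; rw [funext fun x => h x (by simp)]
        | cons b' L' ih' =>
          intro hL' c c' hc
          classical
          let c'' : ℕ → S := fun x => if x ∈ sub b' then c x else c' x
          have h1 : G b c'' = G b c' := by
            refine h b' (List.mem_cons_of_mem _ (hL' b' (List.mem_cons_self ..))) b
              (List.mem_cons_self ..) ?_ _ _ fun x hx => by simp [c'', hx]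
            rintro rfl
            exact hL.1 (hL' b' (List.mem_cons_self ..))
          rw [← h1]
          refine ih' (fun x hx => hL' x (List.mem_cons_of_mem _ hx)) _ _ fun x hx => ?_
          by_cases hxb : x ∈ sub b'
          · simp [c'', hxb]
          · simp only [c'', hxb, if_false]
            exact hc x (by rw [List.flatMap_cons, List.mem_append]; tauto)
      exact key L (fun _ h => h) c c' hcc
    · exact IndepOf.prod L fun b' hb' => h b (List.mem_cons_self ..) b' (List.mem_cons_of_mem _ hb')
        (by rintro rfl; exact hL.1 hb')

end sumOver

/-! ### Trees on the nodes `0, …, n` -/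

/-- A tree on the nodes `0, …, n` with root `0`, parents `par` and depths `dep`, which are at most
`τ`. -/
structure IdTree (n τ : ℕ) (par dep : ℕ → ℕ) : Prop where
  dep_zero : dep 0 = 0
  par_zero : par 0 = 0
  par_le : ∀ b, 1 ≤ b → b ≤ n → par b ≤ n
  dep_par : ∀ b, 1 ≤ b → b ≤ n → dep b = dep (par b) + 1
  dep_le : ∀ b, b ≤ n → dep b ≤ τ

/-- The nodes of the subtree of `a` within `k` levels, without `a` itself if `a` is `0`. -/
def subtreeList (n : ℕ) (par : ℕ → ℕ) : ℕ → ℕ → List ℕ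
  | 0, _ => []
  | k + 1, a => a :: (List.range n).flatMap fun i =>
      if par (i + 1) = a then subtreeList n par k (i + 1) else []

/-- The sum over all contexts on the subtree of `a` of the product of the local weights `F`,
computed recursively down to `k` levels. -/
def evalTree {S : Type*} [Fintype S] (n : ℕ) (par : ℕ → ℕ) (F : ℕ → (ℕ → S) → ℤ) :
    ℕ → ℕ → (ℕ → S) → ℤ
  | 0, _, _ => 1
  | k + 1, a, c => ∑ s : S, F a (Function.update c a s) *
      ((List.range n).map fun i =>
        if par (i + 1) = a then evalTree n par F k (i + 1) (Function.update c a s) else 1).prod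

namespace IdTree

variable {n τ : ℕ} {par dep : ℕ → ℕ} (t : IdTree n τ par dep)

include t

theorem iterate_le {x : ℕ} (hx : x ≤ n) (j : ℕ) : par^[j] x ≤ n := by
  induction j with
  | zero => exact hx
  | succ j ih =>
    rw [Function.iterate_succ_apply']
    rcases Nat.eq_zero_or_pos (par^[j] x) with h | h
    · rw [h, t.par_zero]; exact Nat.zero_le n
    · exact t.par_le _ h ih

/-- The iterate must not be the root: `par 0 = 0`, so beyond the root the depth no longer falls. -/
theorem dep_iterate {x : ℕ} (hx : x ≤ n) (j : ℕ) (h : 1 ≤ par^[j] x) :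
    dep x = dep (par^[j] x) + j := by
  induction j with
  | zero => rfl
  | succ j ih =>
    rw [Function.iterate_succ_apply'] at h ⊢
    have h1 : 1 ≤ par^[j] x := by
      by_contra h0
      have : par^[j] x = 0 := by omega
      rw [this, t.par_zero] at h
      omega
    rw [ih h1, t.dep_par _ h1 (t.iterate_le hx j)]
    ring

theorem mem_subtreeList {k a x : ℕ} (ha : a ≤ n) (h : x ∈ subtreeList n par k a) :
    x ≤ n ∧ ∃ j < k, par^[j] x = a := by
  induction k generalizing a with
  | zero => simp [subtreeList] at h
  | succ k ih =>
    simp only [subtreeList, List.mem_cons, List.mem_flatMap, List.mem_range] at h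
    rcases h with rfl | ⟨i, hi, h⟩
    · exact ⟨ha, 0, by omega, rfl⟩
    · split_ifs at h with hp
      · obtain ⟨hx, j, hj, hja⟩ := ih (by omega) h
        exact ⟨hx, j + 1, by omega, by rw [Function.iterate_succ_apply', hja, hp]⟩
      · simp at h

theorem mem_subtreeList_of_iterate {k a x j : ℕ} (hx : x ≤ n) (hj : j < k)
    (h : par^[j] x = a) : x ∈ subtreeList n par k a := by
  induction j generalizing k a with
  | zero =>
    obtain ⟨k, rfl⟩ : ∃ k', k = k' + 1 := ⟨k - 1, by omega⟩
    obtain rfl : x = a := h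
    exact List.mem_cons_self ..
  | succ j ih =>
    obtain ⟨k, rfl⟩ : ∃ k', k = k' + 1 := ⟨k - 1, by omega⟩
    rw [Function.iterate_succ_apply'] at h
    -- If the walk has already arrived at the root, its last step stays there and a shorter walk
    -- does the same.
    rcases Nat.eq_zero_or_pos (par^[j] x) with h0 | h0
    · rw [h0, t.par_zero] at h
      exact ih (by omega) (h0.trans h)
    · have hle := t.iterate_le hx j
      have := ih (k := k) (a := par^[j] x) (by omega) rfl
      simp only [subtreeList, List.mem_cons, List.mem_flatMap, List.mem_range]
      refine Or.inr ⟨par^[j] x - 1, by omega, ?_⟩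
      rw [Nat.sub_add_cancel h0, if_pos h]
      exact this

theorem dep_le_of_mem {k a x : ℕ} (ha : a ≤ n) (h : x ∈ subtreeList n par k a) :
    dep a ≤ dep x := by
  obtain ⟨hx, j, -, hj⟩ := t.mem_subtreeList ha h
  rcases Nat.eq_zero_or_pos a with rfl | h1
  · rw [t.dep_zero]; exact Nat.zero_le _
  · rw [t.dep_iterate hx j (by omega), hj]; omega

theorem not_mem_subtreeList_child {k i a : ℕ} (hi : i < n) (hp : par (i + 1) = a) :
    a ∉ subtreeList n par k (i + 1) := fun h => by
  have h1 := t.dep_le_of_mem (by omega) h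
  have h2 := t.dep_par (i + 1) (by omega) (by omega)
  rw [hp] at h2
  omega

/-- A common node would have both siblings as ancestors. They have equal depth, so they are the same
iterate of `par`. -/
theorem disjoint_children {k a i j : ℕ} (hi : i < n) (hj : j < n) (hpi : par (i + 1) = a)
    (hpj : par (j + 1) = a) (hij : i ≠ j) :
    (subtreeList n par k (i + 1)).Disjoint (subtreeList n par k (j + 1)) := by
  intro x hxi hxj
  obtain ⟨hx, p, -, hp⟩ := t.mem_subtreeList (by omega) hxi
  obtain ⟨-, q, -, hq⟩ := t.mem_subtreeList (by omega) hxj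
  have h1 := t.dep_iterate hx p (by omega)
  have h2 := t.dep_iterate hx q (by omega)
  rw [hp, t.dep_par (i + 1) (by omega) (by omega), hpi] at h1
  rw [hq, t.dep_par (j + 1) (by omega) (by omega), hpj] at h2
  obtain rfl : p = q := by omega
  omega

theorem nodup_subtreeList {k a : ℕ} (ha : a ≤ n) : (subtreeList n par k a).Nodup := by
  induction k generalizing a with
  | zero => exact List.nodup_nil
  | succ k ih =>
    rw [subtreeList, List.nodup_cons]
    constructor
    · simp only [List.mem_flatMap, List.mem_range, not_exists, not_and]
      intro i hi h
      split_ifs at h with hp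
      · exact t.not_mem_subtreeList_child hi hp h
      · simp at h
    · rw [List.nodup_flatMap]
      constructor
      · intro i hi
        rw [List.mem_range] at hi
        split_ifs
        · exact ih (by omega)
        · exact List.nodup_nil
      · refine List.Nodup.pairwise_of_forall_ne List.nodup_range fun i hi j hj hij => ?_
        rw [List.mem_range] at hi hj
        simp only [Function.onFun]
        split_ifs with h1 h2
        · exact t.disjoint_children hi hj h1 h2 hij
        all_goals simp

theorem sum_length_children {k a : ℕ} :
    (subtreeList n par (k + 1) a).length =
      1 + ∑ i ∈ Finset.range n,
        if par (i + 1) = a then (subtreeList n par k (i + 1)).length else 0 := by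
  rw [subtreeList, List.length_cons, List.length_flatMap, add_comm]
  congr 1
  simp only [Finset.sum, Finset.range_val]
  rw [Multiset.range, Multiset.map_coe, Multiset.sum_coe]
  congr 1
  refine List.map_congr_left fun i _ => ?_
  split_ifs <;> rfl

theorem length_subtreeList_le {k a : ℕ} (ha : a ≤ n) : (subtreeList n par k a).length ≤ n + 1 := by
  have h := (t.nodup_subtreeList (k := k) ha).subperm (l₂ := List.range (n + 1)) fun x hx =>
    List.mem_range.2 (Nat.lt_succ_of_le (t.mem_subtreeList ha hx).1)
  simpa using h.length_le

variable {S : Type*} [Fintype S] {F : ℕ → (ℕ → S) → ℤ}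

/-- `evalTree` depends on the context only at proper ancestors. -/
theorem evalTree_congr
    (hF : ∀ a ≤ n, ∀ c c' : ℕ → S, (∀ j, c (par^[j] a) = c' (par^[j] a)) → F a c = F a c')
    {k a : ℕ} (ha : a ≤ n) {c c' : ℕ → S} (h : ∀ j, par^[j] a ≠ a → c (par^[j] a) = c' (par^[j] a)) :
    evalTree n par F k a c = evalTree n par F k a c' := by
  induction k generalizing a c c' with
  | zero => rfl
  | succ k ih =>
    have hu : ∀ s : S, ∀ j, Function.update c a s (par^[j] a) = Function.update c' a s (par^[j] a) := by
      intro s j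
      by_cases hj : par^[j] a = a
      · simp [hj]
      · rw [Function.update_of_ne hj, Function.update_of_ne hj, h j hj]
    refine Finset.sum_congr rfl fun s _ => ?_
    rw [hF a ha _ _ (hu s)]
    congr 2
    refine List.map_congr_left fun i hi => ?_
    rw [List.mem_range] at hi
    split_ifs with hp
    · refine ih (by omega) fun j hj => ?_
      cases j with
      | zero => exact absurd rfl hj
      | succ j => rw [Function.iterate_succ_apply, hp]; exact hu s j
    · rfl

/-- The nodes below `a` within `k` levels. -/
def _root_.belowList (n : ℕ) (par : ℕ → ℕ) (k a : ℕ) : List ℕ :=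
  (List.range n).flatMap fun i => if par (i + 1) = a then subtreeList n par k (i + 1) else []

/-- The subtrees of different children share no variables: a weight `F x` reads the context only on
the path from `x` to the root, and this path meets just one of the subtrees. -/
theorem children_eq_sumOver
    (hF : ∀ a ≤ n, ∀ c c' : ℕ → S, (∀ j, c (par^[j] a) = c' (par^[j] a)) → F a c = F a c')
    {k a : ℕ} (c : ℕ → S)
    (ih : ∀ b ≤ n, evalTree n par F k b c =
      sumOver (subtreeList n par k b) (fun c => ((subtreeList n par k b).map (F · c)).prod) c) :
    ((List.range n).map fun i =>
        if par (i + 1) = a then evalTree n par F k (i + 1) c else 1).prod =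
      sumOver (belowList n par k a) (fun c => ((belowList n par k a).map (F · c)).prod) c := by
  have := sumOver_flatMap_prod (List.range n)
    (fun i => if par (i + 1) = a then subtreeList n par k (i + 1) else [])
    (fun i c => ((if par (i + 1) = a then subtreeList n par k (i + 1) else []).map (F · c)).prod)
    List.nodup_range ?_ c
  · have h2 : (fun c : ℕ → S => ((belowList n par k a).map (F · c)).prod) =
        fun c => ((List.range n).map fun i =>
          ((if par (i + 1) = a then subtreeList n par k (i + 1) else []).map (F · c)).prod).prod := by
      funext c
      rw [belowList, List.map_flatMap, List.flatMap, List.prod_flatten, List.map_map]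
      rfl
    rw [h2, belowList, this]
    congr 1
    refine List.map_congr_left fun i hi => ?_
    rw [List.mem_range] at hi
    split_ifs with hp
    · rw [ih (i + 1) (by omega)]
    · rfl
  · intro i hi j hj hij c c' h
    rw [List.mem_range] at hi hj
    simp only
    congr 1
    refine List.map_congr_left fun x hx => ?_
    split_ifs at hx with hpj
    · obtain ⟨hxn, q, -, hq⟩ := t.mem_subtreeList (by omega) hx
      refine hF x hxn c c' fun m => h _ fun hm => ?_
      split_ifs at hm with hpi
      -- An ancestor of `x` in the subtree of `i + 1` would make both `i + 1` and `j + 1` ancestors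
      -- of `x`; equal depths force them to coincide.
      · obtain ⟨-, p, -, hp⟩ := t.mem_subtreeList (by omega) hm
        rw [← Function.iterate_add_apply] at hp
        have h1 := t.dep_iterate hxn (p + m) (by omega)
        have h2 := t.dep_iterate hxn q (by omega)
        rw [hp, t.dep_par (i + 1) (by omega) (by omega), hpi] at h1
        rw [hq, t.dep_par (j + 1) (by omega) (by omega), hpj] at h2
        have : p + m = q := by omega
        rw [this, hq] at hp
        omega
      · simp at hm
    · simp at hx

/-- The weight `F a` leaves the sum over the nodes below `a`, because no ancestor of `a` lies below
`a`. By induction the nested evaluation is the full sum. -/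
theorem evalTree_eq_sumOver
    (hF : ∀ a ≤ n, ∀ c c' : ℕ → S, (∀ j, c (par^[j] a) = c' (par^[j] a)) → F a c = F a c')
    {k a : ℕ} (ha : a ≤ n) (c : ℕ → S) :
    evalTree n par F k a c =
      sumOver (subtreeList n par k a) (fun c => ((subtreeList n par k a).map (F · c)).prod) c := by
  induction k generalizing a c with
  | zero => rfl
  | succ k ih =>
    simp only [evalTree, subtreeList, sumOver, List.map_cons, List.prod_cons]
    refine Finset.sum_congr rfl fun s _ => ?_
    rw [← belowList, sumOver_mul_left, t.children_eq_sumOver hF _ fun b hb => ih hb _]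
    refine fun c c' h => hF a ha c c' fun j => h _ fun hj => ?_
    simp only [belowList, List.mem_flatMap, List.mem_range] at hj
    obtain ⟨i, hi, hj⟩ := hj
    split_ifs at hj with hp
    · have h1 := t.dep_le_of_mem (by omega) hj
      have h2 := t.dep_par (i + 1) (by omega) (by omega)
      rw [hp] at h2
      rcases Nat.eq_zero_or_pos (par^[j] a) with h0 | h0
      · rw [h0, t.dep_zero] at h1; omega
      · have := t.dep_iterate ha j h0
        omega
    · simp at hj

end IdTree

/-! ### Depth-first evaluation -/

/-- The states of the depth-first evaluation: the current node, the candidate for the next child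
(or `0` if the local weight has to be computed first), the context, and for each node the
current product and the sum of the products so far. -/
structure DfsState where
  cur : ℕ
  cand : ℕ
  ctx : ℕ → Bool × Bool
  prod : ℕ → ℤ
  sum : ℕ → ℤ

namespace DfsState

/-- One step of the depth-first evaluation. -/
def step (n : ℕ) (par : ℕ → ℕ) (F : ℕ → (ℕ → Bool × Bool) → ℤ) (σ : DfsState) : DfsState :=
  if σ.cand = 0 then
    { σ with prod := Function.update σ.prod σ.cur (F σ.cur σ.ctx), cand := 1 }
  else if σ.cand ≤ n then
    if par σ.cand = σ.cur then
      { σ with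
        cur := σ.cand
        cand := 0
        ctx := Function.update σ.ctx σ.cand (false, false)
        sum := Function.update σ.sum σ.cand 0 }
    else { σ with cand := σ.cand + 1 }
  else if (σ.ctx σ.cur).2 then
    if (σ.ctx σ.cur).1 then
      { σ with
        cur := par σ.cur
        cand := σ.cur + 1
        sum := Function.update σ.sum σ.cur (σ.sum σ.cur + σ.prod σ.cur)
        prod := Function.update σ.prod (par σ.cur)
          (σ.prod (par σ.cur) * (σ.sum σ.cur + σ.prod σ.cur)) }
    else
      { σ with
        cand := 0
        ctx := Function.update σ.ctx σ.cur (true, false)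
        sum := Function.update σ.sum σ.cur (σ.sum σ.cur + σ.prod σ.cur) }
  else
    { σ with
      cand := 0
      ctx := Function.update σ.ctx σ.cur ((σ.ctx σ.cur).1, true)
      sum := Function.update σ.sum σ.cur (σ.sum σ.cur + σ.prod σ.cur) }

/-- The bounds that hold throughout the evaluation. -/
structure Good (n : ℕ) (W : ℤ) (σ : DfsState) : Prop where
  cur_le : σ.cur ≤ n
  cand_le : σ.cand ≤ n + 1
  cur_pos : σ.cand = 0 → 1 ≤ σ.cur
  prod_le : ∀ x, |σ.prod x| ≤ W
  sum_le : ∀ x, |σ.sum x| ≤ W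

/-- `σ'` is reached from `σ` in the given number of steps, through good states that are not
final. -/
inductive Reach (n : ℕ) (par : ℕ → ℕ) (F : ℕ → (ℕ → Bool × Bool) → ℤ) (W : ℤ) :
    ℕ → DfsState → DfsState → Prop
  | refl {σ : DfsState} (h : Good n W σ) : Reach n par F W 0 σ σ
  | head {j : ℕ} {σ σ' : DfsState} (h : Good n W σ) (hf : ¬ (σ.cur = 0 ∧ n < σ.cand))
      (hr : Reach n par F W j (step n par F σ) σ') : Reach n par F W (j + 1) σ σ'

variable {n : ℕ} {par : ℕ → ℕ} {F : ℕ → (ℕ → Bool × Bool) → ℤ} {W : ℤ}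

theorem Reach.good_left {j : ℕ} {σ σ' : DfsState} (h : Reach n par F W j σ σ') : Good n W σ := by
  cases h <;> assumption

theorem Reach.good_right {j : ℕ} {σ σ' : DfsState} (h : Reach n par F W j σ σ') : Good n W σ' := by
  induction h <;> assumption

theorem Reach.trans {i j : ℕ} {σ σ' σ'' : DfsState} (h : Reach n par F W i σ σ')
    (h' : Reach n par F W j σ' σ'') : Reach n par F W (i + j) σ σ'' := by
  induction h with
  | refl _ => rwa [zero_add]
  | head hg hf _ ih =>
    rw [Nat.add_right_comm]
    exact .head hg hf (ih h')

theorem Reach.single {σ : DfsState} (h : Good n W σ) (hf : ¬ (σ.cur = 0 ∧ n < σ.cand))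
    (h' : Good n W (step n par F σ)) : Reach n par F W 1 σ (step n par F σ) :=
  .head h hf (.refl h')

end DfsState

theorem list_range_map_prod (n : ℕ) (f : ℕ → ℤ) :
    ((List.range n).map f).prod = ∏ i ∈ Finset.range n, f i := by
  simp only [Finset.prod, Finset.range_val]
  rw [Multiset.range, Multiset.map_coe, Multiset.prod_coe]

theorem update_bound {f : ℕ → ℤ} {W v : ℤ} (hf : ∀ x, |f x| ≤ W) (hv : |v| ≤ W) (a x : ℕ) :
    |Function.update f a v x| ≤ W := by
  rw [Function.update_apply]
  split_ifs
  · exact hv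
  · exact hf x

/-- The product of the values of the children of `a` among the first `j` nodes. -/
def childProd (n : ℕ) (par : ℕ → ℕ) (F : ℕ → (ℕ → Bool × Bool) → ℤ) (k a j : ℕ)
    (c : ℕ → Bool × Bool) : ℤ :=
  ∏ i ∈ Finset.range j, if par (i + 1) = a then evalTree n par F k (i + 1) c else 1

/-- The number of nodes below `a` in the subtrees of the first `j` nodes. -/
def childSize (n : ℕ) (par : ℕ → ℕ) (k a j : ℕ) : ℕ :=
  ∑ i ∈ Finset.range j, if par (i + 1) = a then (subtreeList n par k (i + 1)).length else 0

theorem evalTree_succ (n : ℕ) (par : ℕ → ℕ) (F : ℕ → (ℕ → Bool × Bool) → ℤ) (k a : ℕ)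
    (c : ℕ → Bool × Bool) :
    evalTree n par F (k + 1) a c = ∑ s : Bool × Bool, F a (Function.update c a s) *
      childProd n par F k a n (Function.update c a s) := by
  simp only [evalTree, childProd, list_range_map_prod]

namespace IdTree

open DfsState

variable {n τ : ℕ} {par dep : ℕ → ℕ} (t : IdTree n τ par dep)
  {F : ℕ → (ℕ → Bool × Bool) → ℤ} {W : ℤ} {β : ℕ}

theorem abs_childProd_le {k a j : ℕ} {c : ℕ → Bool × Bool} (hj : j ≤ n)
    (h : ∀ i < n, ∀ c, |evalTree n par F k (i + 1) c| ≤
      (4 * β : ℤ) ^ (subtreeList n par k (i + 1)).length) :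
    |childProd n par F k a j c| ≤ (4 * β : ℤ) ^ childSize n par k a j := by
  rw [childProd, childSize, Finset.abs_prod, ← Finset.prod_pow_eq_pow_sum]
  refine Finset.prod_le_prod (fun _ _ => abs_nonneg _) fun i hi => ?_
  rw [Finset.mem_range] at hi
  split_ifs
  · exact h i (by omega) c
  · simp

/-- Each node of the subtree contributes a factor 4 for its contexts and a factor `β` for its
weight. -/
theorem abs_evalTree_le (hFβ : ∀ a ≤ n, ∀ c, |F a c| ≤ β) {k a : ℕ} (ha : a ≤ n)
    (c : ℕ → Bool × Bool) :
    |evalTree n par F k a c| ≤ (4 * β : ℤ) ^ (subtreeList n par k a).length := by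
  induction k generalizing a c with
  | zero => simp [evalTree, subtreeList]
  | succ k ih =>
    rw [evalTree_succ]
    refine (Finset.abs_sum_le_sum_abs _ _).trans ?_
    have hlen : (subtreeList n par (k + 1) a).length = 1 + childSize n par k a n := by
      rw [subtreeList, List.length_cons, List.length_flatMap, add_comm, childSize]
      simp only [Finset.sum, Finset.range_val]
      rw [Multiset.range, Multiset.map_coe, Multiset.sum_coe]
      congr 2
      refine List.map_congr_left fun i _ => ?_
      split_ifs <;> rfl
    calc _ ≤ ∑ s : Bool × Bool, (β : ℤ) * (4 * β : ℤ) ^ childSize n par k a n := by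
          refine Finset.sum_le_sum fun s _ => ?_
          rw [abs_mul]
          exact mul_le_mul (hFβ a ha _) (abs_childProd_le le_rfl fun i hi c => ih (by omega) c)
            (abs_nonneg _) (by positivity)
      _ = _ := by
          rw [hlen, pow_add, pow_one, Finset.sum_const, Finset.card_univ, Fintype.card_prod,
            Fintype.card_bool, nsmul_eq_mul]
          push_cast
          ring

include t

theorem childSize_mono {k a j : ℕ} (ha : a ≤ n) (hj : j ≤ n) : childSize n par k a j ≤ n := by
  have h1 := t.sum_length_children (k := k) (a := a)
  have h2 := t.length_subtreeList_le (k := k + 1) ha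
  have h3 : childSize n par k a j ≤ childSize n par k a n :=
    Finset.sum_le_sum_of_subset (Finset.range_mono hj)
  unfold childSize at *
  omega

theorem childProd_congr
    (hF : ∀ a ≤ n, ∀ c c' : ℕ → Bool × Bool, (∀ j, c (par^[j] a) = c' (par^[j] a)) →
      F a c = F a c')
    {k a j : ℕ} (hj : j ≤ n) {c c' : ℕ → Bool × Bool}
    (h : ∀ j, c (par^[j] a) = c' (par^[j] a)) :
    childProd n par F k a j c = childProd n par F k a j c' := by
  refine Finset.prod_congr rfl fun i hi => ?_
  rw [Finset.mem_range] at hi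
  split_ifs with hp
  · refine t.evalTree_congr hF (by omega) fun j hj => ?_
    cases j with
    | zero => exact absurd rfl hj
    | succ j => rw [Function.iterate_succ_apply, hp]; exact h j
  · rfl

/-- Ancestors of `a` are at most as deep as `a`, the nodes in the subtree of a child are deeper. So
the visit of a child does not disturb the part of the context that its siblings read. -/
theorem iterate_not_mem {k a i : ℕ} (ha : a ≤ n) (hi : i < n) (hp : par (i + 1) = a) (j : ℕ) :
    par^[j] a ∉ subtreeList n par k (i + 1) := by
  intro hj
  have h1 := t.dep_le_of_mem (by omega) hj
  have h2 := t.dep_par (i + 1) (by omega) (by omega)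
  rw [hp] at h2
  rcases Nat.eq_zero_or_pos (par^[j] a) with h0 | h0
  · rw [h0, t.dep_zero] at h1; omega
  · have := t.dep_iterate ha j h0
    omega

/-- What the evaluation of the subtree of a node does to the state. -/
structure _root_.DfsState.Evaluated (par : ℕ → ℕ) (l : List ℕ) (a : ℕ) (v : ℤ)
    (σ σ' : DfsState) : Prop where
  cur : σ'.cur = par a
  cand : σ'.cand = a + 1
  prod_par : σ'.prod (par a) = σ.prod (par a) * v
  ctx : ∀ x, x ∉ l → σ'.ctx x = σ.ctx x
  sum : ∀ x, x ∉ l → σ'.sum x = σ.sum x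
  prod : ∀ x, x ∉ l → x ≠ par a → σ'.prod x = σ.prod x

/-- The evaluation is correct for all nodes with `k` levels below them. -/
def _root_.EvalSpec (n τ : ℕ) (par dep : ℕ → ℕ) (F : ℕ → (ℕ → Bool × Bool) → ℤ) (W : ℤ)
    (k : ℕ) : Prop :=
  ∀ a, 1 ≤ a → a ≤ n → dep a + k = τ + 1 → ∀ σ : DfsState, Good n W σ → σ.cur = a →
    σ.cand = 0 → σ.ctx a = (false, false) → σ.sum a = 0 →
    |σ.prod (par a) * evalTree n par F k a σ.ctx| ≤ W →
    ∃ σ' T, Reach n par F W T σ σ' ∧ T ≤ (n + 3) * 4 ^ k * (subtreeList n par k a).length ∧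
      Evaluated par (subtreeList n par k a) a (evalTree n par F k a σ.ctx) σ σ'

/-- Scanning the children of a node. -/
theorem scan
    (hF : ∀ a ≤ n, ∀ c c' : ℕ → Bool × Bool, (∀ j, c (par^[j] a) = c' (par^[j] a)) →
      F a c = F a c')
    (hW : 0 ≤ W) {k : ℕ} (ih : EvalSpec n τ par dep F W k) {a : ℕ} (ha : a ≤ n)
    (hk : dep a + k = τ) {σ : DfsState} (hσ : Good n W σ) (hcur : σ.cur = a) (hcand : σ.cand = 1)
    {j : ℕ} (hj : j ≤ n) (hb : ∀ i ≤ j, |σ.prod a * childProd n par F k a i σ.ctx| ≤ W) :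
    ∃ σ' T, Reach n par F W T σ σ' ∧ T ≤ j + (n + 3) * 4 ^ k * childSize n par k a j ∧
      σ'.cur = a ∧ σ'.cand = j + 1 ∧
      σ'.prod a = σ.prod a * childProd n par F k a j σ.ctx ∧
      ∀ x, (x = a ∨ x ∉ subtreeList n par (k + 1) a) → σ'.ctx x = σ.ctx x ∧ σ'.sum x = σ.sum x ∧
        (x ≠ a → σ'.prod x = σ.prod x) := by
  induction j with
  | zero =>
    exact ⟨σ, 0, .refl hσ, Nat.zero_le _, hcur, hcand, by simp [childProd],
      fun x _ => ⟨rfl, rfl, fun _ => rfl⟩⟩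
  | succ j ihj =>
    obtain ⟨σ', T, hr, hT, h1, h2, h3, h4⟩ := ihj (by omega) fun i hi => hb i (by omega)
    have hg := hr.good_right
    -- The earlier children changed the context only inside their subtrees, so the next child is
    -- evaluated in the original context.
    have hanc : ∀ j, σ'.ctx (par^[j] a) = σ.ctx (par^[j] a) := fun j => by
      refine (h4 _ ?_).1
      by_cases hja : par^[j] a = a
      · exact .inl hja
      · refine .inr fun hmem => ?_
        rw [subtreeList, List.mem_cons, List.mem_flatMap] at hmem
        rcases hmem with h | ⟨i, hi, h⟩
        · exact hja h
        · rw [List.mem_range] at hi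
          split_ifs at h with hp
          · exact t.iterate_not_mem ha hi hp j h
          · simp at h
    by_cases hp : par (j + 1) = a
    · have hstep : step n par F σ' =
          { σ' with
            cur := j + 1
            cand := 0
            ctx := Function.update σ'.ctx (j + 1) (false, false)
            sum := Function.update σ'.sum (j + 1) 0 } := by
        rw [step, if_neg (by omega), if_pos (by omega), if_pos (by rw [h2, h1, hp]), h2]
      have hdep := t.dep_par (j + 1) (by omega) (by omega)
      rw [hp] at hdep
      have hmem : j + 1 ∈ subtreeList n par (k + 1) a := by
        exact t.mem_subtreeList_of_iterate (j := 1) (by omega)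
          (by have := t.dep_le (j + 1) (by omega); omega) hp
      have hne : j + 1 ≠ a := by rintro rfl; omega
      have hg' : Good n W (step n par F σ') := by
        rw [hstep]
        exact ⟨by show j + 1 ≤ n; omega, Nat.zero_le _, fun _ => Nat.succ_pos j, hg.prod_le,
          update_bound hg.sum_le (by simpa using hW) _⟩
      have hev : evalTree n par F k (j + 1) (step n par F σ').ctx =
          evalTree n par F k (j + 1) σ.ctx := by
        refine t.evalTree_congr hF (by omega) fun i hi => ?_
        rw [hstep]
        show Function.update σ'.ctx (j + 1) (false, false) _ = _
        rw [Function.update_of_ne hi]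
        cases i with
        | zero => exact absurd rfl hi
        | succ i => rw [Function.iterate_succ_apply, hp]; exact hanc i
      have hprod : childProd n par F k a (j + 1) σ.ctx =
          childProd n par F k a j σ.ctx * evalTree n par F k (j + 1) σ.ctx := by
        rw [childProd, Finset.prod_range_succ, if_pos hp, ← childProd]
      have hsize : childSize n par k a (j + 1) =
          childSize n par k a j + (subtreeList n par k (j + 1)).length := by
        rw [childSize, Finset.sum_range_succ, if_pos hp, ← childSize]
      have hpr : (step n par F σ').prod = σ'.prod := by rw [hstep]
      obtain ⟨σ'', T', hr', hT', hE⟩ := ih (j + 1) (by omega) (by omega) (by omega)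
        (step n par F σ') hg' (by rw [hstep]) (by rw [hstep]) (by rw [hstep]; simp)
        (by rw [hstep]; simp) (by
          rw [hev, hpr, hp, h3, mul_assoc, ← hprod]
          exact hb (j + 1) le_rfl)
      refine ⟨σ'', T + (T' + 1), hr.trans (.head hg (by omega) hr'), ?_, by rw [hE.cur, hp],
        hE.cand, ?_, fun x hx => ?_⟩
      · rw [hsize, mul_add]; omega
      · have := hE.prod_par
        rw [hp] at this
        rw [this, hev, hpr, h3, hprod, mul_assoc]
      · have hxl : x ∉ subtreeList n par k (j + 1) := by
          rcases hx with rfl | hx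
          · exact t.not_mem_subtreeList_child (by omega) hp
          · intro hxm
            refine hx ?_
            rw [subtreeList, List.mem_cons, List.mem_flatMap]
            exact .inr ⟨j, List.mem_range.2 (by omega), by rwa [if_pos hp]⟩
        have hxj : x ≠ j + 1 := by
          rintro rfl
          rcases hx with hx | hx
          · exact hne hx
          · exact hx hmem
        obtain ⟨e1, e2, e3⟩ := h4 x hx
        refine ⟨?_, ?_, fun hxa => ?_⟩
        · rw [hE.ctx x hxl, hstep]
          show Function.update σ'.ctx (j + 1) (false, false) x = _
          rw [Function.update_of_ne hxj, e1]
        · rw [hE.sum x hxl, hstep]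
          show Function.update σ'.sum (j + 1) 0 x = _
          rw [Function.update_of_ne hxj, e2]
        · rw [hE.prod x hxl (by rwa [hp]), hpr, e3 hxa]
    · have hstep : step n par F σ' = { σ' with cand := j + 1 + 1 } := by
        rw [step, if_neg (by omega), if_pos (by omega), if_neg (by rwa [h2, h1]), h2]
      have hg' : Good n W (step n par F σ') := by
        rw [hstep]
        exact ⟨hg.cur_le, by show j + 1 + 1 ≤ n + 1; omega, fun h => absurd h (Nat.succ_ne_zero _),
          hg.prod_le, hg.sum_le⟩
      refine ⟨_, T + 1, hr.trans (.single hg (by omega) hg'), ?_, by rw [hstep]; exact h1,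
        by rw [hstep], ?_, fun x hx => by rw [hstep]; exact h4 x hx⟩
      · rw [childSize, Finset.sum_range_succ, if_neg hp, ← childSize, add_zero]; omega
      · rw [hstep]
        show σ'.prod a = _
        rw [h3, childProd, childProd, Finset.prod_range_succ, if_neg hp, mul_one]

/-- Computing the product for one choice of the context at a node. -/
theorem round
    (hF : ∀ a ≤ n, ∀ c c' : ℕ → Bool × Bool, (∀ j, c (par^[j] a) = c' (par^[j] a)) →
      F a c = F a c')
    (hFβ : ∀ a ≤ n, ∀ c, |F a c| ≤ β) (hβ : 1 ≤ β) (hW : (4 * β : ℤ) ^ (n + 1) ≤ W)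
    {k : ℕ} (ih : EvalSpec n τ par dep F W k) {a : ℕ} (ha : a ≤ n)
    (hk : dep a + k = τ) {σ : DfsState} (hσ : Good n W σ) (hcur : σ.cur = a) (hcand : σ.cand = 0) :
    ∃ σ' T, Reach n par F W T σ σ' ∧ T ≤ n + 1 + (n + 3) * 4 ^ k * childSize n par k a n ∧
      σ'.cur = a ∧ σ'.cand = n + 1 ∧
      σ'.prod a = F a σ.ctx * childProd n par F k a n σ.ctx ∧
      ∀ x, (x = a ∨ x ∉ subtreeList n par (k + 1) a) → σ'.ctx x = σ.ctx x ∧ σ'.sum x = σ.sum x ∧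
        (x ≠ a → σ'.prod x = σ.prod x) := by
  have h4β : (1 : ℤ) ≤ 4 * β := by exact_mod_cast (by omega : 1 ≤ 4 * β)
  have hW0 : 0 ≤ W := le_trans (by positivity) hW
  -- All partial products have to be bounded, since each of them is stored in a register.
  have hbd : ∀ c, ∀ i ≤ n, |F a c * childProd n par F k a i c| ≤ W := fun c i hi => by
    rw [abs_mul]
    calc _ ≤ (4 * β : ℤ) * (4 * β : ℤ) ^ childSize n par k a i := by
          refine mul_le_mul ((hFβ a ha c).trans (by omega))
            (abs_childProd_le hi fun i hi c => abs_evalTree_le hFβ (by omega) c)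
            (abs_nonneg _) (by positivity)
      _ = (4 * β : ℤ) ^ (childSize n par k a i + 1) := by ring
      _ ≤ (4 * β : ℤ) ^ (n + 1) :=
          pow_le_pow_right₀ h4β (by have := t.childSize_mono (k := k) ha hi; omega)
      _ ≤ W := hW
  have hstep : step n par F σ =
      { σ with prod := Function.update σ.prod a (F a σ.ctx), cand := 1 } := by
    rw [step, if_pos hcand, hcur]
  have hg' : Good n W (step n par F σ) := by
    rw [hstep]
    exact ⟨hσ.cur_le, by show 1 ≤ n + 1; omega, fun h => absurd h one_ne_zero,
      update_bound hσ.prod_le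
      (by simpa [childProd] using hbd σ.ctx 0 (Nat.zero_le n)) _, hσ.sum_le⟩
  have hp : (step n par F σ).prod a = F a σ.ctx := by rw [hstep]; simp
  have hc : (step n par F σ).ctx = σ.ctx := by rw [hstep]
  obtain ⟨σ', T, hr, hT, h1, h2, h3, h4⟩ := t.scan hF hW0 ih ha hk hg' (by rw [hstep]; exact hcur)
    (by rw [hstep]) le_rfl (by rw [hp, hc]; exact hbd σ.ctx)
  refine ⟨σ', T + 1, .head hσ (by omega) hr, by omega, h1, h2, by rw [h3, hp, hc], fun x hx => ?_⟩
  obtain ⟨e1, e2, e3⟩ := h4 x hx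
  refine ⟨by rw [e1, hc], by rw [e2, hstep], fun hxa => ?_⟩
  rw [e3 hxa, hstep]
  exact Function.update_of_ne hxa _ _

/-- Induction on the number of levels. A node runs four rounds, one per context, in the order of a
two-bit counter, and then returns its sum to the parent. The four rounds multiply the time by 4 per
level, which yields the factor `4 ^ k`. -/
theorem evalSpec
    (hF : ∀ a ≤ n, ∀ c c' : ℕ → Bool × Bool, (∀ j, c (par^[j] a) = c' (par^[j] a)) →
      F a c = F a c')
    (hFβ : ∀ a ≤ n, ∀ c, |F a c| ≤ β) (hβ : 1 ≤ β) (hW : (4 * β : ℤ) ^ (n + 1) ≤ W) (k : ℕ) :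
    EvalSpec n τ par dep F W k := by
  induction k with
  | zero =>
    -- With no levels left, `a` would have depth `τ + 1`.
    intro a _ ha hd
    have := t.dep_le a ha
    omega
  | succ k ih =>
    intro a ha1 ha hd σ hσ hcur hcand hctx hsum hprod
    have h4β : (1 : ℤ) ≤ 4 * β := by exact_mod_cast (by omega : 1 ≤ 4 * β)
    set G : Bool × Bool → ℤ := fun s => F a (Function.update σ.ctx a s) *
      childProd n par F k a n (Function.update σ.ctx a s) with hG
    have hGb : ∀ s, |G s| ≤ (β : ℤ) * (4 * β) ^ n := fun s => by
      rw [hG, abs_mul]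
      refine mul_le_mul (hFβ a ha _) ?_ (abs_nonneg _) (by positivity)
      exact (abs_childProd_le le_rfl fun i hi c => abs_evalTree_le hFβ (by omega) c).trans
        (pow_le_pow_right₀ h4β (t.childSize_mono ha le_rfl))
    -- This leaves room for the sum of four rounds.
    have hW4 : 4 * ((β : ℤ) * (4 * β) ^ n) ≤ W := le_trans (by rw [pow_succ]; linarith) hW
    have hβn : (0 : ℤ) ≤ (β : ℤ) * (4 * β) ^ n := by positivity
    -- The state of the node after finishing the round with context `s` at `a`.
    have hround : ∀ (s : Bool × Bool) (ρ : DfsState), Good n W ρ → ρ.cur = a → ρ.cand = 0 →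
        ρ.ctx a = s →
        (∀ x, x ∉ subtreeList n par (k + 1) a → ρ.ctx x = σ.ctx x ∧ ρ.sum x = σ.sum x ∧
          ρ.prod x = σ.prod x) →
        ∃ ρ' T, Reach n par F W T ρ ρ' ∧ T ≤ n + 1 + (n + 3) * 4 ^ k * childSize n par k a n ∧
          ρ'.cur = a ∧ ρ'.cand = n + 1 ∧ ρ'.prod a = G s ∧ ρ'.ctx a = s ∧ ρ'.sum a = ρ.sum a ∧
          ∀ x, x ∉ subtreeList n par (k + 1) a → ρ'.ctx x = σ.ctx x ∧ ρ'.sum x = σ.sum x ∧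
            ρ'.prod x = σ.prod x := by
      intro s ρ hρ h1 h2 h3 h4
      obtain ⟨ρ', T, hr, hT, e1, e2, e3, e4⟩ := t.round hF hFβ hβ hW ih ha (by omega) hρ h1 h2
      have hanc : ∀ j, ρ.ctx (par^[j] a) = Function.update σ.ctx a s (par^[j] a) := fun j => by
        by_cases hja : par^[j] a = a
        · rw [hja, h3, Function.update_self]
        · rw [Function.update_of_ne hja]
          refine (h4 _ fun hmem => ?_).1
          rw [subtreeList, List.mem_cons, List.mem_flatMap] at hmem
          rcases hmem with h | ⟨i, hi, h⟩
          · exact hja h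
          · rw [List.mem_range] at hi
            split_ifs at h with hp
            · exact t.iterate_not_mem ha hi hp j h
            · simp at h
      refine ⟨ρ', T, hr, hT, e1, e2, ?_, by rw [(e4 a (.inl rfl)).1, h3], (e4 a (.inl rfl)).2.1,
        fun x hx => ?_⟩
      · rw [e3, hG, hF a ha _ _ hanc, t.childProd_congr hF le_rfl hanc]
      · have hxa : x ≠ a := by
          rintro rfl
          exact hx (by rw [subtreeList]; exact List.mem_cons_self ..)
        obtain ⟨f1, f2, f3⟩ := e4 x (.inr hx)
        obtain ⟨g1, g2, g3⟩ := h4 x hx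
        exact ⟨f1.trans g1, f2.trans g2, (f3 hxa).trans g3⟩
    have hnext : ∀ (s s' : Bool × Bool) (ρ : DfsState), Good n W ρ → ρ.cur = a →
        ρ.cand = n + 1 → ρ.ctx a = s →
        (s = (false, false) ∧ s' = (false, true) ∨ s = (false, true) ∧ s' = (true, false) ∨
          s = (true, false) ∧ s' = (true, true)) → |ρ.sum a + ρ.prod a| ≤ W →
        (∀ x, x ∉ subtreeList n par (k + 1) a → ρ.ctx x = σ.ctx x ∧ ρ.sum x = σ.sum x ∧
          ρ.prod x = σ.prod x) →
        Good n W (step n par F ρ) ∧ (step n par F ρ).cur = a ∧ (step n par F ρ).cand = 0 ∧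
        (step n par F ρ).ctx a = s' ∧ (step n par F ρ).sum a = ρ.sum a + ρ.prod a ∧
        (∀ x, x ∉ subtreeList n par (k + 1) a → (step n par F ρ).ctx x = σ.ctx x ∧
          (step n par F ρ).sum x = σ.sum x ∧ (step n par F ρ).prod x = σ.prod x) := by
      intro s s' ρ hρ h1 h2 h3 hs hb h4
      have hstep : step n par F ρ =
          { ρ with
            cand := 0
            ctx := Function.update ρ.ctx a s'
            sum := Function.update ρ.sum a (ρ.sum a + ρ.prod a) } := by
        rw [step, if_neg (by omega), if_neg (by omega), h1, h3]
        rcases hs with ⟨rfl, rfl⟩ | ⟨rfl, rfl⟩ | ⟨rfl, rfl⟩ <;> simp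
      rw [hstep]
      refine ⟨⟨hρ.cur_le, Nat.zero_le _, fun _ => h1 ▸ ha1, hρ.prod_le, update_bound hρ.sum_le hb _⟩, h1, rfl,
        Function.update_self .., Function.update_self .., fun x hx => ?_⟩
      have hxa : x ≠ a := by
        rintro rfl
        exact hx (by rw [subtreeList]; exact List.mem_cons_self ..)
      obtain ⟨g1, g2, g3⟩ := h4 x hx
      exact ⟨(Function.update_of_ne hxa _ _).trans g1, (Function.update_of_ne hxa _ _).trans g2, g3⟩
    obtain ⟨ρ₁, T₁, r₁, b₁, u₁, c₁, p₁, x₁, s₁, e₁⟩ := hround (false, false) σ hσ hcur hcand hctx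
      fun x _ => ⟨rfl, rfl, rfl⟩
    rw [hsum] at s₁
    have v₁ : ρ₁.sum a + ρ₁.prod a = G (false, false) := by rw [s₁, p₁, zero_add]
    obtain ⟨g₁, u₁', c₁', x₁', s₁', e₁'⟩ := hnext _ _ ρ₁ r₁.good_right u₁ c₁ x₁
      (.inl ⟨rfl, rfl⟩) (by
        rw [v₁]; have := hGb (false, false); omega) e₁
    obtain ⟨ρ₂, T₂, r₂, b₂, u₂, c₂, p₂, x₂, s₂, e₂⟩ := hround _ _ g₁ u₁' c₁' x₁' e₁'
    have v₂ : ρ₂.sum a + ρ₂.prod a = G (false, false) + G (false, true) := by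
      rw [s₂, s₁', v₁, p₂]
    obtain ⟨g₂, u₂', c₂', x₂', s₂', e₂'⟩ := hnext _ _ ρ₂ r₂.good_right u₂ c₂ x₂
      (.inr (.inl ⟨rfl, rfl⟩)) (by
        rw [v₂]
        have h1 := abs_add_le (G (false, false)) (G (false, true))
        have h2 := hGb (false, false)
        have h3 := hGb (false, true)
        omega) e₂
    obtain ⟨ρ₃, T₃, r₃, b₃, u₃, c₃, p₃, x₃, s₃, e₃⟩ := hround _ _ g₂ u₂' c₂' x₂' e₂'
    have v₃ : ρ₃.sum a + ρ₃.prod a = G (false, false) + G (false, true) + G (true, false) := by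
      rw [s₃, s₂', v₂, p₃]
    have hb₃ : |G (false, false) + G (false, true) + G (true, false)| ≤
        3 * ((β : ℤ) * (4 * β) ^ n) := by
      have h1 := abs_add_three (G (false, false)) (G (false, true)) (G (true, false))
      have h2 := hGb (false, false)
      have h3 := hGb (false, true)
      have h4 := hGb (true, false)
      omega
    obtain ⟨g₃, u₃', c₃', x₃', s₃', e₃'⟩ := hnext _ _ ρ₃ r₃.good_right u₃ c₃ x₃
      (.inr (.inr ⟨rfl, rfl⟩)) (by rw [v₃]; omega) e₃
    obtain ⟨ρ₄, T₄, r₄, b₄, u₄, c₄, p₄, x₄, s₄, e₄⟩ := hround _ _ g₃ u₃' c₃' x₃' e₃'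
    have hval : evalTree n par F (k + 1) a σ.ctx = ρ₄.sum a + ρ₄.prod a := by
      rw [evalTree_succ, s₄, s₃', v₃, p₄, Fintype.sum_prod_type]
      simp only [Fintype.sum_bool, hG]
      ring
    -- The product of the parent must have survived the visit, because the value of `a` is
    -- multiplied into it.
    have hpa : par a ∉ subtreeList n par (k + 1) a := fun h => by
      have h1 := t.dep_le_of_mem ha h
      have h2 := t.dep_par a ha1 ha
      omega
    have hpra : par a ≠ a := fun h => hpa (by
      rw [h, subtreeList]; exact List.mem_cons_self ..)
    have hstep : step n par F ρ₄ =
        { ρ₄ with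
          cur := par a
          cand := a + 1
          sum := Function.update ρ₄.sum a (ρ₄.sum a + ρ₄.prod a)
          prod := Function.update ρ₄.prod (par a)
            (ρ₄.prod (par a) * (ρ₄.sum a + ρ₄.prod a)) } := by
      rw [step, if_neg (by omega), if_neg (by omega), u₄, x₄]
      simp
    have hg := r₄.good_right
    have hgood : Good n W (step n par F ρ₄) := by
      rw [hstep]
      refine ⟨t.par_le a ha1 ha, by show a + 1 ≤ n + 1; omega,
        fun h => absurd h (Nat.succ_ne_zero a), update_bound hg.prod_le ?_ _,
        update_bound hg.sum_le ?_ _⟩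
      · rw [← hval, (e₄ _ hpa).2.2]; exact hprod
      · rw [← hval]
        refine (abs_evalTree_le hFβ ha _).trans (le_trans ?_ hW)
        exact pow_le_pow_right₀ h4β (t.length_subtreeList_le ha)
    refine ⟨_, _, ((((r₁.trans (.head r₁.good_right (by omega) r₂)).trans
      (.head r₂.good_right (by omega) r₃))).trans (.head r₃.good_right (by omega) r₄)).trans
      (.single hg (by omega) hgood), ?_, ?_⟩
    -- Four rounds and four transitions take at most `4 * (n + 2)` steps besides the visits to the
    -- children; this is below `(n + 3) * 4 ^ (k + 1)`, the share of `a` itself.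
    · have hlen : (subtreeList n par (k + 1) a).length = 1 + childSize n par k a n :=
        t.sum_length_children
      rw [hlen, pow_succ]
      have h1 : 1 ≤ 4 ^ k := Nat.one_le_pow _ _ (by norm_num)
      have h2 : (n + 3) * (4 ^ k * 4) * (1 + childSize n par k a n) =
        (n + 3) * 4 ^ k * 4 + 4 * ((n + 3) * 4 ^ k * childSize n par k a n) := by ring
      have h3 : (n + 3) * 1 ≤ (n + 3) * 4 ^ k := Nat.mul_le_mul_left _ h1
      omega
    · rw [hstep]
      refine ⟨rfl, rfl, ?_, fun x hx => (e₄ x hx).1, fun x hx => ?_, fun x hx hxp => ?_⟩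
      · show Function.update ρ₄.prod (par a) _ (par a) = _
        rw [Function.update_self, ← hval, (e₄ _ hpa).2.2]
      · have hxa : x ≠ a := by
          rintro rfl
          exact hx (by rw [subtreeList]; exact List.mem_cons_self ..)
        exact (Function.update_of_ne hxa _ _).trans (e₄ x hx).2.1
      · exact (Function.update_of_ne hxp _ _).trans (e₄ x hx).2.2

/-- The initial state of the evaluation. -/
def _root_.DfsState.init : DfsState where
  cur := 0
  cand := 1
  ctx := fun _ => (false, false)
  prod := Function.update (fun _ => 0) 0 1
  sum := fun _ => 0

/-- The artificial root 0 has no context and no weight. The search starts as if its product were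
already initialized to 1 and performs a single scan of its children, the roots of the forest. -/
theorem reach_final
    (hF : ∀ a ≤ n, ∀ c c' : ℕ → Bool × Bool, (∀ j, c (par^[j] a) = c' (par^[j] a)) →
      F a c = F a c')
    (hFβ : ∀ a ≤ n, ∀ c, |F a c| ≤ β) (hβ : 1 ≤ β) (hW : (4 * β : ℤ) ^ (n + 1) ≤ W) :
    ∃ σ T, Reach n par F W T DfsState.init σ ∧ T ≤ (n + 3) * (n + 1) * 4 ^ τ ∧
      σ.cur = 0 ∧ σ.cand = n + 1 ∧
      σ.prod 0 = childProd n par F τ 0 n fun _ => (false, false) := by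
  have h4β : (1 : ℤ) ≤ 4 * β := by exact_mod_cast (by omega : 1 ≤ 4 * β)
  have hW1 : 1 ≤ W := le_trans (one_le_pow₀ h4β) hW
  have hg : Good n W DfsState.init :=
    ⟨Nat.zero_le _, by show 1 ≤ n + 1; omega, fun h => absurd h one_ne_zero,
      update_bound (fun _ => by simp; omega) (by simpa using hW1) _, fun _ => by
        show |(0 : ℤ)| ≤ W
        simp; omega⟩
  obtain ⟨σ, T, hr, hT, h1, h2, h3, -⟩ := t.scan hF (by omega) (t.evalSpec hF hFβ hβ hW τ)
    (Nat.zero_le n) (by rw [t.dep_zero, zero_add]) hg rfl rfl le_rfl fun i hi => by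
      rw [show DfsState.init.prod 0 = 1 from rfl, one_mul]
      refine (abs_childProd_le hi fun i hi c => abs_evalTree_le hFβ (by omega) c).trans
        (le_trans (pow_le_pow_right₀ h4β ?_) hW)
      have := t.childSize_mono (k := τ) (Nat.zero_le n) hi
      omega
  refine ⟨σ, T, hr, hT.trans ?_, h1, h2, ?_⟩
  · have h5 := t.childSize_mono (k := τ) (Nat.zero_le n) le_rfl
    have h6 : 1 ≤ 4 ^ τ := Nat.one_le_pow _ _ (by norm_num)
    calc n + (n + 3) * 4 ^ τ * childSize n par τ 0 n
        ≤ (n + 3) * 4 ^ τ + (n + 3) * 4 ^ τ * n := by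
          refine Nat.add_le_add ?_ (Nat.mul_le_mul_left _ h5)
          nlinarith
      _ = _ := by ring
  · rw [h3]
    show (1 : ℤ) * _ = _
    rw [one_mul]
    rfl

/-- The result of the evaluation as a sum over all contexts. -/
theorem childProd_eq_sumOver
    (hF : ∀ a ≤ n, ∀ c c' : ℕ → Bool × Bool, (∀ j, c (par^[j] a) = c' (par^[j] a)) →
      F a c = F a c') (c : ℕ → Bool × Bool) :
    childProd n par F τ 0 n c =
      sumOver (belowList n par τ 0) (fun c => ((belowList n par τ 0).map (F · c)).prod) c := by
  rw [← t.children_eq_sumOver hF c fun b hb => t.evalTree_eq_sumOver hF hb c, list_range_map_prod,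
    childProd]

theorem nodup_belowList : (belowList n par τ 0).Nodup := by
  have h := t.nodup_subtreeList (k := τ + 1) (Nat.zero_le n)
  rw [subtreeList, List.nodup_cons] at h
  exact h.2

/-- Every node reaches the root after as many steps as its depth, which is at most `τ`, so `τ`
levels below the root exhaust the tree. -/
theorem mem_belowList {x : ℕ} : x ∈ belowList n par τ 0 ↔ 1 ≤ x ∧ x ≤ n := by
  have h0 := t.nodup_subtreeList (k := τ + 1) (Nat.zero_le n)
  rw [subtreeList, List.nodup_cons] at h0
  have hmem : x ∈ subtreeList n par (τ + 1) 0 ↔ x = 0 ∨ x ∈ belowList n par τ 0 := by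
    rw [subtreeList, List.mem_cons, belowList]
  constructor
  · intro h
    refine ⟨Nat.one_le_iff_ne_zero.2 ?_, (t.mem_subtreeList (Nat.zero_le n) (hmem.2 (.inr h))).1⟩
    rintro rfl
    exact h0.1 h
  · rintro ⟨h1, h2⟩
    have h3 : par^[dep x] x = 0 := by
      by_contra h
      have h4 := t.dep_iterate h2 (dep x) (by omega)
      have h5 := t.dep_par _ (by omega) (t.iterate_le h2 (dep x))
      omega
    have := t.mem_subtreeList_of_iterate (k := τ + 1) h2 (by have := t.dep_le x h2; omega) h3
    rcases hmem.1 this with h | h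
    · omega
    · exact h

end IdTree

/-! ### The program -/

/-- The address of the entry with index `x` of the array `j`. -/
def addr (x j : ℕ) : ℕ := (x + 1) * 32 + j

@[simp] theorem toNat_addr_zero (x : ℕ) : (((x : ℤ) + 1) * 32).toNat = addr x 0 := by
  unfold addr; omega

@[simp] theorem toNat_addr_one (x : ℕ) : (((x : ℤ) + 1) * 32 + 1).toNat = addr x 1 := by
  unfold addr; omega

@[simp] theorem toNat_addr_two (x : ℕ) : (((x : ℤ) + 1) * 32 + 2).toNat = addr x 2 := by
  unfold addr; omega

@[simp] theorem toNat_addr_three (x : ℕ) : (((x : ℤ) + 1) * 32 + 3).toNat = addr x 3 := by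
  unfold addr; omega

-- The interleaved arrays start at address 32, so they never overlap the scalar registers. The form
-- `= False` lets the simplifier decide the case distinctions that writes produce.
@[simp] theorem reg_ne_addr {r x j : ℕ} (h : r < 32) : (r = addr x j) = False := by
  unfold addr; simp; omega

@[simp] theorem addr_ne_reg {r x j : ℕ} (h : r < 32) : (addr x j = r) = False := by
  unfold addr; simp; omega

@[simp] theorem addr_inj {x y i j : ℕ} (hi : i < 32) (hj : j < 32) :
    (addr x i = addr y j) = (x = y ∧ i = j) := by
  unfold addr; simp; omega

namespace RAM

-- Register layout: 0, 1, 11, 12 hold the constants 0, 1, 32, 2; registers 2 to 7 hold `n`, `w`,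
-- `ℓ`, `M`, `M ^ 5`, `2 ^ M ^ 3`; 8, 9, 10 hold the current node, the candidate and the running
-- flag; 13 to 31 are auxiliary. Arrays 0 to 4 hold products, first bits, second bits, sums and
-- powers of two.
attribute [simp] upd_apply Instr.target Instr.value blockOk blockRun

/-- Preparation of the computation of a local weight. -/
def weightInit : List Instr :=
  -- The parent of node `b` is input entry `2 + b`. The matrix entry for nodes `a` and `u` has index
  -- `a * n + 2 + u`, so register 13 receives the offset of the row of `a`.
  [.add 13 12 8, .input 14 13, .mul 13 8 2, .add 13 13 12, .const 15 0, .const 16 0, .const 17 0]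

/-- Reading the matrix entry for an ancestor. -/
def weightRead : List Instr :=
  [.add 18 13 14, .input 18 18]

/-- Adding the terms for an ancestor. -/
def weightAdd : List Instr :=
  -- The edge factor is looked up in the table of powers at index `(weight + M) * M`. Registers 15,
  -- 16, 17 accumulate the two sums over ancestors and the diagonal sum.
  [.add 18 18 5, .mul 18 18 5, .add 18 18 1, .mul 18 18 11, .const 19 4, .add 18 18 19, .load 18 18,
    .add 20 14 1, .mul 20 20 11, .add 21 20 1, .load 21 21, .add 22 20 12, .load 22 22,
    .mul 21 21 18, .mul 22 22 18, .add 15 15 21, .add 16 16 22, .mul 21 21 22, .add 17 17 21]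

/-- Proceeding to the next ancestor. -/
def weightNext : List Instr :=
  [.add 18 12 14, .input 14 18]

/-- The loop over all ancestors. -/
def weightLoop : Program :=
  .loop 14 (.seq (block weightRead) (.seq (.ite 18 (block weightAdd) .skip) (block weightNext)))

/-- Reading the context of the current node. -/
def weightBits : List Instr :=
  [.add 18 8 1, .mul 18 18 11, .add 19 18 1, .load 19 19, .add 20 18 12, .load 20 20, .add 21 19 20]

/-- Combining the sums over the ancestors to the local weight. -/
def weightCombine : Program :=
  .seq (.ite 19 (block [.add 15 7 0]) (block [.sub 15 15 7]))
    (.seq (.ite 20 (block [.add 16 7 0]) (block [.sub 16 16 7]))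
      (.seq (block [.mul 15 15 16])
        -- Register 21 is the sum of the two bits, so it fails to be positive only in the context
        -- `(false, false)`.
        (.seq (.ite 21 .skip (block [.add 15 15 1, .sub 15 15 17]))
          (block [.store 18 15, .const 9 1]))))

/-- The computation of the local weight of the current node. -/
def weightProgram : Program :=
  .seq (block weightInit) (.seq weightLoop (.seq (block weightBits) weightCombine))

/-- Descending to a child. -/
def enterBlock : List Instr :=
  [.add 8 9 0, .const 9 0, .add 13 8 1, .mul 13 13 11, .add 14 13 1, .store 14 0, .add 14 13 12,
    .store 14 0, .const 14 3, .add 14 13 14, .store 14 0]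

/-- Testing the next candidate for a child. -/
def scanProgram : Program :=
  -- Squaring turns the test for inequality into a test for positivity, the only test available.
  .seq (block [.add 13 12 9, .input 13 13, .sub 13 13 8, .mul 13 13 13])
    (.ite 13 (block [.add 9 9 1]) (block enterBlock))

/-- Returning from a node to its parent. -/
def popBlock : List Instr :=
  [.add 16 12 8, .input 16 16, .add 9 8 1, .add 8 16 0, .add 16 16 1, .mul 16 16 11, .load 18 16,
    .mul 18 18 17, .store 16 18]

/-- Adding the current product to the sum of a node. -/
def sumBlock : List Instr :=
  [.add 13 8 1, .mul 13 13 11, .add 14 13 1, .add 15 13 12, .const 16 3, .add 16 13 16, .load 17 16,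
    .load 18 13, .add 17 17 18, .store 16 17, .load 18 14, .load 19 15]

/-- Finishing a round at a node. -/
def finishProgram : Program :=
  .seq (block sumBlock)
    (.ite 19 (.ite 18 (block popBlock) (block [.store 14 1, .store 15 0, .const 9 0]))
      (block [.store 15 1, .const 9 0]))

/-- One step of the depth-first evaluation. -/
def dfsBody : Program :=
  .ite 9
    -- The value `n - cand + 1` is positive exactly if there is a candidate left.
    (.seq (block [.sub 13 2 9, .add 13 13 1])
      (.ite 13 scanProgram (.ite 8 finishProgram (block [.const 10 0]))))
    weightProgram

end RAM

/-! ### Local weights -/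

/-- The factor for an edge from `a` upwards to `u`. -/
def edgeFactor (M : ℕ) (wg : ℕ → ℕ → ℕ) (a u : ℕ) : ℕ :=
  if 0 < wg a u then 2 ^ ((wg a u + M) * M) else 0

/-- The sum of `g` over the proper ancestors of `a`. -/
def ancSum (par dep : ℕ → ℕ) (g : ℕ → ℤ) (a : ℕ) : ℤ :=
  ∑ i ∈ Finset.range (dep (par a)), g (par^[i] (par a))

/-- The local weight of the node `a`. -/
def localWeight (par dep : ℕ → ℕ) (wg : ℕ → ℕ → ℕ) (M a : ℕ) (c : ℕ → Bool × Bool) : ℤ :=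
  (if (c a).1 then (2 ^ M ^ 3 : ℤ) else
    ancSum par dep (fun u => (c u).1.toInt * edgeFactor M wg a u) a - 2 ^ M ^ 3) *
  (if (c a).2 then (2 ^ M ^ 3 : ℤ) else
    ancSum par dep (fun u => (c u).2.toInt * edgeFactor M wg a u) a - 2 ^ M ^ 3) +
  (if c a = (false, false) then
    1 - ancSum par dep (fun u => (c u).1.toInt * edgeFactor M wg a u *
      ((c u).2.toInt * edgeFactor M wg a u)) a else 0)

theorem localWeight_congr (par dep : ℕ → ℕ) (wg : ℕ → ℕ → ℕ) (M a : ℕ) (c c' : ℕ → Bool × Bool)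
    (h : ∀ j, c (par^[j] a) = c' (par^[j] a)) :
    localWeight par dep wg M a c = localWeight par dep wg M a c' := by
  have h0 : c a = c' a := h 0
  have h1 : ∀ j, c (par^[j] (par a)) = c' (par^[j] (par a)) := fun j => h (j + 1)
  simp only [localWeight, ancSum, h0, h1]

/-- The assumptions on the input and on the bounds for the memory. -/
structure Setting (inp : List ℕ) (n M w ℓ τ A B : ℕ) (par dep : ℕ → ℕ) (wg : ℕ → ℕ → ℕ) :
    Prop where
  tree : IdTree n τ par dep
  τ_le : τ ≤ n
  -- This makes `M` large enough to absorb the factors quadratic in `n` in the bounds of local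
  -- weights.
  M_ge : 2 * (n + 1) ^ 2 ≤ M
  w_lt : w < M
  ℓ_lt : ℓ < M
  inp_par : ∀ b, 1 ≤ b → b ≤ n → inp.getD (2 + b) 0 = par b
  inp_wg : ∀ a u, 1 ≤ a → a ≤ n → 1 ≤ u → u ≤ n → inp.getD (a * n + 2 + u) 0 = wg a u
  wg_lt : ∀ a u, 1 ≤ a → a ≤ n → 1 ≤ u → u ≤ n → wg a u < M
  A_ge : (M ^ 5 + M + 3) * 32 ≤ A
  -- The next three conditions prevent overflow in address arithmetic, in the values of the search,
  -- and in the table of powers.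
  small : 1000000 * M ^ 7 ≤ 2 ^ B
  big : 100 * (4 * (M * (2 ^ M ^ 3) ^ 2)) ^ (n + 1) ≤ 2 ^ B
  pow_le : M ^ 5 + 2 ≤ B

open RAM in
/-- The contents of the registers that do not change during the evaluation. -/
structure Fixed (n M w ℓ : ℕ) (m : Memory) : Prop where
  r0 : m 0 = 0
  r1 : m 1 = 1
  r2 : m 2 = n
  r3 : m 3 = w
  r4 : m 4 = ℓ
  r5 : m 5 = M
  r6 : m 6 = (M : ℤ) ^ 5
  r7 : m 7 = 2 ^ M ^ 3
  r11 : m 11 = 32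
  r12 : m 12 = 2
  pow : ∀ e ≤ M ^ 5, m (addr e 4) = 2 ^ e

open RAM in
/-- The memory `m` represents the state `σ` of the evaluation. -/
structure Represents (n : ℕ) (m : Memory) (σ : DfsState) : Prop where
  run : m 10 = 1
  cur : m 8 = σ.cur
  cand : m 9 = σ.cand
  prod : ∀ x ≤ n, m (addr x 0) = σ.prod x
  fst : ∀ x ≤ n, m (addr x 1) = (σ.ctx x).1.toInt
  snd : ∀ x ≤ n, m (addr x 2) = (σ.ctx x).2.toInt
  sum : ∀ x ≤ n, m (addr x 3) = σ.sum x

open RAM in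
/-- `m` and `m'` differ only in the auxiliary registers. -/
def Frame (m m' : Memory) : Prop := ∀ a, a < 13 ∨ 32 ≤ a → m' a = m a

open RAM in
theorem Frame.addr {m m' : Memory} (h : Frame m m') (x j : ℕ) : m' (addr x j) = m (addr x j) :=
  h _ (.inr (by unfold _root_.addr; omega))

open RAM in
theorem Frame.trans {m m' m'' : Memory} (h : Frame m m') (h' : Frame m' m'') : Frame m m'' :=
  fun a ha => (h' a ha).trans (h a ha)

open RAM in
theorem frame_blockRun {inp : List ℕ} (l : List Instr)
    (hl : ∀ a ∈ l, ∀ m, 13 ≤ a.target m ∧ a.target m < 32) (m : Memory) :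
    Frame m (blockRun inp l m) := by
  induction l generalizing m with
  | nil => exact fun _ _ => rfl
  | cons a l ih =>
    refine Frame.trans (fun r hr => ?_) (ih (fun b hb => hl b (List.mem_cons_of_mem _ hb)) _)
    have := hl a (List.mem_cons_self ..) m
    rw [upd_apply, if_neg (by omega)]

open RAM in
theorem Fixed.frame {n M w ℓ : ℕ} {m m' : Memory} (h : Fixed n M w ℓ m) (hf : Frame m m') :
    Fixed n M w ℓ m' where
  r0 := (hf 0 (by omega)).trans h.r0
  r1 := (hf 1 (by omega)).trans h.r1
  r2 := (hf 2 (by omega)).trans h.r2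
  r3 := (hf 3 (by omega)).trans h.r3
  r4 := (hf 4 (by omega)).trans h.r4
  r5 := (hf 5 (by omega)).trans h.r5
  r6 := (hf 6 (by omega)).trans h.r6
  r7 := (hf 7 (by omega)).trans h.r7
  r11 := (hf 11 (by omega)).trans h.r11
  r12 := (hf 12 (by omega)).trans h.r12
  pow := fun e he => (hf.addr e 4).trans (h.pow e he)

open RAM in
theorem Represents.frame {n : ℕ} {m m' : Memory} {σ : DfsState} (h : Represents n m σ)
    (hf : Frame m m') : Represents n m' σ where
  run := (hf 10 (by omega)).trans h.run
  cur := (hf 8 (by omega)).trans h.cur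
  cand := (hf 9 (by omega)).trans h.cand
  prod := fun x hx => (hf.addr x 0).trans (h.prod x hx)
  fst := fun x hx => (hf.addr x 1).trans (h.fst x hx)
  snd := fun x hx => (hf.addr x 2).trans (h.snd x hx)
  sum := fun x hx => (hf.addr x 3).trans (h.sum x hx)

/-! ### Size bounds derived from the setting. -/

namespace Setting

open RAM

variable {inp : List ℕ} {n M w ℓ τ A B : ℕ} {par dep : ℕ → ℕ} {wg : ℕ → ℕ → ℕ}
  (S : Setting inp n M w ℓ τ A B par dep wg)

include S

theorem n_lt : n < M := by
  have := S.M_ge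
  nlinarith

theorem two_le : 2 ≤ M := by
  have := S.M_ge
  have : 1 ≤ (n + 1) ^ 2 := Nat.one_le_pow _ _ (by omega)
  omega

theorem lt_A {x j : ℕ} (hx : x ≤ M ^ 5 + 1) (hj : j < 32) : addr x j < A := by
  have := S.A_ge
  have := S.two_le
  unfold addr
  omega

theorem lt_A' {x j : ℕ} (hx : x ≤ n) (hj : j < 32) : addr x j < A :=
  S.lt_A (by have := S.n_lt; have := Nat.le_self_pow (n := 5) (by norm_num) M; omega) hj

theorem reg_lt_A {r : ℕ} (hr : r < 32) : r < A := by
  have := S.A_ge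
  omega

theorem small' : 1000000 * (M : ℤ) ^ 7 ≤ 2 ^ B := by exact_mod_cast S.small

/-- A weight is below `M`, so the exponent is at most `2 * M * M`, and `2 ≤ M`. -/
theorem edgeFactor_le {a u : ℕ} (ha : 1 ≤ a) (ha' : a ≤ n) (hu : 1 ≤ u) (hu' : u ≤ n) :
    edgeFactor M wg a u ≤ 2 ^ M ^ 3 := by
  unfold edgeFactor
  split_ifs
  · refine Nat.pow_le_pow_right (by norm_num) ?_
    have h1 := S.wg_lt a u ha ha' hu hu'
    have h2 := S.two_le
    nlinarith [Nat.mul_le_mul_right M (show wg a u + M ≤ 2 * M by omega),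
      Nat.mul_le_mul_right (M * M) h2]
  · positivity

theorem ancestor_le {a i : ℕ} (ha : 1 ≤ a) (ha' : a ≤ n) (hi : i < dep (par a)) :
    1 ≤ par^[i] (par a) ∧ par^[i] (par a) ≤ n := by
  have h1 := S.tree.par_le a ha ha'
  refine ⟨?_, S.tree.iterate_le h1 i⟩
  by_contra h
  -- The iterates cannot reach the root in fewer steps than the depth.
  have key : ∀ x ≤ n, ∀ i, par^[i] x = 0 → dep x ≤ i := by
    intro x hx i
    induction i generalizing x with
    | zero => intro h; rw [show x = 0 from h, S.tree.dep_zero]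
    | succ i ih =>
      intro h
      rcases Nat.eq_zero_or_pos x with rfl | h0
      · rw [S.tree.dep_zero]; omega
      · rw [Function.iterate_succ_apply] at h
        have := ih _ (S.tree.par_le x h0 hx) h
        rw [S.tree.dep_par x h0 hx]
        omega
  have := key _ h1 i (by omega)
  omega

theorem ancSum_bounds {g : ℕ → ℤ} {a : ℕ} {C : ℤ} (ha' : a ≤ n)
    (hg : ∀ i < dep (par a), 0 ≤ g (par^[i] (par a)) ∧ g (par^[i] (par a)) ≤ C) (hC : 0 ≤ C) (ha : 1 ≤ a) :
    0 ≤ ancSum par dep g a ∧ ancSum par dep g a ≤ n * C := by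
  unfold ancSum
  constructor
  · exact Finset.sum_nonneg fun i hi => (hg i (Finset.mem_range.1 hi)).1
  · refine (Finset.sum_le_card_nsmul _ _ C fun i hi => (hg i (Finset.mem_range.1 hi)).2).trans ?_
    rw [Finset.card_range, nsmul_eq_mul]
    refine mul_le_mul_of_nonneg_right ?_ hC
    have h1 := S.tree.dep_le _ (S.tree.par_le a ha ha')
    have := S.τ_le
    exact_mod_cast h1.trans this

end Setting

theorem Bool.toInt_bounds (b : Bool) : 0 ≤ b.toInt ∧ b.toInt ≤ 1 := by
  cases b <;> simp [Bool.toInt]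

theorem Bool.toInt_pos (b : Bool) : 0 < b.toInt ↔ b = true := by
  cases b <;> simp [Bool.toInt]

theorem Bool.toInt_mul_bounds (b : Bool) {x C : ℤ} (h0 : 0 ≤ x) (h : x ≤ C) :
    0 ≤ b.toInt * x ∧ b.toInt * x ≤ C := by
  cases b <;> simp [Bool.toInt] <;> omega

/-! ### Correctness of the computation of a local weight. -/

namespace Setting

open RAM

variable {inp : List ℕ} {n M w ℓ τ A B : ℕ} {par dep : ℕ → ℕ} {wg : ℕ → ℕ → ℕ}
  (S : Setting inp n M w ℓ τ A B par dep wg)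

include S

/-- The nonlinear facts are collected once, so that later overflow checks are linear with products
and powers as atoms. -/
theorem bounds : 1000 * (M : ℤ) ^ 5 ≤ 2 ^ B ∧ (M : ℤ) * M * M ≤ M ^ 5 ∧ (M : ℤ) * M ≤ M * M * M ∧
    2 * (M : ℤ) ≤ M * M ∧ (n : ℤ) < M ∧ (2 : ℤ) ≤ M := by
  have h1 := S.small'
  have h2 : (2 : ℤ) ≤ M := by exact_mod_cast S.two_le
  have h3 : (n : ℤ) < M := by exact_mod_cast S.n_lt
  have h4 : 1 ≤ (M : ℤ) * M := by nlinarith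
  have h5 : (0 : ℤ) ≤ (M : ℤ) ^ 5 := by positivity
  refine ⟨?_, ?_, by nlinarith, by nlinarith, h3, h2⟩
  · have : (M : ℤ) ^ 7 = M ^ 5 * (M * M) := by ring
    nlinarith
  · have : (M : ℤ) ^ 5 = M * M * M * (M * M) := by ring
    have : 0 ≤ (M : ℤ) * M * M := by positivity
    nlinarith

/-- The bounds `U₁`, `U₂`, `U₃` stand for the complete sums: all terms are nonnegative, so partial
sums stay below them. -/
theorem weightAdd_spec {κ : ℕ} (hκ : 1 + B * B ≤ κ) {m : Memory} (hm : Bdd A B m)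
    (hf : Fixed n M w ℓ m) {σ : DfsState} (hr : Represents n m σ) {a u : ℕ} (ha : 1 ≤ a)
    (ha' : a ≤ n) (hu : 1 ≤ u) (hu' : u ≤ n) (h14 : m 14 = u) (h18 : m 18 = wg a u)
    (hpos : 0 < wg a u) {U₁ U₂ U₃ : ℤ}
    (h15 : 0 ≤ m 15 ∧ m 15 + (σ.ctx u).1.toInt * edgeFactor M wg a u ≤ U₁)
    (h16 : 0 ≤ m 16 ∧ m 16 + (σ.ctx u).2.toInt * edgeFactor M wg a u ≤ U₂)
    (h17 : 0 ≤ m 17 ∧ m 17 + (σ.ctx u).1.toInt * edgeFactor M wg a u *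
      ((σ.ctx u).2.toInt * edgeFactor M wg a u) ≤ U₃)
    (hU₁ : U₁ < 2 ^ B) (hU₂ : U₂ < 2 ^ B) (hU₃ : U₃ < 2 ^ B) :
    Ev inp A B κ (block weightAdd) m 20 fun m' => Frame m m' ∧ m' 13 = m 13 ∧ m' 14 = m 14 ∧
      m' 15 = m 15 + (σ.ctx u).1.toInt * edgeFactor M wg a u ∧
      m' 16 = m 16 + (σ.ctx u).2.toInt * edgeFactor M wg a u ∧
      m' 17 = m 17 + (σ.ctx u).1.toInt * edgeFactor M wg a u *
        ((σ.ctx u).2.toInt * edgeFactor M wg a u) := by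
  have hwg := S.wg_lt a u ha ha' hu hu'
  have hM := S.two_le
  have he : (wg a u + M) * M ≤ M ^ 5 := by
    nlinarith [Nat.mul_le_mul_right M (show wg a u + M ≤ 2 * M by omega),
      Nat.mul_le_mul_right (M * M) hM, Nat.pow_le_pow_right (show 0 < M by omega) (show 3 ≤ 5 by norm_num)]
  have haddr : ((((wg a u : ℤ) + M) * M + 1) * 32 + 4).toNat = addr ((wg a u + M) * M) 4 := by
    have : (((wg a u : ℤ) + M) * M + 1) * 32 + 4 = ((((wg a u + M) * M + 1) * 32 + 4 : ℕ) : ℤ) := by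
      push_cast; ring
    rw [this, Int.toNat_natCast, addr]
  have hfac : (edgeFactor M wg a u : ℤ) = 2 ^ ((wg a u + M) * M) := by
    rw [edgeFactor, if_pos hpos]; push_cast; rfl
  rw [hfac] at h15 h16 h17 ⊢
  have hreg : ∀ r < 32, r < A := fun r => S.reg_lt_A
  have hy : (2 : ℤ) ^ ((wg a u + M) * M) < 2 ^ B :=
    pow_lt_pow_right₀ (by norm_num) (by have := S.pow_le; omega)
  refine Ev.block (le_trans (by omega) hκ) (fun a _ m => Instr.cost_le hκ a m) hm ?_ ⟨?_, ?_⟩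
  · simp [weightAdd, hf.r1, hf.r5, hf.r11, hf.r12, h14, h18, haddr, hf.pow _ he,
      hr.fst u hu', hr.snd u hu', hreg]
    have hw' : ((wg a u : ℤ) + M) * M ≤ 2 * (M * M) := by
      have : (wg a u : ℤ) < M := by exact_mod_cast hwg
      nlinarith
    have hw0 : 0 ≤ ((wg a u : ℤ) + M) * M := by positivity
    have hy0 : (0 : ℤ) < 2 ^ ((wg a u + M) * M) := by positivity
    obtain ⟨b1, b2, b3, b4, b5, b6⟩ := S.bounds
    obtain ⟨t1, t2⟩ := Bool.toInt_bounds (σ.ctx u).1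
    obtain ⟨t3, t4⟩ := Bool.toInt_bounds (σ.ctx u).2
    have t5 := mul_nonneg t1 hy0.le
    have t6 := mul_nonneg t3 hy0.le
    have t7 := mul_nonneg t5 t6
    omega
  · exact frame_blockRun _ (by simp [weightAdd]) m
  · simp [weightAdd, hf.r1, hf.r5, hf.r11, hf.r12, h14, h18, haddr, hf.pow _ he,
      hr.fst u hu', hr.snd u hu']

theorem bounds_pow : 400 * ((M : ℤ) * (2 ^ M ^ 3 * 2 ^ M ^ 3)) ≤ 2 ^ B ∧ (1 : ℤ) ≤ 2 ^ M ^ 3 ∧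
    (2 : ℤ) ^ M ^ 3 ≤ 2 ^ M ^ 3 * 2 ^ M ^ 3 ∧
    (n : ℤ) * 2 ^ M ^ 3 ≤ M * 2 ^ M ^ 3 ∧ (M : ℤ) * 2 ^ M ^ 3 ≤ M * (2 ^ M ^ 3 * 2 ^ M ^ 3) ∧
    (n : ℤ) * (2 ^ M ^ 3 * 2 ^ M ^ 3) ≤ M * (2 ^ M ^ 3 * 2 ^ M ^ 3) ∧
    (2 : ℤ) * (2 ^ M ^ 3 * 2 ^ M ^ 3) ≤ M * (2 ^ M ^ 3 * 2 ^ M ^ 3) := by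
  have h1 : (1 : ℤ) ≤ 2 ^ M ^ 3 := one_le_pow₀ (by norm_num)
  obtain ⟨-, -, -, -, b5, b6⟩ := S.bounds
  have h2 : (2 : ℤ) ^ M ^ 3 ≤ 2 ^ M ^ 3 * 2 ^ M ^ 3 := by nlinarith
  refine ⟨?_, h1, h2, ?_, ?_, ?_, ?_⟩
  · have h := S.big
    have h3 : 1 ≤ 4 * (M * (2 ^ M ^ 3) ^ 2) := by
      have := S.two_le
      have : 1 ≤ M * (2 ^ M ^ 3) ^ 2 := Nat.mul_pos (by omega) (by positivity)
      omega
    have h4 : 4 * (M * (2 ^ M ^ 3) ^ 2) ≤ (4 * (M * (2 ^ M ^ 3) ^ 2)) ^ (n + 1) :=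
      Nat.le_self_pow (by omega) _
    have h5 : 400 * (M * (2 ^ M ^ 3 * 2 ^ M ^ 3)) ≤ 2 ^ B := by
      rw [← sq]; omega
    exact_mod_cast h5
  all_goals nlinarith

theorem par_iterate_dep {x : ℕ} (hx : x ≤ n) : par^[dep x] x = 0 := by
  by_contra h
  have h4 := S.tree.dep_iterate hx (dep x) (by omega)
  have h5 := S.tree.dep_par _ (by omega) (S.tree.iterate_le hx (dep x))
  omega

theorem weightLoop_spec {κ : ℕ} (hκ : 1 + B * B ≤ κ) {m : Memory} (hm : Bdd A B m)
    (hf : Fixed n M w ℓ m) {σ : DfsState} (hr : Represents n m σ) {a : ℕ} (ha : 1 ≤ a)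
    (ha' : a ≤ n) (h13 : m 13 = a * n + 2) (h14 : m 14 = par a) (h15 : m 15 = 0)
    (h16 : m 16 = 0) (h17 : m 17 = 0) :
    Ev inp A B κ weightLoop m (28 * n + 1) fun m' => Frame m m' ∧
      m' 15 = ancSum par dep (fun u => (σ.ctx u).1.toInt * edgeFactor M wg a u) a ∧
      m' 16 = ancSum par dep (fun u => (σ.ctx u).2.toInt * edgeFactor M wg a u) a ∧
      m' 17 = ancSum par dep (fun u => (σ.ctx u).1.toInt * edgeFactor M wg a u *
        ((σ.ctx u).2.toInt * edgeFactor M wg a u)) a := by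
  set g₁ : ℕ → ℤ := fun u => (σ.ctx u).1.toInt * edgeFactor M wg a u with hg₁
  set g₂ : ℕ → ℤ := fun u => (σ.ctx u).2.toInt * edgeFactor M wg a u with hg₂
  have hD : dep (par a) ≤ n := (S.tree.dep_le _ (S.tree.par_le a ha ha')).trans S.τ_le
  have hfac : ∀ i < dep (par a), (0 : ℤ) ≤ edgeFactor M wg a (par^[i] (par a)) ∧
      (edgeFactor M wg a (par^[i] (par a)) : ℤ) ≤ 2 ^ M ^ 3 := fun i hi => by
    obtain ⟨h1, h2⟩ := S.ancestor_le ha ha' hi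
    exact ⟨by positivity, by exact_mod_cast S.edgeFactor_le ha ha' h1 h2⟩
  have hb₁ : ∀ i < dep (par a), 0 ≤ g₁ (par^[i] (par a)) ∧ g₁ (par^[i] (par a)) ≤ 2 ^ M ^ 3 :=
    fun i hi => Bool.toInt_mul_bounds _ (hfac i hi).1 (hfac i hi).2
  have hb₂ : ∀ i < dep (par a), 0 ≤ g₂ (par^[i] (par a)) ∧ g₂ (par^[i] (par a)) ≤ 2 ^ M ^ 3 :=
    fun i hi => Bool.toInt_mul_bounds _ (hfac i hi).1 (hfac i hi).2
  have hb₃ : ∀ i < dep (par a), 0 ≤ g₁ (par^[i] (par a)) * g₂ (par^[i] (par a)) ∧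
      g₁ (par^[i] (par a)) * g₂ (par^[i] (par a)) ≤ 2 ^ M ^ 3 * 2 ^ M ^ 3 := fun i hi =>
    ⟨mul_nonneg (hb₁ i hi).1 (hb₂ i hi).1,
      mul_le_mul (hb₁ i hi).2 (hb₂ i hi).2 (hb₂ i hi).1 (by positivity)⟩
  obtain ⟨p1, p2, p3, p4, p5, p6, p7⟩ := S.bounds_pow
  obtain ⟨b1, b2, b3, b4, b5, b6⟩ := S.bounds
  have hs₁ := (S.ancSum_bounds (g := g₁) ha' hb₁ (by positivity) ha).2
  have hs₂ := (S.ancSum_bounds (g := g₂) ha' hb₂ (by positivity) ha).2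
  have hs₃ := (S.ancSum_bounds (g := fun u => g₁ u * g₂ u) ha' hb₃ (by positivity) ha).2
  have hpart : ∀ g : ℕ → ℤ, (∀ i < dep (par a), 0 ≤ g (par^[i] (par a))) → ∀ i ≤ dep (par a),
      0 ≤ ∑ k ∈ Finset.range i, g (par^[k] (par a)) ∧
      ∑ k ∈ Finset.range i, g (par^[k] (par a)) ≤ ancSum par dep g a := fun g hg i hi =>
    ⟨Finset.sum_nonneg fun k hk => hg k (by rw [Finset.mem_range] at hk; omega),
      Finset.sum_le_sum_of_subset_of_nonneg (Finset.range_mono hi) fun k hk _ =>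
        hg k (Finset.mem_range.1 hk)⟩
  have hκ1 : 1 ≤ κ := le_trans (by omega) hκ
  -- Here `i` ancestors are done and `j` remain. Register 14 walks up along the parents and stops
  -- the loop when it becomes the root 0.
  let I : ℕ → Memory → Prop := fun j m' => Frame m m' ∧ m' 13 = a * n + 2 ∧
    ∃ i, i + j = dep (par a) ∧ m' 14 = (par^[i] (par a) : ℕ) ∧
      m' 15 = ∑ k ∈ Finset.range i, g₁ (par^[k] (par a)) ∧
      m' 16 = ∑ k ∈ Finset.range i, g₂ (par^[k] (par a)) ∧
      m' 17 = ∑ k ∈ Finset.range i, g₁ (par^[k] (par a)) * g₂ (par^[k] (par a))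
  have hloop := Ev.loop (inp := inp) (A := A) (B := B) (κ := κ) (i := 14)
    (p := .seq (block weightRead) (.seq (.ite 18 (block weightAdd) .skip) (block weightNext)))
    (k := 27) I hκ1 ?_ ?_ (j := dep (par a)) hm
    ⟨fun _ _ => rfl, h13, 0, by simp, by simpa using h14, by simpa using h15, by simpa using h16,
      by simpa using h17⟩
  · refine hloop.mono (by omega) ?_
    rintro m' - ⟨hfr, -, i, hi, -, e1, e2, e3⟩
    obtain rfl : i = dep (par a) := by omega
    exact ⟨hfr, e1, e2, e3⟩
  · rintro m' ⟨hfr, -, i, hi, e0, -⟩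
    obtain rfl : i = dep (par a) := by omega
    rw [e0, S.par_iterate_dep (S.tree.par_le a ha ha')]
    simp
  · rintro j m₁ hm₁ ⟨hfr, e13, i, hi, e14, e15, e16, e17⟩
    have hi' : i < dep (par a) := by omega
    obtain ⟨hu, hu'⟩ := S.ancestor_le ha ha' hi'
    set u := par^[i] (par a) with hudef
    have hf₁ := hf.frame hfr
    have hr₁ := hr.frame hfr
    refine ⟨by rw [e14]; exact_mod_cast hu, ?_⟩
    have hreg : ∀ r < 32, r < A := fun r => S.reg_lt_A
    have hun : (u : ℤ) ≤ n := by exact_mod_cast hu'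
    have han : (a : ℤ) * n ≤ M * M := by
      have : (a : ℤ) ≤ n := by exact_mod_cast ha'
      nlinarith
    have han0 : 0 ≤ (a : ℤ) * n := by positivity
    have hwg := S.wg_lt a u ha ha' hu hu'
    have hin : inp.getD ((a * n + 2 + u : ℤ)).toNat 0 = wg a u := by
      have : (a * n + 2 + u : ℤ) = ((a * n + 2 + u : ℕ) : ℤ) := by push_cast; ring
      rw [this, Int.toNat_natCast, S.inp_wg a u ha ha' hu hu']
    have hpar := S.inp_par u hu hu'
    have hin2 : inp.getD ((2 + u : ℤ)).toNat 0 = par u := by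
      have : (2 + u : ℤ) = ((2 + u : ℕ) : ℤ) := by push_cast; ring
      rw [this, Int.toNat_natCast, hpar]
    have hparle := S.tree.par_le u hu hu'
    refine Ev.andThen (k := 3) (l := 24) (R := fun m₂ => Frame m₁ m₂ ∧ m₂ 18 = wg a u ∧
      ∀ r, r ≠ 18 → m₂ r = m₁ r) (Ev.block hκ1 (fun a _ m => Instr.cost_le hκ a m) hm₁ ?_
      ⟨frame_blockRun _ (by simp [weightRead]) m₁, ?_, fun r hr => ?_⟩) ?_
    · simp only [weightRead, blockOk, Instr.target, Instr.value, upd_apply, e13, e14, if_true, hin]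
      simp [hreg]
      omega
    · simp only [weightRead, blockRun, Instr.target, Instr.value, upd_apply, e13, e14, if_true, hin]
    · simp [weightRead, hr]
    rintro m₂ hm₂ ⟨hfr₂, e18, hkeep⟩
    have hs₁' := hpart g₁ (fun i hi => (hb₁ i hi).1)
    have hs₂' := hpart g₂ (fun i hi => (hb₂ i hi).1)
    have hs₃' := hpart (fun u => g₁ u * g₂ u) (fun i hi => (hb₃ i hi).1)
    refine Ev.andThen (k := 21) (l := 3) (R := fun m₃ => Frame m₁ m₃ ∧ m₃ 13 = m₁ 13 ∧
      m₃ 14 = m₁ 14 ∧ m₃ 15 = m₁ 15 + g₁ u ∧ m₃ 16 = m₁ 16 + g₂ u ∧ m₃ 17 = m₁ 17 + g₁ u * g₂ u)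
      (Ev.ite (k := 20) hκ1 (fun hpos => ?_) fun hpos => ?_) ?_
    · rw [e18] at hpos
      refine (S.weightAdd_spec hκ hm₂ (hf₁.frame hfr₂) (hr₁.frame hfr₂) ha ha' hu hu'
        (by rw [hkeep 14 (by norm_num), e14]) e18 (by exact_mod_cast hpos)
        (U₁ := ancSum par dep g₁ a) (U₂ := ancSum par dep g₂ a)
        (U₃ := ancSum par dep (fun u => g₁ u * g₂ u) a) ?_ ?_ ?_ ?_ ?_ ?_).mono le_rfl ?_
      · rw [hkeep 15 (by norm_num), e15]
        have h := (hs₁' (i + 1) hi').2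
        rw [Finset.sum_range_succ] at h
        exact ⟨(hs₁' i hi'.le).1, h⟩
      · rw [hkeep 16 (by norm_num), e16]
        have h := (hs₂' (i + 1) hi').2
        rw [Finset.sum_range_succ] at h
        exact ⟨(hs₂' i hi'.le).1, h⟩
      · rw [hkeep 17 (by norm_num), e17]
        have h := (hs₃' (i + 1) hi').2
        rw [Finset.sum_range_succ] at h
        exact ⟨(hs₃' i hi'.le).1, h⟩
      · omega
      · omega
      · omega
      · rintro m₃ - ⟨f, x13, x14, x15, x16, x17⟩
        rw [hkeep _ (by norm_num)] at x13 x14 x15 x16 x17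
        exact ⟨hfr₂.trans f, x13, x14, x15, x16, x17⟩
    -- A zero entry is a non-edge; its factor vanishes, so skipping it is correct.
    · have hw0 : wg a u = 0 := by rw [e18] at hpos; omega
      have hE : edgeFactor M wg a u = 0 := by simp [edgeFactor, hw0]
      refine (Ev.skip hκ1 hm₂ ?_).mono (by norm_num) fun _ _ h => h
      simp only [hg₁, hg₂, hE]
      refine ⟨hfr₂, ?_⟩
      simp [hkeep]
    · rintro m₃ hm₃ ⟨hfr₃, x13, x14, x15, x16, x17⟩
      have hf₃ := hf₁.frame hfr₃
      refine Ev.block hκ1 (fun a _ m => Instr.cost_le hκ a m) hm₃ ?_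
        ⟨hfr.trans (hfr₃.trans (frame_blockRun _ (by simp [weightNext]) m₃)), ?_,
          i + 1, by omega, ?_, ?_, ?_, ?_⟩
      · simp only [weightNext, blockOk, Instr.target, Instr.value, upd_apply, hf₃.r12, x14, e14,
          if_true, hin2]
        simp [hreg]
        omega
      · simp [weightNext, x13, e13]
      · rw [Function.iterate_succ_apply', ← hudef]
        simp only [weightNext, blockRun, Instr.target, Instr.value, upd_apply, hf₃.r12, x14, e14,
          if_true, hin2]
      · rw [Finset.sum_range_succ, ← hudef, ← e15, ← x15]; simp [weightNext]
      · rw [Finset.sum_range_succ, ← hudef, ← e16, ← x16]; simp [weightNext]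
      · rw [Finset.sum_range_succ, ← hudef, ← e17, ← x17]; simp [weightNext]

end Setting

namespace Setting

open RAM

variable {inp : List ℕ} {n M w ℓ τ A B : ℕ} {par dep : ℕ → ℕ} {wg : ℕ → ℕ → ℕ}
  (S : Setting inp n M w ℓ τ A B par dep wg)

include S

theorem weightCombine_spec {κ : ℕ} (hκ : 1 + B * B ≤ κ) {m : Memory} (hm : Bdd A B m)
    (hf : Fixed n M w ℓ m) {a : ℕ} (ha' : a ≤ n) {c : Bool × Bool}
    {U₁ U₂ U₃ : ℤ} (h15 : m 15 = U₁) (h16 : m 16 = U₂) (h17 : m 17 = U₃)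
    (h18 : m 18 = ((a : ℤ) + 1) * 32) (h19 : m 19 = c.1.toInt) (h20 : m 20 = c.2.toInt)
    (h21 : m 21 = c.1.toInt + c.2.toInt)
    (hU₁ : 0 ≤ U₁ ∧ U₁ ≤ n * 2 ^ M ^ 3) (hU₂ : 0 ≤ U₂ ∧ U₂ ≤ n * 2 ^ M ^ 3)
    (hU₃ : 0 ≤ U₃ ∧ U₃ ≤ n * (2 ^ M ^ 3 * 2 ^ M ^ 3)) :
    Ev inp A B κ weightCombine m 20 fun m' => m' 9 = 1 ∧
      m' (addr a 0) = (if c.1 then 2 ^ M ^ 3 else U₁ - 2 ^ M ^ 3) *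
          (if c.2 then 2 ^ M ^ 3 else U₂ - 2 ^ M ^ 3) +
        (if c = (false, false) then 1 - U₃ else 0) ∧
      ∀ r, (r < 13 ∧ r ≠ 9) ∨ (32 ≤ r ∧ r ≠ addr a 0) → m' r = m r := by
  have hκ1 : 1 ≤ κ := le_trans (by omega) hκ
  have hreg : ∀ r < 32, r < A := fun r => S.reg_lt_A
  obtain ⟨p1, p2, p3, p4, p5, p6, p7⟩ := S.bounds_pow
  obtain ⟨b1, b2, b3, b4, b5, b6⟩ := S.bounds
  have hcost : ∀ l : List Instr, ∀ a ∈ l, ∀ m, Bdd A B m → a.cost m ≤ κ :=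
    fun l a _ m => Instr.cost_le hκ a m
  set g₁ : ℤ := if c.1 then 2 ^ M ^ 3 else U₁ - 2 ^ M ^ 3 with hg₁
  set g₂ : ℤ := if c.2 then 2 ^ M ^ 3 else U₂ - 2 ^ M ^ 3 with hg₂
  have hb₁ : |g₁| ≤ (n + 1) * 2 ^ M ^ 3 := by
    have : 0 ≤ (n : ℤ) * 2 ^ M ^ 3 := by positivity
    rw [abs_le, hg₁]; split_ifs <;> constructor <;> linarith
  have hb₂ : |g₂| ≤ (n + 1) * 2 ^ M ^ 3 := by
    have : 0 ≤ (n : ℤ) * 2 ^ M ^ 3 := by positivity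
    rw [abs_le, hg₂]; split_ifs <;> constructor <;> linarith
  -- Both factors are at most `(n + 1) * 2 ^ M ^ 3`, and `(n + 1) ^ 2` is absorbed by `M`.
  have hb : |g₁ * g₂| ≤ M * (2 ^ M ^ 3 * 2 ^ M ^ 3) := by
    rw [abs_mul]
    refine (mul_le_mul hb₁ hb₂ (abs_nonneg _) (by positivity)).trans ?_
    have h := S.M_ge
    have h2 : ((n : ℤ) + 1) * (n + 1) ≤ M := by
      have : (n + 1) * (n + 1) ≤ M := by nlinarith
      exact_mod_cast this
    calc _ = ((n : ℤ) + 1) * (n + 1) * (2 ^ M ^ 3 * 2 ^ M ^ 3) := by ring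
      _ ≤ _ := mul_le_mul_of_nonneg_right h2 (by positivity)
  have hnM : ((n : ℤ) + 1) * 2 ^ M ^ 3 ≤ M * 2 ^ M ^ 3 :=
    mul_le_mul_of_nonneg_right (by omega) (by positivity)
  rw [abs_le] at hb hb₁ hb₂
  refine (Ev.andThen (k := 3) (l := 17) (R := fun m₁ => m₁ 15 = g₁ ∧ ∀ r, r ≠ 15 → m₁ r = m r)
    (Ev.ite (k := 2) hκ1 (fun hpos => ?_) fun hpos => ?_) ?_).mono le_rfl fun _ _ h => h
  · have h1 : c.1 = true := by rwa [h19, Bool.toInt_pos] at hpos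
    refine Ev.block hκ1 (hcost _) hm ?_ ⟨?_, fun r hr => ?_⟩
    · simp [hf.r0, hf.r7, hreg]; omega
    · simp [hf.r0, hf.r7, hg₁, h1]
    · simp [hr]
  · have h1 : c.1 = false := by rwa [h19, Bool.toInt_pos, Bool.not_eq_true] at hpos
    refine Ev.block hκ1 (hcost _) hm ?_ ⟨?_, fun r hr => ?_⟩
    · simp [h15, hf.r7, hreg]; omega
    · simp [h15, hf.r7, hg₁, h1]
    · simp [hr]
  rintro m₁ hm₁ ⟨e15, hk₁⟩
  refine Ev.andThen (k := 3) (l := 14) (R := fun m₂ => m₂ 15 = g₁ ∧ m₂ 16 = g₂ ∧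
    ∀ r, r ≠ 15 → r ≠ 16 → m₂ r = m r)
    (Ev.ite (k := 2) hκ1 (fun hpos => ?_) fun hpos => ?_) ?_
  · have h1 : c.2 = true := by rwa [hk₁ _ (by norm_num), h20, Bool.toInt_pos] at hpos
    refine Ev.block hκ1 (hcost _) hm₁ ?_ ⟨?_, ?_, fun r hr hr' => ?_⟩
    · simp [hk₁, hf.r0, hf.r7, hreg]; omega
    · simp [e15]
    · simp [hk₁, hf.r0, hf.r7, hg₂, h1]
    · simp [hr', hk₁ r hr]
  · have h1 : c.2 = false := by
      rwa [hk₁ _ (by norm_num), h20, Bool.toInt_pos, Bool.not_eq_true] at hpos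
    refine Ev.block hκ1 (hcost _) hm₁ ?_ ⟨?_, ?_, fun r hr hr' => ?_⟩
    · simp [hk₁, h16, hf.r7, hreg]; omega
    · simp [e15]
    · simp [hk₁, h16, hf.r7, hg₂, h1]
    · simp [hr', hk₁ r hr]
  rintro m₂ hm₂ ⟨f15, f16, hk₂⟩
  refine Ev.andThen (k := 2) (l := 12) (R := fun m₃ => m₃ 15 = g₁ * g₂ ∧
    ∀ r, r ≠ 15 → r ≠ 16 → m₃ r = m r) (Ev.block hκ1 (hcost _) hm₂ ?_ ⟨?_, fun r hr hr' => ?_⟩) ?_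
  · simp [f15, f16, hreg]; omega
  · simp [f15, f16]
  · simp [hr, hk₂ r hr hr']
  rintro m₃ hm₃ ⟨i15, hk₃⟩
  refine Ev.andThen (k := 4) (l := 8) (R := fun m₄ => m₄ 15 = g₁ * g₂ +
      (if c = (false, false) then 1 - U₃ else 0) ∧ ∀ r, r ≠ 15 → r ≠ 16 → m₄ r = m r)
    (Ev.ite (k := 3) hκ1 (fun hpos => ?_) fun hpos => ?_) ?_
  · have h1 : c ≠ (false, false) := by
      rintro rfl
      rw [hk₃ _ (by norm_num) (by norm_num), h21] at hpos
      simp [Bool.toInt] at hpos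
    refine (Ev.skip hκ1 hm₃ ⟨?_, hk₃⟩).mono (by norm_num) fun _ _ h => h
    rw [i15, if_neg h1, add_zero]
  · have h1 : c = (false, false) := by
      rw [hk₃ _ (by norm_num) (by norm_num), h21] at hpos
      obtain ⟨c₁, c₂⟩ := c
      cases c₁ <;> cases c₂ <;> simp [Bool.toInt] at hpos ⊢
    refine Ev.block hκ1 (hcost _) hm₃ ?_ ⟨?_, fun r hr hr' => ?_⟩
    · simp [i15, hk₃, hf.r1, h17, hreg]; omega
    · simp [i15, hk₃, hf.r1, h17, h1]; ring
    · simp [hr, hk₃ r hr hr']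
  rintro m₄ hm₄ ⟨j15, hk₄⟩
  have hb4 : |g₁ * g₂ + (if c = (false, false) then 1 - U₃ else 0)| < 2 ^ B := by
    rw [abs_lt]
    split_ifs <;> omega
  rw [abs_lt] at hb4
  refine (Ev.block hκ1 (hcost _) hm₄ ?_ ⟨?_, ?_, fun r hr => ?_⟩).mono (by simp) fun _ _ h => h
  · simp [j15, hk₄, h18, hreg, S.lt_A' ha']; omega
  · simp
  · simp [j15, hk₄, h18]
  · have h1 : r ≠ 15 ∧ r ≠ 16 ∧ r ≠ 9 ∧ r ≠ addr a 0 := by unfold addr at *; omega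
    simp [hk₄, h18, h1.1, h1.2.1, h1.2.2.1, h1.2.2.2]

end Setting

namespace Setting

open RAM

variable {inp : List ℕ} {n M w ℓ τ A B : ℕ} {par dep : ℕ → ℕ} {wg : ℕ → ℕ → ℕ}
  (S : Setting inp n M w ℓ τ A B par dep wg)

include S

theorem weightProgram_spec {κ : ℕ} (hκ : 1 + B * B ≤ κ) {m : Memory} (hm : Bdd A B m)
    (hf : Fixed n M w ℓ m) {σ : DfsState} (hr : Represents n m σ) (ha : 1 ≤ σ.cur)
    (ha' : σ.cur ≤ n) :
    Ev inp A B κ weightProgram m (28 * n + 40) fun m' => m' 9 = 1 ∧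
      m' (addr σ.cur 0) = localWeight par dep wg M σ.cur σ.ctx ∧
      ∀ r, (r < 13 ∧ r ≠ 9) ∨ (32 ≤ r ∧ r ≠ addr σ.cur 0) → m' r = m r := by
  have hκ1 : 1 ≤ κ := le_trans (by omega) hκ
  have hreg : ∀ r < 32, r < A := fun r => S.reg_lt_A
  obtain ⟨b1, b2, b3, b4, b5, b6⟩ := S.bounds
  have hcost : ∀ l : List Instr, ∀ a ∈ l, ∀ m, Bdd A B m → a.cost m ≤ κ :=
    fun l a _ m => Instr.cost_le hκ a m
  set a := σ.cur with hadef
  have han : (a : ℤ) ≤ n := by exact_mod_cast ha'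
  have han2 : (a : ℤ) * n ≤ M * M := by nlinarith
  have han0 : 0 ≤ (a : ℤ) * n := by positivity
  have hin : inp.getD ((2 + a : ℤ)).toNat 0 = par a := by
    have : (2 + a : ℤ) = ((2 + a : ℕ) : ℤ) := by push_cast; ring
    rw [this, Int.toNat_natCast, S.inp_par a ha ha']
  have hparle := S.tree.par_le a ha ha'
  have hr8 : m 8 = a := hr.cur
  refine (Ev.andThen (k := 8) (l := 28 * n + 1 + 28) (R := fun m₁ => Frame m m₁ ∧
    m₁ 13 = a * n + 2 ∧ m₁ 14 = par a ∧ m₁ 15 = 0 ∧ m₁ 16 = 0 ∧ m₁ 17 = 0)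
    (Ev.block hκ1 (hcost _) hm ?_ ⟨frame_blockRun _ (by simp [weightInit]) m, ?_⟩) ?_).mono
    (by omega) fun _ _ h => h
  · simp only [weightInit, blockOk, Instr.target, Instr.value, upd_apply, hf.r12, hr8, if_true, hin]
    simp [hf.r2, hreg]
    omega
  swap
  · simp only [weightInit, blockRun, Instr.target, Instr.value, upd_apply, hf.r12, hr8, if_true, hin]
    simp [hf.r2]
  rintro m₁ hm₁ ⟨hfr₁, e13, e14, e15, e16, e17⟩
  have hf₁ := hf.frame hfr₁
  have hr₁ := hr.frame hfr₁
  refine (Ev.andThen (k := 28 * n + 1) (l := 28)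
    (S.weightLoop_spec hκ hm₁ hf₁ hr₁ ha ha' e13 e14 e15 e16 e17) ?_)
  rintro m₂ hm₂ ⟨hfr₂, x15, x16, x17⟩
  have hf₂ := hf₁.frame hfr₂
  have hr₂ := hr₁.frame hfr₂
  have hr8 : m₂ 8 = a := hr₂.cur
  have hc₁ := Bool.toInt_bounds (σ.ctx a).1
  have hc₂ := Bool.toInt_bounds (σ.ctx a).2
  refine (Ev.andThen (k := 8) (l := 20) (R := fun m₃ => Frame m₂ m₃ ∧
    m₃ 15 = m₂ 15 ∧ m₃ 16 = m₂ 16 ∧ m₃ 17 = m₂ 17 ∧ m₃ 18 = ((a : ℤ) + 1) * 32 ∧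
    m₃ 19 = (σ.ctx a).1.toInt ∧ m₃ 20 = (σ.ctx a).2.toInt ∧
    m₃ 21 = (σ.ctx a).1.toInt + (σ.ctx a).2.toInt)
    (Ev.block hκ1 (hcost _) hm₂ ?_ ⟨frame_blockRun _ (by simp [weightBits]) m₂, ?_⟩) ?_)
  · simp [weightBits, hr8, hf₂.r1, hf₂.r11, hf₂.r12, hr₂.fst a ha', hr₂.snd a ha', hreg]
    omega
  · simp [weightBits, hr8, hf₂.r1, hf₂.r11, hf₂.r12, hr₂.fst a ha', hr₂.snd a ha']
  rintro m₃ hm₃ ⟨hfr₃, y15, y16, y17, y18, y19, y20, y21⟩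
  have hfac : ∀ i < dep (par a), (0 : ℤ) ≤ edgeFactor M wg a (par^[i] (par a)) ∧
      (edgeFactor M wg a (par^[i] (par a)) : ℤ) ≤ 2 ^ M ^ 3 := fun i hi => by
    obtain ⟨h1, h2⟩ := S.ancestor_le ha ha' hi
    exact ⟨by positivity, by exact_mod_cast S.edgeFactor_le ha ha' h1 h2⟩
  have hb₁ := fun i hi => Bool.toInt_mul_bounds (σ.ctx (par^[i] (par a))).1 (hfac i hi).1 (hfac i hi).2
  have hb₂ := fun i hi => Bool.toInt_mul_bounds (σ.ctx (par^[i] (par a))).2 (hfac i hi).1 (hfac i hi).2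
  refine (S.weightCombine_spec hκ hm₃ (hf₂.frame hfr₃) ha' (y15.trans x15) (y16.trans x16)
    (y17.trans x17) y18 y19 y20 y21 (S.ancSum_bounds ha' hb₁ (by positivity) ha)
    (S.ancSum_bounds ha' hb₂ (by positivity) ha)
    (S.ancSum_bounds ha' (fun i hi => ⟨mul_nonneg (hb₁ i hi).1 (hb₂ i hi).1,
      mul_le_mul (hb₁ i hi).2 (hb₂ i hi).2 (hb₂ i hi).1 (by positivity)⟩) (by positivity) ha)).mono
    le_rfl ?_
  rintro m₄ - ⟨z9, z0, zr⟩
  refine ⟨z9, z0, fun r hr => ?_⟩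
  rw [zr r hr, hfr₃ r (by omega), hfr₂ r (by omega), hfr₁ r (by omega)]

theorem fixed_of_eq {m m' : Memory} (hf : Fixed n M w ℓ m)
    (h : ∀ r, r < 8 ∨ r = 11 ∨ r = 12 → m' r = m r)
    (h' : ∀ e, m' (addr e 4) = m (addr e 4)) : Fixed n M w ℓ m' where
  r0 := (h 0 (by omega)).trans hf.r0
  r1 := (h 1 (by omega)).trans hf.r1
  r2 := (h 2 (by omega)).trans hf.r2
  r3 := (h 3 (by omega)).trans hf.r3
  r4 := (h 4 (by omega)).trans hf.r4
  r5 := (h 5 (by omega)).trans hf.r5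
  r6 := (h 6 (by omega)).trans hf.r6
  r7 := (h 7 (by omega)).trans hf.r7
  r11 := (h 11 (by omega)).trans hf.r11
  r12 := (h 12 (by omega)).trans hf.r12
  pow := fun e he => (h' e).trans (hf.pow e he)

theorem step_weight {κ : ℕ} (hκ : 1 + B * B ≤ κ) {m : Memory} (hm : Bdd A B m)
    (hf : Fixed n M w ℓ m) {σ : DfsState} (hr : Represents n m σ) (ha : 1 ≤ σ.cur)
    (ha' : σ.cur ≤ n) (hc : σ.cand = 0) :
    Ev inp A B κ weightProgram m (28 * n + 40) fun m' => Fixed n M w ℓ m' ∧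
      Represents n m' (σ.step n par (localWeight par dep wg M)) := by
  refine (S.weightProgram_spec hκ hm hf hr ha ha').mono le_rfl ?_
  rintro m' - ⟨h9, h0, hk⟩
  refine ⟨S.fixed_of_eq hf (fun r hr => hk r (by omega)) fun e => hk _ (by unfold addr; omega), ?_⟩
  have hne : ∀ x j, j < 32 → (x ≠ σ.cur ∨ j ≠ 0) → m' (addr x j) = m (addr x j) := fun x j hj h =>
    hk _ (by unfold addr; omega)
  rw [DfsState.step, if_pos hc]
  refine ⟨(hk 10 (by omega)).trans hr.run, (hk 8 (by omega)).trans hr.cur, h9, fun x hx => ?_,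
    fun x hx => (hne x 1 (by omega) (by omega)).trans (hr.fst x hx),
    fun x hx => (hne x 2 (by omega) (by omega)).trans (hr.snd x hx),
    fun x hx => (hne x 3 (by omega) (by omega)).trans (hr.sum x hx)⟩
  simp only [Function.update_apply]
  split_ifs with h
  · rw [h, h0]
  · rw [hne x 0 (by omega) (.inl h), hr.prod x hx]

end Setting

/-! ### The program simulates the depth-first evaluation. -/

namespace Setting

open RAM

variable {inp : List ℕ} {n M w ℓ τ A B : ℕ} {par dep : ℕ → ℕ} {wg : ℕ → ℕ → ℕ}
  (S : Setting inp n M w ℓ τ A B par dep wg)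

include S

theorem step_scan {κ : ℕ} (hκ : 1 + B * B ≤ κ) {m : Memory} (hm : Bdd A B m)
    (hf : Fixed n M w ℓ m) {σ : DfsState} (hr : Represents n m σ) (ha' : σ.cur ≤ n)
    (hc : 1 ≤ σ.cand) (hc' : σ.cand ≤ n) {F : ℕ → (ℕ → Bool × Bool) → ℤ} :
    Ev inp A B κ scanProgram m 30 fun m' => Fixed n M w ℓ m' ∧
      Represents n m' (σ.step n par F) := by
  have hκ1 : 1 ≤ κ := le_trans (by omega) hκ
  have hreg : ∀ r < 32, r < A := fun r => S.reg_lt_A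
  obtain ⟨b1, b2, b3, b4, b5, b6⟩ := S.bounds
  have hcost : ∀ l : List Instr, ∀ a ∈ l, ∀ m, Bdd A B m → a.cost m ≤ κ :=
    fun l a _ m => Instr.cost_le hκ a m
  set a := σ.cur with hadef
  set b := σ.cand with hbdef
  have hr8 : m 8 = a := hr.cur
  have hr9 : m 9 = b := hr.cand
  have han : (a : ℤ) ≤ n := by exact_mod_cast ha'
  have hbn : (b : ℤ) ≤ n := by exact_mod_cast hc'
  have hin : inp.getD ((2 + b : ℤ)).toNat 0 = par b := by
    have : (2 + b : ℤ) = ((2 + b : ℕ) : ℤ) := by push_cast; ring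
    rw [this, Int.toNat_natCast, S.inp_par b hc hc']
  have hparle := S.tree.par_le b hc hc'
  have hparn : (par b : ℤ) ≤ n := by exact_mod_cast hparle
  have hsq : ((par b : ℤ) - a) * ((par b : ℤ) - a) ≤ M * M := by nlinarith
  have hsq0 : 0 ≤ ((par b : ℤ) - a) * ((par b : ℤ) - a) := mul_self_nonneg _
  refine (Ev.andThen (k := 5) (l := 13) (R := fun m₁ => Frame m m₁ ∧
    m₁ 13 = ((par b : ℤ) - a) * ((par b : ℤ) - a))
    (Ev.block hκ1 (hcost _) hm ?_ ⟨frame_blockRun _ (by simp) m, ?_⟩) ?_).mono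
    (by omega) fun _ _ h => h
  · simp only [blockOk, Instr.target, Instr.value, upd_apply, hf.r12, hr9, if_true, hin]
    simp [hr8, hreg]
    omega
  swap
  · simp only [blockRun, Instr.target, Instr.value, upd_apply, hf.r12, hr9, if_true, hin]
    simp [hr8]
  rintro m₁ hm₁ ⟨hfr₁, e13⟩
  have hf₁ := hf.frame hfr₁
  have hr₁ := hr.frame hfr₁
  have hr8 : m₁ 8 = a := hr₁.cur
  have hr9 : m₁ 9 = b := hr₁.cand
  refine Ev.ite (k := 12) hκ1 (fun hpos => ?_) fun hpos => ?_
  · have hne : par b ≠ a := by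
      intro h
      rw [e13, h, sub_self, mul_zero] at hpos
      exact lt_irrefl _ hpos
    rw [DfsState.step, if_neg (by omega), if_pos hc', if_neg hne]
    refine (Ev.block hκ1 (hcost _) hm₁ ?_ ⟨?_, ?_⟩).mono (by simp) fun _ _ h => h
    · simp [hr9, hf₁.r1, hreg]
      omega
    · refine S.fixed_of_eq hf₁ (fun r hr => ?_) fun e => ?_
      · have : r ≠ 9 := by omega
        simp [this]
      · simp
    · exact ⟨by simpa using hr₁.run, by simpa using hr₁.cur, by simp [hr9, hf₁.r1, ← hbdef],
        fun x hx => by simpa using hr₁.prod x hx, fun x hx => by simpa using hr₁.fst x hx,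
        fun x hx => by simpa using hr₁.snd x hx, fun x hx => by simpa using hr₁.sum x hx⟩
  · have hne : par b = a := by
      have h0 : ((par b : ℤ) - a) * ((par b : ℤ) - a) = 0 := by
        rw [e13] at hpos
        omega
      have := mul_self_eq_zero.1 h0
      omega
    rw [DfsState.step, if_neg (by omega), if_pos hc', if_pos hne]
    refine (Ev.block hκ1 (hcost _) hm₁ ?_ ⟨?_, ?_⟩).mono (by simp [enterBlock]) fun _ _ h => h
    · simp [enterBlock, hr9, hf₁.r0, hf₁.r1, hf₁.r11, hf₁.r12, hreg, S.lt_A' hc']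
      omega
    · refine S.fixed_of_eq hf₁ (fun r hr => ?_) fun e => ?_
      · have h1 : r ≠ 8 ∧ r ≠ 9 ∧ r ≠ 13 ∧ r ≠ 14 ∧ r < 32 := by omega
        simp [enterBlock, hr9, hf₁.r0, hf₁.r1, hf₁.r11, hf₁.r12, h1]
      · simp [enterBlock, hr9, hf₁.r0, hf₁.r1, hf₁.r11, hf₁.r12]
    · refine ⟨?_, ?_, ?_, fun x hx => ?_, fun x hx => ?_, fun x hx => ?_, fun x hx => ?_⟩
      · simpa [enterBlock, hr9, hf₁.r0, hf₁.r1, hf₁.r11, hf₁.r12] using hr₁.run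
      · simp [enterBlock, hr9, hf₁.r0, hf₁.r1, hf₁.r11, hf₁.r12, ← hbdef]
      · simp [enterBlock, hr9, hf₁.r0, hf₁.r1, hf₁.r11, hf₁.r12]
      · simpa [enterBlock, hr9, hf₁.r0, hf₁.r1, hf₁.r11, hf₁.r12] using hr₁.prod x hx
      · simp [enterBlock, hr9, hf₁.r0, hf₁.r1, hf₁.r11, hf₁.r12, hr₁.fst x hx,
          Function.update_apply, ← hbdef]
        split_ifs <;> rfl
      · simp [enterBlock, hr9, hf₁.r0, hf₁.r1, hf₁.r11, hf₁.r12, hr₁.snd x hx,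
          Function.update_apply, ← hbdef]
        split_ifs <;> rfl
      · simp [enterBlock, hr9, hf₁.r0, hf₁.r1, hf₁.r11, hf₁.r12, hr₁.sum x hx,
          Function.update_apply, ← hbdef]

/-- No new estimate is needed: the values written here are entries of the next state, which is good
by assumption, so they are bounded by `W`. -/
theorem step_finish {κ : ℕ} (hκ : 1 + B * B ≤ κ) {m : Memory} (hm : Bdd A B m)
    (hf : Fixed n M w ℓ m) {σ : DfsState} (hr : Represents n m σ) (ha : 1 ≤ σ.cur)
    (hc : n < σ.cand) {F : ℕ → (ℕ → Bool × Bool) → ℤ} {W : ℤ} (hW : W < 2 ^ B)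
    (hg : σ.Good n W) (hg' : (σ.step n par F).Good n W) :
    Ev inp A B κ finishProgram m 40 fun m' => Fixed n M w ℓ m' ∧
      Represents n m' (σ.step n par F) := by
  have hκ1 : 1 ≤ κ := le_trans (by omega) hκ
  have hreg : ∀ r < 32, r < A := fun r => S.reg_lt_A
  obtain ⟨b1, b2, b3, b4, b5, b6⟩ := S.bounds
  have hcost : ∀ l : List Instr, ∀ a ∈ l, ∀ m, Bdd A B m → a.cost m ≤ κ :=
    fun l a _ m => Instr.cost_le hκ a m
  have ha' := hg.cur_le
  have hstep := DfsState.step.eq_1 n par F σ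
  rw [if_neg (by omega), if_neg (by omega)] at hstep
  set a := σ.cur with hadef
  have hr8 : m 8 = a := hr.cur
  have han : (a : ℤ) ≤ n := by exact_mod_cast ha'
  have hsum : (σ.step n par F).sum a = σ.sum a + σ.prod a := by
    rw [hstep]; split_ifs <;> simp
  have hsb := hg'.sum_le a
  rw [hsum, abs_le] at hsb
  have hpb := hg.prod_le a
  have hs0 := hg.sum_le a
  rw [abs_le] at hpb hs0
  have hin : inp.getD ((2 + a : ℤ)).toNat 0 = par a := by
    have : (2 + a : ℤ) = ((2 + a : ℕ) : ℤ) := by push_cast; ring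
    rw [this, Int.toNat_natCast, S.inp_par a ha ha']
  have hparle := S.tree.par_le a ha ha'
  have hparn : (par a : ℤ) ≤ n := by exact_mod_cast hparle
  have hc₁ := Bool.toInt_bounds (σ.ctx a).1
  have hc₂ := Bool.toInt_bounds (σ.ctx a).2
  refine (Ev.andThen (k := 13) (l := 12) (R := fun m₁ =>
    (∀ r, r < 13 ∨ (32 ≤ r ∧ r ≠ addr a 3) → m₁ r = m r) ∧ m₁ (addr a 3) = σ.sum a + σ.prod a ∧
    m₁ 14 = ((a : ℤ) + 1) * 32 + 1 ∧ m₁ 15 = ((a : ℤ) + 1) * 32 + 2 ∧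
    m₁ 17 = σ.sum a + σ.prod a ∧ m₁ 18 = (σ.ctx a).1.toInt ∧ m₁ 19 = (σ.ctx a).2.toInt)
    (Ev.block hκ1 (hcost _) hm ?_ ?_) ?_).mono (by omega) fun _ _ h => h
  · simp [sumBlock, hr8, hf.r1, hf.r11, hf.r12, hr.prod a ha', hr.sum a ha', hr.fst a ha',
      hr.snd a ha', hreg, S.lt_A' ha']
    omega
  · refine ⟨fun r hr' => ?_, ?_⟩
    · have h1 : r ≠ 13 ∧ r ≠ 14 ∧ r ≠ 15 ∧ r ≠ 16 ∧ r ≠ 17 ∧ r ≠ 18 ∧ r ≠ 19 ∧ r ≠ addr a 3 := by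
        unfold addr at *; omega
      simp [sumBlock, hr8, hf.r1, hf.r11, hf.r12, h1]
    · simp [sumBlock, hr8, hf.r1, hf.r11, hf.r12, hr.prod a ha', hr.sum a ha', hr.fst a ha',
        hr.snd a ha']
  rintro m₁ hm₁ ⟨hk, e3, e14, e15, e17, e18, e19⟩
  have hk4 : ∀ x j, j < 32 → j ≠ 3 → m₁ (addr x j) = m (addr x j) := fun x j hj h =>
    hk _ (by unfold addr; omega)
  have hf₁ : Fixed n M w ℓ m₁ := S.fixed_of_eq hf (fun r hr => hk r (by omega))
    fun e => hk4 e 4 (by omega) (by omega)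
  have hr8 : m₁ 8 = a := (hk 8 (by omega)).trans hr8
  have hr10 : m₁ 10 = 1 := (hk 10 (by omega)).trans hr.run
  have hp : ∀ x ≤ n, m₁ (addr x 0) = σ.prod x := fun x hx =>
    (hk4 x 0 (by omega) (by omega)).trans (hr.prod x hx)
  have h1 : ∀ x ≤ n, m₁ (addr x 1) = (σ.ctx x).1.toInt := fun x hx =>
    (hk4 x 1 (by omega) (by omega)).trans (hr.fst x hx)
  have h2 : ∀ x ≤ n, m₁ (addr x 2) = (σ.ctx x).2.toInt := fun x hx =>
    (hk4 x 2 (by omega) (by omega)).trans (hr.snd x hx)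
  have h3 : ∀ x ≤ n, m₁ (addr x 3) =
      Function.update σ.sum a (σ.sum a + σ.prod a) x := fun x hx => by
    rw [Function.update_apply]
    split_ifs with h
    · rw [h, e3]
    · rw [hk _ (by unfold addr; omega), hr.sum x hx]
  refine Ev.ite (k := 11) hκ1 (fun hpos => Ev.ite (k := 10) hκ1 (fun hpos' => ?_) fun hpos' => ?_)
    fun hpos => ?_
  · rw [e19, Bool.toInt_pos] at hpos
    rw [e18, Bool.toInt_pos] at hpos'
    rw [if_pos hpos, if_pos hpos'] at hstep
    have hmul : |σ.prod (par a) * (σ.sum a + σ.prod a)| ≤ W := by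
      have := hg'.prod_le (par a)
      rw [hstep] at this
      simpa using this
    rw [abs_le] at hmul
    have hpp := hg.prod_le (par a)
    rw [abs_le] at hpp
    refine (Ev.block hκ1 (hcost _) hm₁ ?_ ⟨?_, ?_⟩).mono (by simp [popBlock]) fun _ _ h => h
    · simp only [popBlock, blockOk, Instr.target, Instr.value, upd_apply, hf₁.r12, hr8, if_true, hin]
      simp [hf₁.r0, hf₁.r1, hf₁.r11, e17, hreg, S.lt_A' hparle, hp _ hparle]
      omega
    · refine S.fixed_of_eq hf₁ (fun r hr => ?_) fun e => ?_
      · have h1 : r ≠ 8 ∧ r ≠ 9 ∧ r ≠ 16 ∧ r ≠ 18 ∧ r < 32 := by omega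
        simp only [popBlock, blockRun, Instr.target, Instr.value, upd_apply, hf₁.r12, hr8, if_true, hin]
        simp [hf₁.r1, hf₁.r11, h1]
      · simp only [popBlock, blockRun, Instr.target, Instr.value, upd_apply, hf₁.r12, hr8, if_true, hin]
        simp [hf₁.r1, hf₁.r11]
    · rw [hstep]
      refine ⟨?_, ?_, ?_, fun x hx => ?_, fun x hx => ?_, fun x hx => ?_, fun x hx => ?_⟩
      all_goals
        simp only [popBlock, blockRun, Instr.target, Instr.value, upd_apply, hf₁.r12, hr8, if_true,
          hin]
        simp [hf₁.r0, hf₁.r1, hf₁.r11, hr10, hp _ hparle, e17, Function.update_apply]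
      · simp [hp x hx]
      · simp [h1 x hx]
      · simp [h2 x hx]
      · simp [h3 x hx, Function.update_apply]
  · rw [e19, Bool.toInt_pos] at hpos
    rw [e18, Bool.toInt_pos] at hpos'
    rw [if_pos hpos, if_neg hpos'] at hstep
    refine (Ev.block hκ1 (hcost _) hm₁ ?_ ⟨?_, ?_⟩).mono (by simp) fun _ _ h => h
    · simp [e14, e15, hf₁.r0, hf₁.r1, hreg, S.lt_A' ha']
      omega
    · refine S.fixed_of_eq hf₁ (fun r hr => ?_) fun e => ?_
      · have h1 : r ≠ 9 ∧ r < 32 := by omega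
        simp [e14, e15, h1]
      · simp [e14, e15]
    · rw [hstep]
      refine ⟨?_, ?_, ?_, fun x hx => ?_, fun x hx => ?_, fun x hx => ?_, fun x hx => ?_⟩
      all_goals simp [e14, e15, hr8, hr10, hf₁.r0, hf₁.r1, Function.update_apply]
      · simp [hp x hx]
      · simp [h1 x hx]; split_ifs <;> rfl
      · simp [h2 x hx]; split_ifs <;> rfl
      · simp [h3 x hx, Function.update_apply]
  · rw [e19, Bool.toInt_pos] at hpos
    rw [if_neg hpos] at hstep
    refine (Ev.block hκ1 (hcost _) hm₁ ?_ ⟨?_, ?_⟩).mono (by simp) fun _ _ h => h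
    · simp [e15, hf₁.r1, hreg, S.lt_A' ha']
      omega
    · refine S.fixed_of_eq hf₁ (fun r hr => ?_) fun e => ?_
      · have h1 : r ≠ 9 ∧ r < 32 := by omega
        simp [e15, h1]
      · simp [e15]
    · rw [hstep]
      refine ⟨?_, ?_, ?_, fun x hx => ?_, fun x hx => ?_, fun x hx => ?_, fun x hx => ?_⟩
      all_goals simp [e15, hr8, hr10, hf₁.r1, Function.update_apply]
      · simp [hp x hx]
      · simp [h1 x hx]; split_ifs with h <;> simp [h]
      · simp [h2 x hx]; split_ifs <;> rfl
      · simp [h3 x hx, Function.update_apply]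

theorem dfsBody_spec {κ : ℕ} (hκ : 1 + B * B ≤ κ) {m : Memory} (hm : Bdd A B m)
    (hf : Fixed n M w ℓ m) {σ : DfsState} (hr : Represents n m σ) {W : ℤ} (hW : W < 2 ^ B)
    (hfin : ¬ (σ.cur = 0 ∧ n < σ.cand)) (hg : σ.Good n W)
    (hg' : (σ.step n par (localWeight par dep wg M)).Good n W) :
    Ev inp A B κ dfsBody m (28 * n + 60) fun m' => Fixed n M w ℓ m' ∧
      Represents n m' (σ.step n par (localWeight par dep wg M)) := by
  have hκ1 : 1 ≤ κ := le_trans (by omega) hκ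
  have hreg : ∀ r < 32, r < A := fun r => S.reg_lt_A
  obtain ⟨b1, b2, b3, b4, b5, b6⟩ := S.bounds
  have hcost : ∀ l : List Instr, ∀ a ∈ l, ∀ m, Bdd A B m → a.cost m ≤ κ :=
    fun l a _ m => Instr.cost_le hκ a m
  have hcn : (σ.cand : ℤ) ≤ n + 1 := by exact_mod_cast hg.cand_le
  refine (Ev.ite (k := 28 * n + 50) hκ1 (fun hpos => ?_) fun hpos => ?_).mono (by omega)
    fun _ _ h => h
  · rw [hr.cand] at hpos
    refine (Ev.andThen (k := 3) (l := 42) (R := fun m₁ => Frame m m₁ ∧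
      m₁ 13 = n - σ.cand + 1) (Ev.block hκ1 (hcost _) hm ?_
        ⟨frame_blockRun _ (by simp) m, ?_⟩) ?_).mono (by omega) fun _ _ h => h
    · simp [hf.r1, hf.r2, hr.cand, hreg]
      omega
    swap
    · simp [hf.r1, hf.r2, hr.cand]
    rintro m₁ hm₁ ⟨hfr₁, e13⟩
    have hf₁ := hf.frame hfr₁
    have hr₁ := hr.frame hfr₁
    refine Ev.ite (k := 41) hκ1 (fun hpos' => ?_) fun hpos' => ?_
    · refine (S.step_scan hκ hm₁ hf₁ hr₁ hg.cur_le (by omega) (by omega)).mono (by omega)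
        fun _ _ h => h
    · refine Ev.ite (k := 40) hκ1 (fun hcur => ?_) fun hcur => ?_
      · rw [hr₁.cur] at hcur
        exact S.step_finish hκ hm₁ hf₁ hr₁ (by omega) (by omega) hW hg hg'
      · rw [hr₁.cur] at hcur
        exact absurd ⟨by omega, by omega⟩ hfin
  · rw [hr.cand] at hpos
    exact (S.step_weight hκ hm hf hr (hg.cur_pos (by omega)) hg.cur_le (by omega)).mono
      (by omega) fun _ _ h => h

/-- Each step of the search is one iteration. In the final state one more iteration clears the
running flag and keeps the product of the root. -/
theorem dfsLoop_spec {κ : ℕ} (hκ : 1 + B * B ≤ κ) {W : ℤ} (hW : W < 2 ^ B) {T : ℕ}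
    {σ σ' : DfsState} (h : DfsState.Reach n par (localWeight par dep wg M) W T σ σ')
    (h0 : σ'.cur = 0) (h1 : n < σ'.cand) {m : Memory} (hm : Bdd A B m)
    (hf : Fixed n M w ℓ m) (hr : Represents n m σ) :
    Ev inp A B κ (.loop 10 dfsBody) m (T * (28 * n + 61) + 60) fun m' => Fixed n M w ℓ m' ∧
      m' (addr 0 0) = σ'.prod 0 := by
  have hκ1 : 1 ≤ κ := le_trans (by omega) hκ
  have hreg : ∀ r < 32, r < A := fun r => S.reg_lt_A
  obtain ⟨b1, b2, b3, b4, b5, b6⟩ := S.bounds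
  have hcost : ∀ l : List Instr, ∀ a ∈ l, ∀ m, Bdd A B m → a.cost m ≤ κ :=
    fun l a _ m => Instr.cost_le hκ a m
  induction h generalizing m with
  | @refl σ hg =>
    have hcn : (σ.cand : ℤ) ≤ n + 1 := by exact_mod_cast hg.cand_le
    refine (Ev.loop_step (k := 20) (l := 1) hκ1 (by rw [hr.run]; norm_num)
      ((Ev.ite (k := 10) hκ1 (fun _ => ?_) fun hpos => ?_).mono (by omega) fun _ _ h => h)).mono
      (by omega) fun _ _ h => h
    · refine Ev.andThen (k := 3) (l := 7) (R := fun m₁ => Frame m m₁ ∧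
        m₁ 13 = n - σ.cand + 1) (Ev.block hκ1 (hcost _) hm ?_
          ⟨frame_blockRun _ (by simp) m, ?_⟩) ?_
      · simp [hf.r1, hf.r2, hr.cand, hreg]
        omega
      · simp [hf.r1, hf.r2, hr.cand]
      rintro m₁ hm₁ ⟨hfr₁, e13⟩
      have hf₁ := hf.frame hfr₁
      have hr₁ := hr.frame hfr₁
      refine Ev.ite (k := 6) hκ1 (fun hpos' => ?_) fun _ => ?_
      · rw [e13] at hpos'; omega
      · refine (Ev.ite (k := 2) hκ1 (fun hcur => ?_) fun hcur => ?_).mono (by omega) fun _ _ h => h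
        · rw [hr₁.cur, h0] at hcur
          exact absurd hcur (lt_irrefl _)
        · refine (Ev.block hκ1 (hcost _) hm₁ ?_ ?_ (Q := fun m₂ => Fixed n M w ℓ m₂ ∧ m₂ 10 = 0 ∧
            m₂ (addr 0 0) = σ.prod 0)).mono le_rfl fun m₂ hm₂ h =>
              Ev.loop_stop hκ1 hm₂ (by rw [h.2.1]; norm_num) ⟨h.1, h.2.2⟩
          · simp [hreg]
          · refine ⟨S.fixed_of_eq hf₁ (fun r hr => ?_) fun e => ?_, ?_, ?_⟩
            · have : r ≠ 10 := by omega
              simp [this]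
            · simp
            · simp
            · simpa using hr₁.prod 0 (Nat.zero_le n)
    · rw [hr.cand] at hpos
      omega
  | @head j σ σ' hg hfin hreach ih =>
    refine (Ev.loop_step (l := j * (28 * n + 61) + 60) hκ1 (by rw [hr.run]; norm_num)
      ((S.dfsBody_spec hκ hm hf hr hW hfin hg hreach.good_left).mono le_rfl fun m' hm' h =>
        ih h0 h1 hm' h.1 h.2)).mono (by ring_nf; omega) fun _ _ h => h

end Setting

/-! ### Table of powers, initialization of the search, and extraction of a digit. -/

namespace RAM

/-- Preparation of the table of powers of two. -/
def powInit : List Instr :=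
  -- There are `M ^ 5 + 1` powers to write, and 36 is `addr 0 4`, the first entry of their array.
  [.mul 13 5 5, .mul 14 13 13, .mul 6 14 5, .add 14 6 1, .const 15 1, .const 16 36]

/-- Writing one power of two. -/
def powStep : List Instr :=
  [.store 16 15, .add 15 15 15, .add 16 16 11, .sub 14 14 1]

/-- Preparation of the depth-first evaluation. -/
def dfsInit : List Instr :=
  -- The value `2 ^ M ^ 3` comes from the table. Register 11 contains 32, which is `addr 0 0`, so
  -- the last store sets the product of the root to 1.
  [.mul 13 5 5, .mul 13 13 5, .add 13 13 1, .mul 13 13 11, .const 14 4, .add 13 13 14, .load 7 13,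
    .const 8 0, .const 9 1, .const 10 1, .store 11 1]

/-- Preparation of the extraction of the coefficient. -/
def extractInit : List Instr :=
  -- Register 15 counts the bits from `M ^ 5` down to the lowest bit of the wanted digit, register
  -- 16 is the modulus `2 ^ M`, and register 18 points at the last entry of the table.
  [.load 13 11, .add 14 5 1, .mul 15 14 5, .mul 15 15 4, .add 15 15 3, .mul 15 15 5, .sub 15 6 15,
    .mul 16 14 11, .const 17 4, .add 16 16 17, .load 16 16, .add 18 6 1, .mul 18 18 11,
    .add 18 18 17]

/-- One step of the extraction of the coefficient by binary division. -/
def extractStep : Program :=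
  -- From here on register 0 is not the constant 0 but the quotient, which is doubled to receive the
  -- next bit.
  .seq (block [.sub 18 18 11, .load 19 18, .add 0 0 0, .sub 20 13 19, .add 20 20 1])
    (.seq (.ite 20 (block [.sub 13 13 19, .add 0 0 1]) .skip)
      (.seq (block [.sub 20 0 16, .add 20 20 1])
        (.seq (.ite 20 (block [.sub 0 0 16]) .skip) (block [.sub 15 15 1]))))

/-- The main part of the program. -/
def solveProgram : Program :=
  .seq (.seq (block powInit) (.loop 14 (block powStep)))
    (.seq (block dfsInit)
      (.seq (.loop 10 dfsBody) (.seq (block extractInit) (.loop 15 extractStep))))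

/-- The state of the memory before the main part. -/
structure Prepared (n M w ℓ : ℕ) (m : Memory) : Prop where
  r0 : m 0 = 0
  r1 : m 1 = 1
  r2 : m 2 = n
  r3 : m 3 = w
  r4 : m 4 = ℓ
  r5 : m 5 = M
  r11 : m 11 = 32
  r12 : m 12 = 2
  rest : ∀ a, 32 ≤ a → m a = 0

end RAM

/-- One step of binary long division: comparing the remainder with `2 ^ e` reveals the next bit of
the quotient. -/
theorem mod_two_pow_step (Q e : ℕ) :
    (2 ^ e ≤ Q % 2 ^ (e + 1) → Q % 2 ^ e = Q % 2 ^ (e + 1) - 2 ^ e ∧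
      Q / 2 ^ e = 2 * (Q / 2 ^ (e + 1)) + 1) ∧
    (Q % 2 ^ (e + 1) < 2 ^ e → Q % 2 ^ e = Q % 2 ^ (e + 1) ∧
      Q / 2 ^ e = 2 * (Q / 2 ^ (e + 1))) := by
  have h1 : Q % 2 ^ (e + 1) = Q % 2 ^ e + 2 ^ e * (Q / 2 ^ e % 2) := Nat.mod_pow_succ
  have h2 : Q / 2 ^ (e + 1) = Q / 2 ^ e / 2 := by rw [pow_succ, Nat.div_div_eq_div_mul]
  have h3 : Q % 2 ^ e < 2 ^ e := Nat.mod_lt _ (by positivity)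
  rcases Nat.mod_two_eq_zero_or_one (Q / 2 ^ e) with h | h <;> rw [h] at h1 <;> omega

/-- After appending a bit to a residue, a single conditional subtraction reduces it again, so no
division instruction is needed. -/
theorem two_mul_add_mod (X P b : ℕ) (hP : 0 < P) (hb : b ≤ 1) :
    (2 * X + b) % P = if P ≤ 2 * (X % P) + b then 2 * (X % P) + b - P else 2 * (X % P) + b := by
  have h := Nat.mod_lt X hP
  have h1 : 2 * X + b = 2 * (X % P) + b + P * (2 * (X / P)) := by
    have := Nat.mod_add_div X P
    nlinarith
  rw [h1, Nat.add_mul_mod_self_left]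
  split_ifs with h2
  · rw [Nat.mod_eq_sub_mod h2, Nat.mod_eq_of_lt (by omega)]
  · rw [Nat.mod_eq_of_lt (by omega)]

/-! ### Correctness of the main part of the program. -/

namespace Setting

open RAM

variable {inp : List ℕ} {n M w ℓ τ A B : ℕ} {par dep : ℕ → ℕ} {wg : ℕ → ℕ → ℕ}
  (S : Setting inp n M w ℓ τ A B par dep wg)

include S

/-- Each of the two factors is at most `(n + 1) * 2 ^ M ^ 3`, the correction at most `(n + 1) * 2 ^
(2 * M ^ 3)`, and `(n + 1) ^ 2 + (n + 1) ≤ M`. -/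
theorem localWeight_abs_le {a : ℕ} (ha : a ≤ n) (c : ℕ → Bool × Bool) :
    |localWeight par dep wg M a c| ≤ ((M * (2 ^ M ^ 3) ^ 2 : ℕ) : ℤ) := by
  obtain ⟨p1, p2, p3, p4, p5, p6, p7⟩ := S.bounds_pow
  have key : ∀ U₁ U₂ U₃ : ℤ, (0 ≤ U₁ ∧ U₁ ≤ n * 2 ^ M ^ 3) → (0 ≤ U₂ ∧ U₂ ≤ n * 2 ^ M ^ 3) →
      (0 ≤ U₃ ∧ U₃ ≤ n * (2 ^ M ^ 3 * 2 ^ M ^ 3)) →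
      |(if (c a).1 then (2 ^ M ^ 3 : ℤ) else U₁ - 2 ^ M ^ 3) *
        (if (c a).2 then (2 ^ M ^ 3 : ℤ) else U₂ - 2 ^ M ^ 3) +
        (if c a = (false, false) then 1 - U₃ else 0)| ≤ ((M * (2 ^ M ^ 3) ^ 2 : ℕ) : ℤ) := by
    intro U₁ U₂ U₃ h₁ h₂ h₃
    have hn : 0 ≤ (n : ℤ) * 2 ^ M ^ 3 := by positivity
    have hn' : 0 ≤ (n : ℤ) * (2 ^ M ^ 3 * 2 ^ M ^ 3) := by positivity
    have e1 : |if (c a).1 then (2 ^ M ^ 3 : ℤ) else U₁ - 2 ^ M ^ 3| ≤ (n + 1) * 2 ^ M ^ 3 := by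
      rw [abs_le]; split_ifs <;> constructor <;> linarith
    have e2 : |if (c a).2 then (2 ^ M ^ 3 : ℤ) else U₂ - 2 ^ M ^ 3| ≤ (n + 1) * 2 ^ M ^ 3 := by
      rw [abs_le]; split_ifs <;> constructor <;> linarith
    have e3 : |if c a = (false, false) then 1 - U₃ else 0| ≤ (n + 1) * (2 ^ M ^ 3 * 2 ^ M ^ 3) := by
      rw [abs_le]; split_ifs <;> constructor <;> linarith
    refine (abs_add_le _ _).trans ?_
    rw [abs_mul]
    have e4 := mul_le_mul e1 e2 (abs_nonneg _) (by positivity)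
    have h : ((n : ℤ) + 1) * (n + 1) + (n + 1) ≤ M := by
      have h := S.M_ge
      have : (n + 1) * (n + 1) + (n + 1) ≤ M := by nlinarith
      exact_mod_cast this
    calc _ ≤ (((n : ℤ) + 1) * (n + 1) + (n + 1)) * (2 ^ M ^ 3 * 2 ^ M ^ 3) := by linarith
      _ ≤ M * (2 ^ M ^ 3 * 2 ^ M ^ 3) := mul_le_mul_of_nonneg_right h (by positivity)
      _ = _ := by push_cast; ring
  rcases Nat.eq_zero_or_pos a with rfl | h0
  -- The artificial root has no ancestors; it is included because the search wants a bound at all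
  -- nodes up to `n`.
  · have hz : ∀ g : ℕ → ℤ, ancSum par dep g 0 = 0 := fun g => by
      rw [ancSum, S.tree.par_zero, S.tree.dep_zero]; simp
    unfold localWeight
    rw [hz, hz, hz]
    exact key 0 0 0 ⟨le_rfl, by positivity⟩ ⟨le_rfl, by positivity⟩ ⟨le_rfl, by positivity⟩
  · have hfac : ∀ i < dep (par a), (0 : ℤ) ≤ edgeFactor M wg a (par^[i] (par a)) ∧
        (edgeFactor M wg a (par^[i] (par a)) : ℤ) ≤ 2 ^ M ^ 3 := fun i hi => by
      obtain ⟨h1, h2⟩ := S.ancestor_le h0 ha hi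
      exact ⟨by positivity, by exact_mod_cast S.edgeFactor_le h0 ha h1 h2⟩
    have hb₁ := fun i hi =>
      Bool.toInt_mul_bounds (c (par^[i] (par a))).1 (hfac i hi).1 (hfac i hi).2
    have hb₂ := fun i hi =>
      Bool.toInt_mul_bounds (c (par^[i] (par a))).2 (hfac i hi).1 (hfac i hi).2
    exact key _ _ _ (S.ancSum_bounds ha hb₁ (by positivity) h0)
      (S.ancSum_bounds ha hb₂ (by positivity) h0)
      (S.ancSum_bounds ha (fun i hi => ⟨mul_nonneg (hb₁ i hi).1 (hb₂ i hi).1,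
        mul_le_mul (hb₁ i hi).2 (hb₂ i hi).2 (hb₂ i hi).1 (by positivity)⟩) (by positivity) h0)

theorem powers_spec {κ : ℕ} (hκ : 1 + B * B ≤ κ) {m : Memory} (hm : Bdd A B m)
    (hp : Prepared n M w ℓ m) :
    Ev inp A B κ (.seq (block powInit) (.loop 14 (block powStep))) m (6 * M ^ 5 + 20) fun m' =>
      (∀ r, r < 13 → r ≠ 6 → m' r = m r) ∧ m' 6 = (M : ℤ) ^ 5 ∧
      (∀ e ≤ M ^ 5, m' (addr e 4) = 2 ^ e) ∧ ∀ e, ∀ j < 4, m' (addr e j) = 0 := by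
  have hκ1 : 1 ≤ κ := le_trans (by omega) hκ
  have hreg : ∀ r < 32, r < A := fun r => S.reg_lt_A
  obtain ⟨b1, b2, b3, b4, b5, b6⟩ := S.bounds
  have hcost : ∀ l : List Instr, ∀ a ∈ l, ∀ m, Bdd A B m → a.cost m ≤ κ :=
    fun l a _ m => Instr.cost_le hκ a m
  have h2 : (M : ℤ) * M * (M * M) ≤ M ^ 5 := by
    have : (M : ℤ) ^ 5 = M * M * (M * M) * M := by ring
    have : 0 ≤ (M : ℤ) * M * (M * M) := by positivity
    nlinarith
  have h5 : (M : ℤ) * M * (M * M) * M = M ^ 5 := by ring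
  have hL : ((M ^ 5 : ℕ) : ℤ) = M ^ 5 := by push_cast; rfl
  refine (Ev.andThen (k := 7) (l := (M ^ 5 + 1) * 6 + 1) (R := fun m₁ =>
    (∀ r, r < 13 ∨ 32 ≤ r → r ≠ 6 → m₁ r = m r) ∧ m₁ 6 = (M : ℤ) ^ 5 ∧
    m₁ 14 = (M : ℤ) ^ 5 + 1 ∧ m₁ 15 = 1 ∧ m₁ 16 = 36) (Ev.block hκ1 (hcost _) hm ?_
      ?_) ?_).mono (by ring_nf; omega) fun _ _ h => h
  · have : 0 ≤ (M : ℤ) * M * (M * M) := by positivity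
    simp [powInit, hp.r5, hp.r1, hreg, h5]
    omega
  · refine ⟨fun r hr hr6 => ?_, ?_⟩
    · have : r ≠ 13 ∧ r ≠ 14 ∧ r ≠ 15 ∧ r ≠ 16 := by omega
      simp [powInit, this, hr6]
    · simp [powInit, hp.r5, hp.r1, h5]
  rintro m₁ hm₁ ⟨hk, e6, e14, e15, e16⟩
  have e1 : m₁ 1 = 1 := (hk 1 (by omega) (by omega)).trans hp.r1
  have e11 : m₁ 11 = 32 := (hk 11 (by omega) (by omega)).trans hp.r11
  let I : ℕ → Memory → Prop := fun j m₂ => (∀ r, r < 13 → m₂ r = m₁ r) ∧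
    ∃ e, e + j = M ^ 5 + 1 ∧ m₂ 14 = j ∧ m₂ 15 = 2 ^ e ∧ m₂ 16 = ((e : ℤ) + 1) * 32 + 4 ∧
      (∀ i < e, m₂ (addr i 4) = 2 ^ i) ∧ ∀ i, ∀ j < 4, m₂ (addr i j) = 0
  have hloop := Ev.loop (inp := inp) (A := A) (B := B) (κ := κ) (i := 14)
    (p := block powStep) (k := 5) I hκ1 ?_ ?_ (j := M ^ 5 + 1) hm₁
    ⟨fun _ _ => rfl, 0, by omega, by rw [e14]; push_cast; rfl, by simpa using e15,
      by rw [e16]; norm_num, by simp, fun i j hj => ?_⟩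
  · refine hloop.mono (by omega) ?_
    rintro m₂ - ⟨hk₂, e, he, -, -, -, hpow, hz⟩
    exact ⟨fun r hr hr6 => (hk₂ r hr).trans (hk r (.inl hr) hr6), (hk₂ 6 (by omega)).trans e6,
      fun i hi => hpow i (by omega), hz⟩
  · rintro m₂ ⟨-, e, he, h14, -⟩
    rw [h14]; simp
  · rintro j m₂ hm₂ ⟨hk₂, e, he, h14, h15, h16, hpow, hz⟩
    refine ⟨by rw [h14]; positivity, ?_⟩
    have x1 : m₂ 1 = 1 := (hk₂ 1 (by omega)).trans e1
    have x11 : m₂ 11 = 32 := (hk₂ 11 (by omega)).trans e11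
    have haddr : (((e : ℤ) + 1) * 32 + 4).toNat = addr e 4 := by unfold addr; omega
    have hA : addr e 4 < A := S.lt_A (by omega) (by norm_num)
    have hpe : (2 : ℤ) ^ e + 2 ^ e < 2 ^ B := by
      have : (2 : ℤ) ^ (e + 1) < 2 ^ B :=
        pow_lt_pow_right₀ (by norm_num) (by have := S.pow_le; omega)
      rw [pow_succ] at this
      linarith
    have hpe0 : (0 : ℤ) < 2 ^ e := by positivity
    have heL : (e : ℤ) + j = M ^ 5 := by rw [← hL]; exact_mod_cast (by omega : e + j = M ^ 5)
    refine Ev.block hκ1 (hcost _) hm₂ ?_ ⟨fun r hr => ?_, e + 1, by omega, ?_, ?_, ?_,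
      fun i hi => ?_, fun i k hk => ?_⟩
    · simp [powStep, h14, h15, h16, x1, x11, haddr, hreg, hA]
      omega
    · have : r ≠ 14 ∧ r ≠ 15 ∧ r ≠ 16 ∧ r < 32 := by omega
      simp [powStep, h16, haddr, this, hk₂ r hr]
    · simp [powStep, h14, h16, x1, haddr]
    · simp [powStep, h15, h16, haddr, pow_succ]; ring
    · simp [powStep, h16, x11, haddr]; ring
    · simp [powStep, h15, h16, haddr]
      split_ifs with hie
      · rw [hie]
      · exact hpow i (by omega)
    · have h1 : k < 32 := by omega
      have h2 : k ≠ 4 := by omega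
      simp [powStep, h15, h16, haddr, h1, h2, hz i k hk]
  · rw [hk _ (.inr (by unfold addr; omega)) (by unfold addr; omega)]
    exact hp.rest _ (by unfold addr; omega)

/-- Register 13 holds the remainder of `Q` modulo the current power of two, register 0 the quotient
reduced modulo `2 ^ M`. -/
theorem extractStep_spec {κ : ℕ} (hκ : 1 + B * B ≤ κ) {m : Memory} (hm : Bdd A B m)
    {Q e : ℕ} (he : e < M ^ 5) (h1 : m 1 = 1) (h11 : m 11 = 32)
    (h18 : m 18 = ((e : ℤ) + 1 + 1) * 32 + 4) (hpow : m (addr e 4) = 2 ^ e)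
    (h13 : m 13 = (Q % 2 ^ (e + 1) : ℕ)) (h0 : m 0 = (Q / 2 ^ (e + 1) % 2 ^ M : ℕ))
    (h16 : m 16 = 2 ^ M) (h15 : 0 ≤ m 15) :
    Ev inp A B κ extractStep m 25 fun m' => m' 15 = m 15 - 1 ∧ m' 18 = ((e : ℤ) + 1) * 32 + 4 ∧
      m' 13 = (Q % 2 ^ e : ℕ) ∧ m' 0 = (Q / 2 ^ e % 2 ^ M : ℕ) ∧
      ∀ r, r ≠ 0 → r ≠ 13 → r ≠ 15 → r ≠ 18 → r ≠ 19 → r ≠ 20 → m' r = m r := by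
  have hκ1 : 1 ≤ κ := le_trans (by omega) hκ
  have hreg : ∀ r < 32, r < A := fun r => S.reg_lt_A
  obtain ⟨b1, b2, b3, b4, b5, b6⟩ := S.bounds
  have hcost : ∀ l : List Instr, ∀ a ∈ l, ∀ m, Bdd A B m → a.cost m ≤ κ :=
    fun l a _ m => Instr.cost_le hκ a m
  have hL : ((M ^ 5 : ℕ) : ℤ) = M ^ 5 := by push_cast; rfl
  have heL : (e : ℤ) < M ^ 5 := by rw [← hL]; exact_mod_cast he
  have haddr : (((e : ℤ) + 1 + 1) * 32 + 4 - 32).toNat = addr e 4 := by unfold addr; omega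
  set q := Q % 2 ^ (e + 1) with hq
  set a := Q / 2 ^ (e + 1) % 2 ^ M with ha
  have hqlt : (q : ℤ) < 2 * 2 ^ e := by
    have : q < 2 ^ (e + 1) := Nat.mod_lt _ (by positivity)
    rw [pow_succ] at this
    have h' : ((q : ℕ) : ℤ) < ((2 ^ e * 2 : ℕ) : ℤ) := by exact_mod_cast this
    push_cast at h'
    linarith
  have halt : (a : ℤ) < 2 ^ M := by
    have : a < 2 ^ M := Nat.mod_lt _ (by positivity)
    exact_mod_cast this
  have hpe : (2 : ℤ) * 2 ^ e < 2 ^ B := by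
    have : (2 : ℤ) ^ (e + 1) < 2 ^ B :=
      pow_lt_pow_right₀ (by norm_num) (by have := S.pow_le; omega)
    rw [pow_succ] at this
    linarith
  have hpM : (2 : ℤ) * 2 ^ M < 2 ^ B := by
    have : (2 : ℤ) ^ (M + 1) < 2 ^ B := by
      refine pow_lt_pow_right₀ (by norm_num) ?_
      have := S.pow_le
      have := Nat.le_self_pow (n := 5) (by norm_num) M
      omega
    rw [pow_succ] at this
    linarith
  have hpe0 : (0 : ℤ) < 2 ^ e := by positivity
  have hpM0 : (0 : ℤ) < 2 ^ M := by positivity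
  obtain ⟨s1, s2⟩ := mod_two_pow_step Q e
  have hcast : ((2 ^ e : ℕ) : ℤ) = 2 ^ e := by push_cast; rfl
  have hcastM : ((2 ^ M : ℕ) : ℤ) = 2 ^ M := by push_cast; rfl
  refine (Ev.andThen (k := 6) (l := 19) (R := fun m₁ => m₁ 18 = ((e : ℤ) + 1) * 32 + 4 ∧
    m₁ 19 = 2 ^ e ∧ m₁ 0 = 2 * a ∧ m₁ 20 = q - 2 ^ e + 1 ∧
    ∀ r, r ≠ 0 → r ≠ 18 → r ≠ 19 → r ≠ 20 → m₁ r = m r)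
    (Ev.block hκ1 (hcost _) hm ?_ ⟨?_, ?_, ?_, ?_, fun r g1 g2 g3 g4 => ?_⟩) ?_)
  · simp [h18, h11, h0, h13, h1, haddr, hpow, hreg]
    omega
  · simp [h18, h11]; ring
  · simp [h18, h11, haddr, hpow]
  · simp [h0]; ring
  · simp [h18, h11, h13, h1, haddr, hpow]
  · simp [g1, g2, g3, g4]
  rintro m₁ hm₁ ⟨x18, x19, x0, x20, hk₁⟩
  refine (Ev.andThen (k := 4) (l := 15) (R := fun m₂ => m₂ 13 = (Q % 2 ^ e : ℕ) ∧
    (∃ b : ℕ, b ≤ 1 ∧ m₂ 0 = 2 * a + b ∧ Q / 2 ^ e = 2 * (Q / 2 ^ (e + 1)) + b) ∧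
    ∀ r, r ≠ 0 → r ≠ 13 → m₂ r = m₁ r)
    (Ev.ite (k := 3) hκ1 (fun hpos => ?_) fun hpos => ?_) ?_)
  · rw [x20] at hpos
    obtain ⟨s1, s1'⟩ := s1 (by omega)
    refine Ev.block hκ1 (hcost _) hm₁ ?_ ⟨?_, ⟨1, le_rfl, ?_, s1'⟩, fun r g1 g2 => ?_⟩
    · simp [hk₁, h13, x19, x0, h1, hreg]
      omega
    · have : blockRun inp [.sub 13 13 19, .add 0 0 1] m₁ 13 = m₁ 13 - m₁ 19 := by simp
      rw [this, hk₁ _ (by norm_num) (by norm_num) (by norm_num) (by norm_num), h13, x19, s1]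
      omega
    · simp [hk₁, x0, h1]
    · simp [g1, g2]
  · rw [x20] at hpos
    obtain ⟨s2, s2'⟩ := s2 (by omega)
    refine (Ev.skip hκ1 hm₁ ⟨?_, ⟨0, by norm_num, ?_, s2'⟩, fun r g1 g2 => rfl⟩).mono (by norm_num)
      fun _ _ h => h
    · rw [hk₁ _ (by norm_num) (by norm_num) (by norm_num) (by norm_num), h13, s2]
    · simp [x0]
  rintro m₂ hm₂ ⟨y13, ⟨b, hb, y0, hdiv⟩, hk₂⟩
  have y16 : m₂ 16 = 2 ^ M := by
    rw [hk₂ _ (by norm_num) (by norm_num), hk₁ _ (by norm_num) (by norm_num) (by norm_num)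
      (by norm_num), h16]
  have y1 : m₂ 1 = 1 := by
    rw [hk₂ _ (by norm_num) (by norm_num), hk₁ _ (by norm_num) (by norm_num) (by norm_num)
      (by norm_num), h1]
  refine (Ev.andThen (k := 3) (l := 12) (R := fun m₃ => m₃ 20 = 2 * a + b - 2 ^ M + 1 ∧
    ∀ r, r ≠ 20 → m₃ r = m₂ r) (Ev.block hκ1 (hcost _) hm₂ ?_ ⟨?_, fun r hr => ?_⟩) ?_)
  · simp [y0, y16, y1, hreg]
    omega
  · simp [y0, y16, y1]
  · simp [hr]
  rintro m₃ hm₃ ⟨z20, hk₃⟩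
  have hmod := two_mul_add_mod (Q / 2 ^ (e + 1)) (2 ^ M) b (by positivity) hb
  rw [← hdiv, ← ha] at hmod
  refine (Ev.andThen (k := 4) (l := 8) (R := fun m₄ => m₄ 0 = (Q / 2 ^ e % 2 ^ M : ℕ) ∧
    ∀ r, r ≠ 0 → m₄ r = m₃ r)
    (Ev.ite (k := 3) hκ1 (fun hpos => ?_) fun hpos => ?_) ?_)
  · rw [z20] at hpos
    rw [if_pos (by omega)] at hmod
    refine (Ev.block hκ1 (hcost _) hm₃ ?_ ⟨?_, fun r hr => ?_⟩).mono (by simp) fun _ _ h => h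
    · simp [hk₃, y0, y16, hreg]
      omega
    · simp only [blockRun, Instr.target, Instr.value, upd_apply, if_true]
      rw [hk₃ _ (by norm_num), hk₃ _ (by norm_num), y0, y16, hmod]
      omega
    · simp [hr]
  · rw [z20] at hpos
    rw [if_neg (by omega)] at hmod
    refine (Ev.skip hκ1 hm₃ ⟨?_, fun r hr => rfl⟩).mono (by norm_num) fun _ _ h => h
    rw [hk₃ _ (by norm_num), y0, hmod]
    push_cast
    rfl
  rintro m₄ hm₄ ⟨w0, hk₄⟩
  have hold : ∀ r, r ≠ 0 → r ≠ 13 → r ≠ 18 → r ≠ 19 → r ≠ 20 → m₄ r = m r :=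
    fun r g1 g2 g3 g4 g5 => by rw [hk₄ r g1, hk₃ r g5, hk₂ r g1 g2, hk₁ r g1 g3 g4 g5]
  have h15' : m 15 < 2 ^ B := by
    have : ((m 15).natAbs : ℤ) < 2 ^ B := by exact_mod_cast hm.natAbs_lt 15
    omega
  have k15 : m₄ 15 = m 15 := by
    rw [hk₄ _ (by norm_num), hk₃ _ (by norm_num), hk₂ _ (by norm_num) (by norm_num),
      hk₁ _ (by norm_num) (by norm_num) (by norm_num) (by norm_num)]
  have k1 : m₄ 1 = 1 := by rw [hk₄ _ (by norm_num), hk₃ _ (by norm_num), y1]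
  have k18 : m₄ 18 = ((e : ℤ) + 1) * 32 + 4 := by
    rw [hk₄ _ (by norm_num), hk₃ _ (by norm_num), hk₂ _ (by norm_num) (by norm_num), x18]
  have k13 : m₄ 13 = (Q % 2 ^ e : ℕ) := by
    rw [hk₄ _ (by norm_num), hk₃ _ (by norm_num), y13]
  refine (Ev.block hκ1 (hcost _) hm₄ ?_ ⟨?_, ?_, ?_, ?_, fun r g1 g2 g3 g4 g5 g6 => ?_⟩).mono
    (by simp) fun _ _ h => h
  · simp [k15, k1, hreg]
    omega
  · simp [k15, k1]
  · simp [k18]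
  · simp [k13]
  · simp [w0]
  · simp [g3, hold r g1 g2 g4 g5 g6]

end Setting

@[simp] theorem addr_eq_base {x j : ℕ} (h : j < 32) : (addr x j = 32) = (x = 0 ∧ j = 0) := by
  unfold addr; simp; omega

namespace Setting

open RAM

variable {inp : List ℕ} {n M w ℓ τ A B : ℕ} {par dep : ℕ → ℕ} {wg : ℕ → ℕ → ℕ}
  (S : Setting inp n M w ℓ τ A B par dep wg)

include S

theorem exponent_lt : (w + ℓ * M + ℓ * M ^ 2) * M < M ^ 5 := by
  have h1 := S.w_lt
  have h2 := S.ℓ_lt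
  have h3 := S.two_le
  have h4 : w + ℓ * M + ℓ * M ^ 2 < M ^ 3 := by
    obtain ⟨k, rfl⟩ : ∃ k, M = k + 1 := ⟨M - 1, by omega⟩
    have : ℓ * (k + 1) ≤ k * (k + 1) := Nat.mul_le_mul_right _ (by omega)
    have : ℓ * (k + 1) ^ 2 ≤ k * (k + 1) ^ 2 := Nat.mul_le_mul_right _ (by omega)
    nlinarith
  calc _ < M ^ 3 * M := Nat.mul_lt_mul_of_pos_right h4 (by omega)
    _ = M ^ 4 := by ring
    _ ≤ M ^ 5 := Nat.pow_le_pow_right (by omega) (by norm_num)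

/-- The division starts at `2 ^ M ^ 5`, where `Q` is its own remainder and the quotient is 0, and
stops at the exponent `E`. -/
theorem extract_spec {κ : ℕ} (hκ : 1 + B * B ≤ κ) {m : Memory} (hm : Bdd A B m)
    (hf : Fixed n M w ℓ m) {Q : ℕ} (hQ : Q < 2 ^ M ^ 5) (hq : m (addr 0 0) = Q) :
    Ev inp A B κ (.seq (block extractInit) (.loop 15 extractStep)) m (M ^ 5 * 26 + 16) fun m' =>
      m' 0 = (Q / 2 ^ ((w + ℓ * M + ℓ * M ^ 2) * M) % 2 ^ M : ℕ) := by
  have hκ1 : 1 ≤ κ := le_trans (by omega) hκ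
  have hreg : ∀ r < 32, r < A := fun r => S.reg_lt_A
  obtain ⟨b1, b2, b3, b4, b5, b6⟩ := S.bounds
  have hcost : ∀ l : List Instr, ∀ a ∈ l, ∀ m, Bdd A B m → a.cost m ≤ κ :=
    fun l a _ m => Instr.cost_le hκ a m
  have hT := S.exponent_lt
  set E := (w + ℓ * M + ℓ * M ^ 2) * M with hE
  have hL : ((M ^ 5 : ℕ) : ℤ) = M ^ 5 := by push_cast; rfl
  have hEZ : ((((M : ℤ) + 1) * M * ℓ + w) * M) = E := by rw [hE]; push_cast; ring
  have hEZ' : (E : ℤ) < M ^ 5 := by rw [← hL]; exact_mod_cast hT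
  have hQ' : (Q : ℤ) < 2 ^ M ^ 5 := by exact_mod_cast hQ
  have hpB : (2 : ℤ) ^ M ^ 5 < 2 ^ B :=
    pow_lt_pow_right₀ (by norm_num) (by have := S.pow_le; omega)
  have haddr5 : (((M : ℤ) ^ 5 + 1) * 32 + 4).toNat = addr (M ^ 5) 4 := by
    rw [← hL]; unfold addr; omega
  have haddrM : (((M : ℤ) + 1) * 32 + 4).toNat = addr M 4 := by
    unfold addr; omega
  have hMM : M ≤ M ^ 5 := Nat.le_self_pow (by norm_num) M
  have hpM : (2 : ℤ) ^ M < 2 ^ B :=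
    pow_lt_pow_right₀ (by norm_num) (by have := S.pow_le; omega)
  have hpM0 : (0 : ℤ) < 2 ^ M := by positivity
  have hq' : m 32 = Q := hq
  have hw : (w : ℤ) < M := by exact_mod_cast S.w_lt
  have hl : (ℓ : ℤ) < M := by exact_mod_cast S.ℓ_lt
  have c1 : 0 ≤ ((M : ℤ) + 1) * M := by positivity
  have c2 : ((M : ℤ) + 1) * M ≤ 2 * (M * M) := by nlinarith
  have c3 : 0 ≤ ((M : ℤ) + 1) * M * ℓ := by positivity
  have c4 : ((M : ℤ) + 1) * M * ℓ ≤ 2 * (M * M * M) := by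
    calc _ ≤ 2 * ((M : ℤ) * M) * M := mul_le_mul c2 hl.le (by positivity) (by positivity)
      _ = _ := by ring
  refine (Ev.andThen (k := 15) (l := M ^ 5 * 26 + 1) (R := fun m₁ =>
    (∀ r, r < 13 ∨ 32 ≤ r → m₁ r = m r) ∧ m₁ 13 = Q ∧ m₁ 15 = (M : ℤ) ^ 5 - E ∧ m₁ 16 = 2 ^ M ∧
    m₁ 18 = ((M : ℤ) ^ 5 + 1) * 32 + 4) (Ev.block hκ1 (hcost _) hm ?_ ?_) ?_).mono
    (by omega) fun _ _ h => h
  · simp [extractInit, hf.r1, hf.r3, hf.r4, hf.r5, hf.r6, hf.r11, haddrM, hf.pow M hMM, hreg, hEZ, hq']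
    omega
  · refine ⟨frame_blockRun _ (by simp [extractInit]) m, ?_⟩
    simp [extractInit, hf.r1, hf.r3, hf.r4, hf.r5, hf.r6, hf.r11, haddrM, hf.pow M hMM, hEZ, hq']
  rintro m₁ hm₁ ⟨hfr, e13, e15, e16, e18⟩
  have hf₁ := hf.frame hfr
  let I : ℕ → Memory → Prop := fun j m₂ =>
    (∀ r, r ≠ 0 → r < 13 ∨ 32 ≤ r → m₂ r = m₁ r) ∧ m₂ 15 = j ∧ E + j ≤ M ^ 5 ∧
    m₂ 16 = 2 ^ M ∧ m₂ 18 = (((E + j : ℕ) : ℤ) + 1) * 32 + 4 ∧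
    m₂ 13 = (Q % 2 ^ (E + j) : ℕ) ∧ m₂ 0 = (Q / 2 ^ (E + j) % 2 ^ M : ℕ)
  have hloop := Ev.loop (inp := inp) (A := A) (B := B) (κ := κ) (i := 15)
    (p := extractStep) (k := 25) I hκ1 ?_ ?_ (j := M ^ 5 - E) hm₁
    ⟨fun _ _ _ => rfl, ?_, by omega, e16, ?_, ?_, ?_⟩
  · refine hloop.mono ?_ fun m₂ _ h => h.2.2.2.2.2.2
    have : (M ^ 5 - E) * (25 + 1) ≤ M ^ 5 * 26 := Nat.mul_le_mul_right _ (Nat.sub_le _ _)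
    omega
  · rintro m₂ ⟨-, h15, -⟩
    rw [h15]; simp
  · rintro j m₂ hm₂ ⟨hk, h15, hj, h16, h18, h13, h0⟩
    refine ⟨by rw [h15]; positivity, ?_⟩
    refine (S.extractStep_spec hκ hm₂ (Q := Q) (e := E + j) (by omega)
      ((hk 1 (by norm_num) (by norm_num)).trans hf₁.r1)
      ((hk 11 (by norm_num) (by norm_num)).trans hf₁.r11)
      (by rw [h18]; push_cast; ring) ?_ h13 h0 h16 (by rw [h15]; positivity)).mono le_rfl ?_
    · rw [hk _ (by unfold addr; omega) (by unfold addr; omega), hf₁.pow _ (by omega)]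
    · rintro m₃ - ⟨x15, x18, x13, x0, hk'⟩
      refine ⟨fun r hr hr' => ?_, ?_, by omega, ?_, x18, x13, x0⟩
      · rw [hk' r hr (by omega) (by omega) (by omega) (by omega) (by omega), hk r hr hr']
      · rw [x15, h15]; push_cast; ring
      · rw [hk' 16 (by norm_num) (by norm_num) (by norm_num) (by norm_num) (by norm_num)
          (by norm_num), h16]
  · rw [e15, ← hL]; omega
  · rw [e18, ← hL, Nat.add_sub_cancel' hT.le]
  · rw [e13, Nat.add_sub_cancel' hT.le, Nat.mod_eq_of_lt hQ]
  · rw [hf₁.r0, Nat.add_sub_cancel' hT.le, Nat.div_eq_of_lt hQ]; simp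

theorem dfsInit_spec {κ : ℕ} (hκ : 1 + B * B ≤ κ) {m : Memory} (hm : Bdd A B m)
    (h0 : m 0 = 0) (h1 : m 1 = 1) (h2 : m 2 = n) (h3 : m 3 = w) (h4 : m 4 = ℓ) (h5 : m 5 = M)
    (h6 : m 6 = (M : ℤ) ^ 5) (h11 : m 11 = 32) (h12 : m 12 = 2)
    (hpow : ∀ e ≤ M ^ 5, m (addr e 4) = 2 ^ e) (hz : ∀ e, ∀ j < 4, m (addr e j) = 0) :
    Ev inp A B κ (block dfsInit) m 12 fun m' => Fixed n M w ℓ m' ∧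
      Represents n m' DfsState.init := by
  have hκ1 : 1 ≤ κ := le_trans (by omega) hκ
  have hreg : ∀ r < 32, r < A := fun r => S.reg_lt_A
  obtain ⟨b1, b2, b3, b4, b5, b6⟩ := S.bounds
  obtain ⟨p1, p2, p3, p4, p5, p6, p7⟩ := S.bounds_pow
  have hcost : ∀ l : List Instr, ∀ a ∈ l, ∀ m, Bdd A B m → a.cost m ≤ κ :=
    fun l a _ m => Instr.cost_le hκ a m
  have hcube : ((M ^ 3 : ℕ) : ℤ) = M * M * M := by push_cast; ring
  have haddr : (((M : ℤ) * M * M + 1) * 32 + 4).toNat = addr (M ^ 3) 4 := by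
    rw [← hcube]; unfold addr; omega
  have hM3 : M ^ 3 ≤ M ^ 5 := Nat.pow_le_pow_right (by have := S.two_le; omega) (by norm_num)
  have hp3 := hpow _ hM3
  have hA0 : 32 < A := S.lt_A' (x := 0) (j := 0) (Nat.zero_le n) (by norm_num)
  refine Ev.block hκ1 (hcost _) hm ?_ ⟨?_, ?_⟩
  · simp [dfsInit, h1, h5, h11, haddr, hp3, hreg, hA0]
    omega
  · constructor
    case pow => intro e he; simp [dfsInit, h1, h5, h11, haddr, hp3, hpow e he]
    all_goals simp [dfsInit, h0, h1, h2, h3, h4, h5, h6, h11, h12, haddr, hp3]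
  · refine ⟨?_, ?_, ?_, fun x hx => ?_, fun x hx => ?_, fun x hx => ?_, fun x hx => ?_⟩
    all_goals simp [dfsInit, h1, h5, h11, haddr, hp3, DfsState.init, Function.update_apply, hz]

theorem solve_spec {κ : ℕ} (hκ : 1 + B * B ≤ κ) {m : Memory} (hm : Bdd A B m)
    (hp : Prepared n M w ℓ m) {Q : ℕ} (hQ : Q < 2 ^ M ^ 5)
    (hval : sumOver (belowList n par τ 0)
      (fun c => ((belowList n par τ 0).map (localWeight par dep wg M · c)).prod)
      (fun _ => (false, false)) = Q) :
    Ev inp A B κ solveProgram m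
      ((n + 3) * (n + 1) * 4 ^ τ * (28 * n + 61) + 32 * M ^ 5 + 108) fun m' =>
      m' 0 = (Q / 2 ^ ((w + ℓ * M + ℓ * M ^ 2) * M) % 2 ^ M : ℕ) := by
  have hF : ∀ a ≤ n, ∀ c c' : ℕ → Bool × Bool, (∀ j, c (par^[j] a) = c' (par^[j] a)) →
      localWeight par dep wg M a c = localWeight par dep wg M a c' :=
    fun a _ c c' h => localWeight_congr par dep wg M a c c' h
  have hβ : 1 ≤ M * (2 ^ M ^ 3) ^ 2 := Nat.mul_pos (by have := S.two_le; omega) (by positivity)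
  have hW : (4 * ((M * (2 ^ M ^ 3) ^ 2 : ℕ) : ℤ)) ^ (n + 1) < 2 ^ B := by
    have h := S.big
    have : 1 ≤ (4 * (M * (2 ^ M ^ 3) ^ 2)) ^ (n + 1) := Nat.one_le_pow _ _ (by omega)
    have h' : (4 * (M * (2 ^ M ^ 3) ^ 2)) ^ (n + 1) < 2 ^ B := by omega
    exact_mod_cast h'
  obtain ⟨σ, T, hreach, hT, hcur, hcand, hprod⟩ := S.tree.reach_final hF
    (fun a ha c => S.localWeight_abs_le ha c) hβ le_rfl
  rw [S.tree.childProd_eq_sumOver hF, hval] at hprod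
  refine Ev.mono (k := (6 * M ^ 5 + 20) + (12 + ((T * (28 * n + 61) + 60) + (M ^ 5 * 26 + 16)))) ?_
    (by have := Nat.mul_le_mul_right (28 * n + 61) hT; omega) fun _ _ h => h
  refine Ev.andThen (S.powers_spec hκ hm hp) ?_
  rintro m₁ hm₁ ⟨hk, h6, hpow, hz⟩
  refine Ev.andThen (S.dfsInit_spec hκ hm₁ ((hk 0 (by norm_num) (by norm_num)).trans hp.r0)
    ((hk 1 (by norm_num) (by norm_num)).trans hp.r1)
    ((hk 2 (by norm_num) (by norm_num)).trans hp.r2)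
    ((hk 3 (by norm_num) (by norm_num)).trans hp.r3)
    ((hk 4 (by norm_num) (by norm_num)).trans hp.r4)
    ((hk 5 (by norm_num) (by norm_num)).trans hp.r5) h6
    ((hk 11 (by norm_num) (by norm_num)).trans hp.r11)
    ((hk 12 (by norm_num) (by norm_num)).trans hp.r12) hpow hz) ?_
  rintro m₂ hm₂ ⟨hf₂, hr₂⟩
  refine Ev.andThen (S.dfsLoop_spec hκ hW hreach hcur (by omega) hm₂ hf₂ hr₂) ?_
  rintro m₃ hm₃ ⟨hf₃, hq⟩
  exact S.extract_spec hκ hm₃ hf₃ hQ (hq.trans hprod)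

end Setting

/-! ### Computing `M` from the input, and the complete algorithm. -/

namespace RAM

/-- Preparation of the sum of all weights. -/
def prepareInit : List Instr :=
  [.const 1 1, .const 11 32, .const 12 2, .input 2 0, .mul 13 2 2, .const 14 3, .add 14 14 2]

/-- Adding one weight. -/
def sumStep : List Instr :=
  [.input 16 14, .add 15 15 16, .add 14 14 1, .sub 13 13 1]

/-- Computing the bound `M`. -/
def boundBlock : List Instr :=
  [.add 16 2 1, .mul 16 16 16, .add 16 16 16, .add 15 15 1, .mul 5 16 15]

/-- The computation of the bound `M`. -/
def prepareProgram : Program :=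
  .seq (block prepareInit) (.seq (.loop 13 (block sumStep)) (block boundBlock))

/-- The algorithm. -/
def countingProgram : Program :=
  .seq prepareProgram
    -- The test is `w < M`, and then `ℓ < M` with register 12 as the input index 2. If one fails,
    -- register 0 still contains 0, the correct answer.
    (.seq (block [.input 3 1, .sub 16 5 3])
      (.ite 16 (.seq (block [.input 4 12, .sub 16 5 4]) (.ite 16 solveProgram .skip)) .skip))

/-- The state of the memory after the computation of `M`. -/
structure Counted (n M : ℕ) (m : Memory) : Prop where
  r0 : m 0 = 0
  r1 : m 1 = 1
  r2 : m 2 = n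
  r5 : m 5 = M
  r11 : m 11 = 32
  r12 : m 12 = 2
  rest : ∀ a, 32 ≤ a → m a = 0

/-- The parameter `M` is computed from the matrix entries themselves and not from a bound on the
weights. Therefore one program serves all polynomial bounds on `N`. -/
theorem prepare_spec {inp : List ℕ} {A B κ n M s : ℕ} (hκ : 1 + B * B ≤ κ) (hA : 32 ≤ A)
    (hn : inp.getD 0 0 = n)
    (hs : ∑ i ∈ Finset.range (n * n), inp.getD (n + 3 + i) 0 = s)
    (hM : M = 2 * (n + 1) ^ 2 * (s + 1)) (hB : 1000 * M ≤ 2 ^ B) :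
    Ev inp A B κ prepareProgram 0 (6 * (n * n) + 20) (Counted n M) := by
  have hκ1 : 1 ≤ κ := le_trans (by omega) hκ
  have hn' := hn
  simp only [List.getD_eq_getElem?_getD] at hn'
  have hreg : ∀ r < 32, r < A := fun r hr => by omega
  have hcost : ∀ l : List Instr, ∀ a ∈ l, ∀ m, Bdd A B m → a.cost m ≤ κ :=
    fun l a _ m => Instr.cost_le hκ a m
  have hB' : 1000 * (M : ℤ) ≤ 2 ^ B := by exact_mod_cast hB
  have hM1 : 2 * ((n : ℤ) * n + 2 * n + 1) ≤ M := by
    have : 2 * (n * n + 2 * n + 1) ≤ M := by rw [hM]; nlinarith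
    exact_mod_cast this
  have hM2 : (s : ℤ) + 1 ≤ M := by
    have : s + 1 ≤ M := by
      rw [hM]
      exact Nat.le_mul_of_pos_left _ (by positivity)
    exact_mod_cast this
  have hnn : 0 ≤ (n : ℤ) * n := by positivity
  refine (Ev.andThen (k := 8) (l := ((n * n) * 6 + 1) + 6) (R := fun m₁ => m₁ 0 = 0 ∧ m₁ 1 = 1 ∧
    m₁ 2 = n ∧ m₁ 11 = 32 ∧ m₁ 12 = 2 ∧ m₁ 13 = (n * n : ℕ) ∧ m₁ 14 = (n + 3 : ℕ) ∧ m₁ 15 = 0 ∧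
    ∀ a, 32 ≤ a → m₁ a = 0) (Ev.block hκ1 (hcost _) (Bdd.zero A B) ?_ ?_) ?_).mono (by omega)
    fun _ _ h => h
  · simp [prepareInit, hreg, hn']
    omega
  · refine ⟨?_, ?_, ?_, ?_, ?_, ?_, ?_, ?_, fun a ha => ?_⟩
    all_goals simp [prepareInit, hn']
    · ring
    · rw [Finsupp.single_eq_of_ne (by omega)]
      simp (discharger := omega) only [if_neg]
  rintro m₁ hm₁ ⟨h0, h1, h2, h11, h12, h13, h14, h15, hz⟩
  refine Ev.andThen (k := (n * n) * 6 + 1) (l := 6) (R := fun m₂ => m₂ 0 = 0 ∧ m₂ 1 = 1 ∧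
    m₂ 2 = n ∧ m₂ 11 = 32 ∧ m₂ 12 = 2 ∧ m₂ 15 = s ∧ ∀ a, 32 ≤ a → m₂ a = 0) ?_ ?_
  · let I : ℕ → Memory → Prop := fun j m₂ => m₂ 0 = 0 ∧ m₂ 1 = 1 ∧
      m₂ 2 = n ∧ m₂ 11 = 32 ∧ m₂ 12 = 2 ∧ (∀ a, 32 ≤ a → m₂ a = 0) ∧ m₂ 13 = j ∧
      ∃ i, i + j = n * n ∧ m₂ 14 = (n + 3 + i : ℕ) ∧
        m₂ 15 = (∑ k ∈ Finset.range i, inp.getD (n + 3 + k) 0 : ℕ)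
    have hloop := Ev.loop (inp := inp) (A := A) (B := B) (κ := κ) (i := 13)
      (p := block sumStep) (k := 5) I hκ1 ?_ ?_ (j := n * n) hm₁
      ⟨h0, h1, h2, h11, h12, hz, h13, 0, by omega, h14, by simpa using h15⟩
    · refine hloop.mono le_rfl ?_
      rintro m₂ - ⟨g0, g1, g2, g11, g12, gz, -, i, hi, -, g15⟩
      rw [show i = n * n by omega, hs] at g15
      exact ⟨g0, g1, g2, g11, g12, g15, gz⟩
    · rintro m₂ ⟨-, -, -, -, -, -, g, -⟩
      rw [g]; simp
    · rintro j m₂ hm₂ ⟨g0, g1, g2, g11, g12, gz, g13, i, hi, g14, g15⟩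
      refine ⟨by rw [g13]; positivity, ?_⟩
      have hle : ∑ k ∈ Finset.range (i + 1), inp.getD (n + 3 + k) 0 ≤ s := by
        rw [← hs]
        exact Finset.sum_le_sum_of_subset (Finset.range_mono (by omega))
      rw [Finset.sum_range_succ] at hle
      set t₀ := ∑ k ∈ Finset.range i, inp.getD (n + 3 + k) 0 with ht₀
      have hv : ((t₀ : ℕ) : ℤ) + (inp.getD (n + 3 + i) 0 : ℕ) ≤ s := by exact_mod_cast hle
      have hi' : (i : ℤ) + j + 1 = n * n := by exact_mod_cast (by omega : i + j + 1 = n * n)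
      refine Ev.block hκ1 (hcost _) hm₂ ?_ ?_
      · simp only [sumStep, blockOk, Instr.target, Instr.value, upd_apply, g14, Int.toNat_natCast]
        generalize inp.getD (n + 3 + i) 0 = v at *
        simp [g13, g15, g1, hreg]
        omega
      · have hrun : ∀ r, blockRun inp sumStep m₂ r = if r = 13 then (j : ℤ) else if r = 14 then
            ((n + 3 + (i + 1) : ℕ) : ℤ) else if r = 15 then
            ((t₀ + inp.getD (n + 3 + i) 0 : ℕ) : ℤ) else if r = 16 then
            ((inp.getD (n + 3 + i) 0 : ℕ) : ℤ) else m₂ r := fun r => by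
          simp only [sumStep, blockRun, Instr.target, Instr.value, upd_apply, g14, Int.toNat_natCast]
          generalize inp.getD (n + 3 + i) 0 = v at *
          simp [g13, g15, g1]
          split_ifs <;> ring
        refine ⟨?_, ?_, ?_, ?_, ?_, fun a ha => ?_, ?_, i + 1, by omega, ?_, ?_⟩
        · rw [hrun]; simpa using g0
        · rw [hrun]; simpa using g1
        · rw [hrun]; simpa using g2
        · rw [hrun]; simpa using g11
        · rw [hrun]; simpa using g12
        · rw [hrun, if_neg (by omega), if_neg (by omega), if_neg (by omega), if_neg (by omega)]
          exact gz a ha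
        · rw [hrun]; simp
        · rw [hrun]; simp
        · rw [hrun, Finset.sum_range_succ]; simp [ht₀]
  · rintro m₂ hm₂ ⟨g0, g1, g2, g11, g12, g15, gz⟩
    have hM3 : (((n : ℤ) + 1) * (n + 1) + (n + 1) * (n + 1)) * (s + 1) = M := by
      rw [hM]; push_cast; ring
    have hexp : ((n : ℤ) + 1) * (n + 1) = n * n + 2 * n + 1 := by ring
    refine Ev.block hκ1 (hcost _) hm₂ ?_ ?_
    · simp [boundBlock, g1, g2, g15, hreg, hM3]
      omega
    · constructor
      case rest =>
        intro a ha
        have h : a ≠ 5 ∧ a ≠ 15 ∧ a ≠ 16 := by omega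
        simp [boundBlock, h, gz a ha]
      all_goals simp [boundBlock, g0, g1, g2, g11, g12, g15, hM3]

end RAM

/-! ### Specification of the complete algorithm. -/

namespace Setting

open RAM

/-- The result of the algorithm if `w` or `ℓ` is too large. -/
theorem _root_.RAM.countingProgram_zero {inp : List ℕ} {A B κ n M s w ℓ : ℕ}
    (hκ : 1 + B * B ≤ κ) (hA : 32 ≤ A)
    (hn : inp.getD 0 0 = n) (hw : inp.getD 1 0 = w) (hℓ : inp.getD 2 0 = ℓ)
    (hs : ∑ i ∈ Finset.range (n * n), inp.getD (n + 3 + i) 0 = s)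
    (hM : M = 2 * (n + 1) ^ 2 * (s + 1)) (hB : 1000 * M ≤ 2 ^ B) (hlt : ¬ (w < M ∧ ℓ < M)) :
    Ev inp A (B + w.size + ℓ.size) κ countingProgram 0 (6 * (n * n) + 60) fun m' => m' 0 = 0 := by
  have hκ1 : 1 ≤ κ := le_trans (by omega) hκ
  have hreg : ∀ r < 32, r < A := fun r hr => by omega
  have hw₀ := hw
  have hℓ₀ := hℓ
  simp only [List.getD_eq_getElem?_getD] at hw₀ hℓ₀
  set B' := B + w.size + ℓ.size with hB'def
  have hM1 : 1 ≤ M := by rw [hM]; exact Nat.succ_le_of_lt (by positivity)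
  have hBB : (2 : ℕ) ^ B ≤ 2 ^ B' := Nat.pow_le_pow_right (by norm_num) (by omega)
  have hB1 : 1000 * (M : ℤ) ≤ 2 ^ B' := by exact_mod_cast hB.trans hBB
  have hw' : (w : ℤ) < 2 ^ B' := by
    have h := (Nat.lt_size_self w).trans_le
      (Nat.pow_le_pow_right (by norm_num) (show w.size ≤ B' by omega))
    exact_mod_cast h
  have hℓ' : (ℓ : ℤ) < 2 ^ B' := by
    have h := (Nat.lt_size_self ℓ).trans_le
      (Nat.pow_le_pow_right (by norm_num) (show ℓ.size ≤ B' by omega))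
    exact_mod_cast h
  refine (Ev.andThen (l := 30) ((prepare_spec hκ hA hn hs hM hB).mono_bound (show B ≤ B' by omega)
    le_rfl) fun m₁ hm₁ hc => ?_).mono (by omega) fun _ _ h => h
  refine (Ev.andThen (k := 3) (l := 20) (R := fun m₂ => m₂ 0 = 0 ∧ m₂ 12 = 2 ∧ m₂ 5 = M ∧
    m₂ 16 = (M : ℤ) - w)
    -- From here on `w` and `ℓ` may be huge, but only instructions of cost 1 are executed, so they
    -- enter the space bound and not `κ`.
    (Ev.block hκ1 (by simp [Instr.cost]; omega) hm₁ ?_ ?_) ?_).mono (by omega) fun _ _ h => h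
  · simp only [blockOk, Instr.target, Instr.value, upd_apply, hc.r1, hc.r5, Int.toNat_one]
    simp [hreg, hw₀]
    omega
  · simp only [blockRun, Instr.target, Instr.value, upd_apply, hc.r1, hc.r5, Int.toNat_one]
    simp [hc.r0, hc.r12, hw₀]
  rintro m₂ hm₂ ⟨g0, g12, g5, g16⟩
  refine (Ev.ite (k := 19) hκ1 (fun hpos => ?_) fun _ => ?_).mono (by omega) fun _ _ h => h
  · rw [g16] at hpos
    refine (Ev.andThen (k := 3) (l := 2) (R := fun m₃ => m₃ 0 = 0 ∧ m₃ 16 = (M : ℤ) - ℓ)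
      (Ev.block hκ1 (by simp [Instr.cost]; omega) hm₂ ?_ ?_) ?_).mono (by omega) fun _ _ h => h
    · simp only [blockOk, Instr.target, Instr.value, upd_apply, g12]
      simp [hreg, g5, hℓ₀]
      omega
    · simp only [blockRun, Instr.target, Instr.value, upd_apply, g12]
      simp [g0, g5, hℓ₀]
    rintro m₃ hm₃ ⟨i0, i16⟩
    refine Ev.ite (k := 1) hκ1 (fun hpos' => ?_) fun _ => Ev.skip hκ1 hm₃ i0
    rw [i16] at hpos'
    exact absurd ⟨by omega, by omega⟩ hlt
  · exact (Ev.skip hκ1 hm₂ g0).mono (by norm_num) fun _ _ h => h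

theorem countingProgram_spec {inp : List ℕ} {n M w ℓ τ A B s : ℕ} {par dep : ℕ → ℕ}
    {wg : ℕ → ℕ → ℕ} (S : Setting inp n M w ℓ τ A B par dep wg) {κ : ℕ} (hκ : 1 + B * B ≤ κ)
    (hn : inp.getD 0 0 = n) (hw : inp.getD 1 0 = w) (hℓ : inp.getD 2 0 = ℓ)
    (hs : ∑ i ∈ Finset.range (n * n), inp.getD (n + 3 + i) 0 = s)
    (hM : M = 2 * (n + 1) ^ 2 * (s + 1)) {Q : ℕ} (hQ : Q < 2 ^ M ^ 5)
    (hval : sumOver (belowList n par τ 0)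
      (fun c => ((belowList n par τ 0).map (localWeight par dep wg M · c)).prod)
      (fun _ => (false, false)) = Q) :
    Ev inp A B κ countingProgram 0
      (6 * (n * n) + 28 + ((n + 3) * (n + 1) * 4 ^ τ * (28 * n + 61) + 32 * M ^ 5 + 108)) fun m' =>
      m' 0 = (Q / 2 ^ ((w + ℓ * M + ℓ * M ^ 2) * M) % 2 ^ M : ℕ) := by
  have hκ1 : 1 ≤ κ := le_trans (by omega) hκ
  have hreg : ∀ r < 32, r < A := fun r => S.reg_lt_A
  have hw₀ := hw
  have hℓ₀ := hℓ
  simp only [List.getD_eq_getElem?_getD] at hw₀ hℓ₀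
  have hA : 32 ≤ A := S.reg_lt_A (r := 31) (by norm_num)
  have hB : 1000 * M ≤ 2 ^ B := by
    have := S.small
    have := Nat.le_self_pow (n := 7) (by norm_num) M
    omega
  have hB1 : 1000 * (M : ℤ) ≤ 2 ^ B := by exact_mod_cast hB
  have hw' : (w : ℤ) < M := by exact_mod_cast S.w_lt
  have hℓ' : (ℓ : ℤ) < M := by exact_mod_cast S.ℓ_lt
  refine (Ev.andThen (l := 8 + ((n + 3) * (n + 1) * 4 ^ τ * (28 * n + 61) + 32 * M ^ 5 + 108))
    (prepare_spec hκ hA hn hs hM hB) fun m₁ hm₁ hc => ?_).mono (by omega) fun _ _ h => h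
  refine (Ev.andThen (k := 3) (R := fun m₂ => m₂ 16 = (M : ℤ) - w ∧ m₂ 3 = w ∧
    ∀ r, r ≠ 3 → r ≠ 16 → m₂ r = m₁ r)
    (l := 1 + (3 + (1 + ((n + 3) * (n + 1) * 4 ^ τ * (28 * n + 61) + 32 * M ^ 5 + 108))))
    (Ev.block hκ1 (by simp [Instr.cost]; omega) hm₁ ?_ ?_) ?_).mono (by omega) fun _ _ h => h
  · simp only [blockOk, Instr.target, Instr.value, upd_apply, hc.r1, hc.r5, Int.toNat_one]
    simp [hreg, hw₀]
    omega
  · simp only [blockRun, Instr.target, Instr.value, upd_apply, hc.r1, hc.r5, Int.toNat_one]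
    simp +contextual [hw₀]
  rintro m₂ hm₂ ⟨g16, g3, hk₂⟩
  refine Ev.ite hκ1 (fun _ => ?_) fun hpos => absurd (by rw [g16]; omega) hpos
  refine (Ev.andThen (k := 3) (R := fun m₃ => m₃ 16 = (M : ℤ) - ℓ ∧ m₃ 3 = w ∧ m₃ 4 = ℓ ∧
    ∀ r, r ≠ 3 → r ≠ 4 → r ≠ 16 → m₃ r = m₁ r) (Ev.block hκ1 (by simp [Instr.cost]; omega) hm₂ ?_ ?_) ?_)
  · simp only [blockOk, Instr.target, Instr.value, upd_apply, hk₂ 12 (by norm_num) (by norm_num),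
      hc.r12]
    simp [hreg, hk₂, hc.r5, hℓ₀]
    omega
  · simp only [blockRun, Instr.target, Instr.value, upd_apply, hk₂ 12 (by norm_num) (by norm_num),
      hc.r12]
    simp +contextual [g3, hk₂, hc.r5, hℓ₀]
  rintro m₃ hm₃ ⟨i16, i3, i4, hk₃⟩
  refine Ev.ite hκ1 (fun _ => ?_) fun hpos => absurd (by rw [i16]; omega) hpos
  exact S.solve_spec hκ hm₃ ⟨by rw [hk₃, hc.r0] <;> norm_num, by rw [hk₃, hc.r1] <;> norm_num,
    by rw [hk₃, hc.r2] <;> norm_num, i3, i4, by rw [hk₃, hc.r5] <;> norm_num,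
    by rw [hk₃, hc.r11] <;> norm_num, by rw [hk₃, hc.r12] <;> norm_num,
    fun a ha => by rw [hk₃ a (by omega) (by omega) (by omega), hc.rest a ha]⟩ hQ hval

end Setting

/-! ### Digits of sums of powers -/

/-- If less than `2 ^ M` powers of `2 ^ M` are summed, then the digits of the sum to the base
`2 ^ M` count the exponents. -/
theorem sum_pow_digit {ι : Type*} (O : Finset ι) (f : ι → ℕ) (M t : ℕ) (hO : O.card < 2 ^ M) :
    (∑ o ∈ O, 2 ^ (M * f o)) / 2 ^ (t * M) % 2 ^ M = (O.filter fun o => f o = t).card := by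
  have hsplit : ∑ o ∈ O, 2 ^ (M * f o) = ∑ o ∈ O.filter (fun o => f o < t), 2 ^ (M * f o) +
      (∑ o ∈ O.filter (fun o => f o = t), 2 ^ (M * f o) +
        ∑ o ∈ O.filter (fun o => t < f o), 2 ^ (M * f o)) := by
    rw [← Finset.sum_filter_add_sum_filter_not O (fun o => f o < t)]
    congr 1
    rw [← Finset.sum_filter_add_sum_filter_not (O.filter fun o => ¬ f o < t) (fun o => f o = t)]
    simp only [Finset.filter_filter]
    congr 1
    · refine Finset.sum_congr (Finset.filter_congr fun o _ => ?_) fun _ _ => rfl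
      omega
    · refine Finset.sum_congr (Finset.filter_congr fun o _ => ?_) fun _ _ => rfl
      omega
  -- Fewer than `2 ^ M` terms, each at most `2 ^ ((t - 1) * M)`, produce no carry into digit `t`.
  -- The inequality is multiplied by `2 ^ M` to avoid the exponent `t - 1`.
  have hlow : ∑ o ∈ O.filter (fun o => f o < t), 2 ^ (M * f o) < 2 ^ (t * M) := by
    have h1 : (∑ o ∈ O.filter (fun o => f o < t), 2 ^ (M * f o)) * 2 ^ M ≤
        O.card * 2 ^ (t * M) := by
      rw [Finset.sum_mul]
      calc _ ≤ ∑ o ∈ O.filter (fun o => f o < t), 2 ^ (t * M) := by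
            refine Finset.sum_le_sum fun o ho => ?_
            rw [← pow_add]
            refine Nat.pow_le_pow_right (by norm_num) ?_
            have : f o + 1 ≤ t := (Finset.mem_filter.1 ho).2
            calc M * f o + M = (f o + 1) * M := by ring
              _ ≤ t * M := Nat.mul_le_mul_right _ this
        _ ≤ O.card * 2 ^ (t * M) := by
            rw [Finset.sum_const, smul_eq_mul]
            exact Nat.mul_le_mul_right _ (Finset.card_filter_le _ _)
    have h2 : O.card * 2 ^ (t * M) < 2 ^ (t * M) * 2 ^ M := by
      rw [mul_comm]
      exact Nat.mul_lt_mul_of_pos_left hO (by positivity)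
    exact Nat.lt_of_mul_lt_mul_right (h1.trans_lt h2)
  have hmid : ∑ o ∈ O.filter (fun o => f o = t), 2 ^ (M * f o) =
      (O.filter fun o => f o = t).card * 2 ^ (t * M) := by
    rw [Finset.sum_congr rfl fun o ho => by rw [(Finset.mem_filter.1 ho).2, mul_comm M t],
      Finset.sum_const, smul_eq_mul]
  -- Larger exponents affect only higher digits.
  obtain ⟨H, hH⟩ : 2 ^ (t * M) * 2 ^ M ∣ ∑ o ∈ O.filter (fun o => t < f o), 2 ^ (M * f o) := by
    refine Finset.dvd_sum fun o ho => ?_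
    rw [← pow_add]
    refine pow_dvd_pow _ ?_
    have : t + 1 ≤ f o := (Finset.mem_filter.1 ho).2
    calc t * M + M = (t + 1) * M := by ring
      _ ≤ f o * M := Nat.mul_le_mul_right _ this
      _ = M * f o := mul_comm _ _
  rw [hsplit, hmid, hH, show (O.filter fun o => f o = t).card * 2 ^ (t * M) +
    2 ^ (t * M) * 2 ^ M * H = 2 ^ (t * M) * ((O.filter fun o => f o = t).card + 2 ^ M * H) by ring,
    Nat.add_mul_div_left _ _ (by positivity), Nat.div_eq_of_lt hlow, zero_add,
    Nat.add_mul_mod_self_left]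
  exact Nat.mod_eq_of_lt ((Finset.card_filter_le _ _).trans_lt hO)

/-! ### Matchings as schemes -/

section Scheme

variable {V : Type*} [Fintype V] [DecidableEq V]

/-- A scheme for the orientation `D`: a vertex `v` is not covered (`none`), or picked by another
vertex (`some none`), or it picks a vertex `u` with `D v u` (`some (some u)`). -/
structure IsScheme (D : V → V → Prop) (φ : V → Option (Option V)) : Prop where
  up : ∀ v u, φ v = some (some u) → D v u
  picked : ∀ u, φ u = some none ↔ ∃ v, φ v = some (some u)

/-- The vertices that pick a vertex. -/
def pickers (φ : V → Option (Option V)) : Finset V := Finset.univ.filter fun v => (φ v).join.isSome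

/-- The vertices that are marked as picked. -/
def downs (φ : V → Option (Option V)) : Finset V := Finset.univ.filter fun v => φ v = some none

/-- The vertex that is picked by `v`. -/
def pick (φ : V → Option (Option V)) (v : V) : V := (φ v).join.getD v

/-- The edges of a scheme. -/
def schemeEdges (φ : V → Option (Option V)) : Finset (Sym2 V) :=
  (pickers φ).image fun v => s(v, pick φ v)

variable {D : V → V → Prop} {φ : V → Option (Option V)}

theorem mem_pickers {v : V} : v ∈ pickers φ ↔ ∃ u, φ v = some (some u) := by
  simp [pickers, Option.isSome_iff_exists, Option.join_eq_some_iff]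

theorem pick_eq {v u : V} (h : φ v = some (some u)) : pick φ v = u := by
  simp [pick, h]

theorem mem_downs {v : V} : v ∈ downs φ ↔ φ v = some none := by
  simp [downs]

theorem mem_schemeEdges {e : Sym2 V} :
    e ∈ schemeEdges φ ↔ ∃ v u, φ v = some (some u) ∧ e = s(v, u) := by
  simp only [schemeEdges, Finset.mem_image, mem_pickers]
  constructor
  · rintro ⟨v, ⟨u, h⟩, rfl⟩
    exact ⟨v, u, h, by rw [pick_eq h]⟩
  · rintro ⟨v, u, h, rfl⟩
    exact ⟨v, ⟨u, h⟩, by rw [pick_eq h]⟩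

namespace IsScheme

/-- As the orientation is antisymmetric, an edge determines which of its ends is the picker. -/
theorem mk_mem_schemeEdges (hφ : IsScheme D φ) (hD : ∀ v u, D v u → ¬ D u v) {v u : V}
    (h : D v u) : s(v, u) ∈ schemeEdges φ ↔ φ v = some (some u) := by
  rw [mem_schemeEdges]
  constructor
  · rintro ⟨v', u', h', he⟩
    rcases Sym2.eq_iff.1 he with ⟨rfl, rfl⟩ | ⟨rfl, rfl⟩
    · exact h'
    · exact absurd (hφ.up _ _ h') (hD _ _ h)
  · exact fun h' => ⟨v, u, h', rfl⟩

/-- If two pickers picked each other, each would have to be marked as picked and could not be a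
picker. -/
theorem injOn_edge (hφ : IsScheme D φ) :
    Set.InjOn (fun v => s(v, pick φ v)) (pickers φ : Set V) := by
  intro v hv v' hv' he
  obtain ⟨u, hu⟩ := mem_pickers.1 hv
  obtain ⟨u', hu'⟩ := mem_pickers.1 hv'
  simp only [pick_eq hu, pick_eq hu'] at he
  rcases Sym2.eq_iff.1 he with ⟨h, -⟩ | ⟨h, -⟩
  · exact h
  · have := (hφ.picked v).2 ⟨v', by rw [hu', h]⟩
    rw [hu] at this
    simp at this

theorem card_schemeEdges (hφ : IsScheme D φ) : (schemeEdges φ).card = (pickers φ).card :=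
  Finset.card_image_of_injOn hφ.injOn_edge

theorem sum_schemeEdges (hφ : IsScheme D φ) (wt : Sym2 V → ℕ) :
    ∑ e ∈ schemeEdges φ, wt e = ∑ v ∈ pickers φ, wt s(v, pick φ v) :=
  Finset.sum_image hφ.injOn_edge

theorem surjOn_pick (hφ : IsScheme D φ) :
    Set.SurjOn (pick φ) (pickers φ : Set V) (downs φ : Set V) := by
  intro u hu
  obtain ⟨v, hv⟩ := (hφ.picked u).1 (mem_downs.1 hu)
  exact ⟨v, mem_pickers.2 ⟨u, hv⟩, pick_eq hv⟩

theorem card_downs_le (hφ : IsScheme D φ) : (downs φ).card ≤ (pickers φ).card :=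
  Finset.card_le_card_of_surjOn _ hφ.surjOn_pick

/-- Picking maps the pickers onto the marked vertices; a surjection onto a set that is at least as
large is injective. Thus mere counting excludes multiple picks. -/
theorem pick_injective (hφ : IsScheme D φ) (h : (pickers φ).card ≤ (downs φ).card) {v v' u : V}
    (hv : φ v = some (some u)) (hv' : φ v' = some (some u)) : v = v' := by
  refine Finset.inj_on_of_surj_on_of_card_le (s := pickers φ) (t := downs φ)
    (fun v _ => pick φ v) (fun v hv => ?_) (fun u hu => ?_) h (mem_pickers.2 ⟨u, hv⟩)
    (mem_pickers.2 ⟨u, hv'⟩) (by simp only [pick_eq hv, pick_eq hv'])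
  · obtain ⟨u, hu⟩ := mem_pickers.1 hv
    rw [pick_eq hu]
    exact mem_downs.2 ((hφ.picked u).2 ⟨v, hu⟩)
  · obtain ⟨v, hv, h⟩ := hφ.surjOn_pick hu
    exact ⟨v, hv, h⟩

/-- Hence a common set of uncovered vertices is the same as `V(M₁) = V(M₂)`. -/
theorem covered (hφ : IsScheme D φ) :
    coveredVertices (schemeEdges φ) = {v | φ v ≠ none} := by
  ext x
  simp only [coveredVertices, Set.mem_ofPred_eq, mem_schemeEdges]
  constructor
  · rintro ⟨e, ⟨v, u, h, rfl⟩, hx⟩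
    rcases Sym2.mem_iff.1 hx with rfl | rfl
    · simp [h]
    · simp [(hφ.picked _).2 ⟨v, h⟩]
  · intro hx
    obtain ⟨y, hy⟩ := Option.ne_none_iff_exists'.1 hx
    cases y with
    | none =>
      obtain ⟨v, hv⟩ := (hφ.picked x).1 hy
      exact ⟨_, ⟨v, x, hv, rfl⟩, by simp⟩
    | some u => exact ⟨_, ⟨x, u, hy, rfl⟩, by simp⟩

theorem isEdgeMatching {G : SimpleGraph V} (hG : ∀ v u, D v u → G.Adj v u)
    (hφ : IsScheme D φ) (h : (pickers φ).card ≤ (downs φ).card) :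
    IsEdgeMatching G (schemeEdges φ) := by
  constructor
  · intro e he
    obtain ⟨v, u, h', rfl⟩ := mem_schemeEdges.1 he
    exact hG _ _ (hφ.up _ _ h')
  · intro e he f hf hne x hxe hxf
    obtain ⟨v, u, h₁, rfl⟩ := mem_schemeEdges.1 he
    obtain ⟨v', u', h₂, rfl⟩ := mem_schemeEdges.1 hf
    refine hne ?_
    -- A shared vertex picks in both edges, or is picked in both, or would be picker and marked at
    -- once.
    rcases Sym2.mem_iff.1 hxe with rfl | rfl <;> rcases Sym2.mem_iff.1 hxf with rfl | rfl
    · rw [h₁] at h₂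
      simp only [Option.some.injEq] at h₂
      rw [h₂]
    · have := (hφ.picked _).2 ⟨_, h₂⟩
      simp [h₁] at this
    · have := (hφ.picked _).2 ⟨_, h₁⟩
      simp [h₂] at this
    · rw [hφ.pick_injective h h₁ h₂]

/-- The edges determine all picks through the orientation, and the picks determine all marks. -/
theorem ext_of_edges (hD : ∀ v u, D v u → ¬ D u v) {ψ : V → Option (Option V)}
    (hφ : IsScheme D φ) (hψ : IsScheme D ψ) (h : schemeEdges φ = schemeEdges ψ) : φ = ψ := by
  have h1 : ∀ v u, φ v = some (some u) ↔ ψ v = some (some u) := fun v u => by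
    constructor
    · intro hv
      rw [← hψ.mk_mem_schemeEdges hD (hφ.up _ _ hv), ← h]
      exact mem_schemeEdges.2 ⟨v, u, hv, rfl⟩
    · intro hv
      rw [← hφ.mk_mem_schemeEdges hD (hψ.up _ _ hv), h]
      exact mem_schemeEdges.2 ⟨v, u, hv, rfl⟩
  have h2 : ∀ u, φ u = some none ↔ ψ u = some none := fun u => by
    rw [hφ.picked, hψ.picked]
    simp only [h1]
  funext v
  rcases hv : φ v with _ | _ | u
  · rcases hv' : ψ v with _ | _ | u
    · rfl
    · rw [(h2 v).2 hv'] at hv; simp at hv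
    · rw [(h1 v u).2 hv'] at hv; simp at hv
  · exact ((h2 v).1 hv).symm
  · exact ((h1 v u).1 hv).symm

end IsScheme

open Classical in
/-- The scheme of a matching. -/
noncomputable def matchingScheme (D : V → V → Prop) (M : Finset (Sym2 V)) (v : V) :
    Option (Option V) :=
  if h : ∃ u, D v u ∧ s(v, u) ∈ M then some (some h.choose)
  else if v ∈ coveredVertices M then some none else none

section Matching

variable {G : SimpleGraph V} {M : Finset (Sym2 V)}

theorem IsEdgeMatching.eq_of_mem (hM : IsEdgeMatching G M) {v u u' : V} (h : s(v, u) ∈ M)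
    (h' : s(v, u') ∈ M) : u = u' := by
  by_contra hne
  refine hM.2 _ h _ h' (fun he => hne ?_) v (by simp) (by simp)
  rcases Sym2.eq_iff.1 he with ⟨-, h⟩ | ⟨h, h'⟩
  · exact h
  · exact h'.trans h

theorem matchingScheme_eq_some (hM : IsEdgeMatching G M) {v u : V} :
    matchingScheme D M v = some (some u) ↔ D v u ∧ s(v, u) ∈ M := by
  unfold matchingScheme
  split_ifs with h h'
  · have hc := h.choose_spec
    simp only [Option.some.injEq]
    constructor
    · rintro rfl; exact hc
    · exact fun hu => hM.eq_of_mem hc.2 hu.2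
  · simp only [Option.some.injEq, reduceCtorEq, false_iff]
    exact fun hu => h ⟨u, hu⟩
  · simp only [false_iff]
    exact fun hu => h ⟨u, hu⟩

theorem matchingScheme_eq_none {v : V} :
    matchingScheme D M v = none ↔ v ∉ coveredVertices M := by
  unfold matchingScheme
  split_ifs with h h'
  · simp only [false_iff, not_not]
    obtain ⟨u, -, hu⟩ := h
    exact ⟨_, hu, by simp⟩
  · simpa using h'
  · simpa using h'

theorem isScheme_matchingScheme (hD : ∀ v u, D v u → ¬ D u v)
    (hG : ∀ v u, G.Adj v u ↔ D v u ∨ D u v) (hM : IsEdgeMatching G M) :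
    IsScheme D (matchingScheme D M) := by
  constructor
  · intro v u h
    exact ((matchingScheme_eq_some hM).1 h).1
  · intro u
    simp only [matchingScheme_eq_some hM]
    constructor
    · intro h
      have hc : u ∈ coveredVertices M := by
        by_contra hc
        rw [matchingScheme_eq_none.2 hc] at h
        simp at h
      obtain ⟨e, he, hu⟩ := hc
      obtain ⟨v, rfl⟩ := Sym2.mem_iff_exists.1 hu
      rcases (hG _ _).1 (hM.1 _ he) with h' | h'
      · rw [(matchingScheme_eq_some hM).2 ⟨h', he⟩] at h
        simp at h
      · exact ⟨v, h', by rwa [Sym2.eq_swap]⟩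
    · rintro ⟨v, hv, hm⟩
      rw [Sym2.eq_swap] at hm
      rcases h : matchingScheme D M u with _ | _ | x
      · exact absurd ⟨_, hm, by simp⟩ (matchingScheme_eq_none.1 h)
      · rfl
      · obtain ⟨hx, hx'⟩ := (matchingScheme_eq_some hM).1 h
        rw [hM.eq_of_mem hx' hm] at hx
        exact absurd hx (hD _ _ hv)

theorem schemeEdges_matchingScheme (hG : ∀ v u, G.Adj v u ↔ D v u ∨ D u v)
    (hM : IsEdgeMatching G M) : schemeEdges (matchingScheme D M) = M := by
  ext e
  simp only [mem_schemeEdges, matchingScheme_eq_some hM]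
  constructor
  · rintro ⟨v, u, ⟨-, h⟩, rfl⟩
    exact h
  · intro he
    induction e with
    | h v u =>
      rcases (hG _ _).1 (hM.1 _ he) with h | h
      · exact ⟨v, u, ⟨h, he⟩, rfl⟩
      · exact ⟨u, v, ⟨h, by rwa [Sym2.eq_swap]⟩, Sym2.eq_swap⟩

theorem card_pickers_matchingScheme (hD : ∀ v u, D v u → ¬ D u v)
    (hG : ∀ v u, G.Adj v u ↔ D v u ∨ D u v) (hM : IsEdgeMatching G M) :
    (pickers (matchingScheme D M)).card = (downs (matchingScheme D M)).card := by
  have hs := isScheme_matchingScheme hD hG hM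
  refine le_antisymm ?_ hs.card_downs_le
  refine Finset.card_le_card_of_injOn (pick (matchingScheme D M)) (fun v hv => ?_)
    fun v hv v' hv' h => ?_
  · obtain ⟨u, hu⟩ := mem_pickers.1 hv
    rw [pick_eq hu]
    exact mem_downs.2 ((hs.picked u).2 ⟨v, hu⟩)
  · obtain ⟨u, hu⟩ := mem_pickers.1 hv
    obtain ⟨u', hu'⟩ := mem_pickers.1 hv'
    rw [pick_eq hu, pick_eq hu'] at h
    subst h
    have h1 := ((matchingScheme_eq_some hM).1 hu).2
    have h2 := ((matchingScheme_eq_some hM).1 hu').2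
    rw [Sym2.eq_swap] at h1 h2
    exact hM.eq_of_mem h1 h2

end Matching

end Scheme

/-! ### Pairs of schemes -/

section Choice

variable {V : Type*} [Fintype V] [DecidableEq V]

/-- The possible choices of a vertex `v` for a pair of schemes: not covered, or in either scheme
either picked (`none`) or picking a vertex `u` (`some u`). -/
abbrev Choice (V : Type*) := Option (Option V × Option V)

/-- The first scheme. -/
def scheme₁ (o : V → Choice V) (v : V) : Option (Option V) := (o v).map Prod.fst

/-- The second scheme. -/
def scheme₂ (o : V → Choice V) (v : V) : Option (Option V) := (o v).map Prod.snd

theorem scheme_ext {o o' : V → Choice V} (h₁ : scheme₁ o = scheme₁ o')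
    (h₂ : scheme₂ o = scheme₂ o') : o = o' := by
  funext v
  have h₁ := congrFun h₁ v
  have h₂ := congrFun h₂ v
  simp only [scheme₁, scheme₂] at h₁ h₂
  rcases h : o v with _ | ⟨a, b⟩ <;> rcases h' : o' v with _ | ⟨a', b'⟩ <;> simp_all

theorem scheme_none (o : V → Choice V) (v : V) : scheme₁ o v = none ↔ scheme₂ o v = none := by
  simp [scheme₁, scheme₂]

/-- The choices of the vertices form two edge-disjoint schemes. -/
structure IsSchemePair (D : V → V → Prop) (o : V → Choice V) : Prop where
  fst : IsScheme D (scheme₁ o)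
  snd : IsScheme D (scheme₂ o)
  ne : ∀ v u, scheme₁ o v = some (some u) → scheme₂ o v ≠ some (some u)

/-- The total weight of the edges. -/
def totalWeight (wt : Sym2 V → ℕ) (o : V → Choice V) : ℕ :=
  ∑ v ∈ pickers (scheme₁ o), wt s(v, pick (scheme₁ o) v) +
    ∑ v ∈ pickers (scheme₂ o), wt s(v, pick (scheme₂ o) v)

/-- The total number of picking vertices. -/
def pickCount (o : V → Choice V) : ℕ := (pickers (scheme₁ o)).card + (pickers (scheme₂ o)).card

/-- The total number of picked vertices. -/
def downCount (o : V → Choice V) : ℕ := (downs (scheme₁ o)).card + (downs (scheme₂ o)).card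

variable {D : V → V → Prop} {G : SimpleGraph V}

theorem IsSchemePair.disjoint (hD : ∀ v u, D v u → ¬ D u v) {o : V → Choice V}
    (ho : IsSchemePair D o) : Disjoint (schemeEdges (scheme₁ o)) (schemeEdges (scheme₂ o)) := by
  rw [Finset.disjoint_left]
  intro e he he'
  obtain ⟨v, u, h, rfl⟩ := mem_schemeEdges.1 he
  rw [ho.snd.mk_mem_schemeEdges hD (ho.fst.up _ _ h)] at he'
  exact ho.ne _ _ h he'

theorem card_pickers_add_downs (φ : V → Option (Option V)) :
    (pickers φ).card + (downs φ).card = (Finset.univ.filter fun v => φ v ≠ none).card := by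
  rw [← Finset.card_union_of_disjoint]
  · congr 1
    ext v
    rw [Finset.mem_union, mem_pickers, mem_downs]
    rcases h : φ v with _ | _ | u <;> simp [h]
  · rw [Finset.disjoint_left]
    intro v hv hv'
    obtain ⟨u, hu⟩ := mem_pickers.1 hv
    rw [mem_downs, hu] at hv'
    simp at hv'

/-- The consistent pairs of matchings are the edge sets of the pairs of schemes without surplus
picks. -/
theorem consistentMatchingPairs_eq_image (hD : ∀ v u, D v u → ¬ D u v)
    (hG : ∀ v u, G.Adj v u ↔ D v u ∨ D u v) (wt : Sym2 V → ℕ) (w ℓ : ℕ) :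
    consistentMatchingPairs G wt w ℓ =
      (fun o : V → Choice V => (schemeEdges (scheme₁ o), schemeEdges (scheme₂ o))) ''
        {o | IsSchemePair D o ∧ totalWeight wt o = w ∧ pickCount o = ℓ ∧ downCount o = ℓ} := by
  ext ⟨M₁, M₂⟩
  simp only [consistentMatchingPairs, Set.mem_ofPred_eq, Set.mem_image, Prod.mk.injEq]
  constructor
  · rintro ⟨h₁, h₂, ⟨hdisj, hcov⟩, hc₁, hc₂, hw⟩
    let o : V → Choice V := fun v =>
      match matchingScheme D M₁ v, matchingScheme D M₂ v with
      | some a, some b => some (a, b)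
      | _, _ => none
    have hnone : ∀ v, matchingScheme D M₁ v = none ↔ matchingScheme D M₂ v = none := fun v => by
      rw [matchingScheme_eq_none, matchingScheme_eq_none, hcov]
    have ho : scheme₁ o = matchingScheme D M₁ ∧ scheme₂ o = matchingScheme D M₂ := by
      refine ⟨funext fun v => ?_, funext fun v => ?_⟩ <;>
      · have := hnone v
        simp only [scheme₁, scheme₂, o]
        rcases ha : matchingScheme D M₁ v with _ | a <;>
          rcases hb : matchingScheme D M₂ v with _ | b <;> simp_all
    have hs₁ := isScheme_matchingScheme hD hG h₁
    have hs₂ := isScheme_matchingScheme hD hG h₂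
    have he₁ := schemeEdges_matchingScheme hG h₁
    have he₂ := schemeEdges_matchingScheme hG h₂
    have hk₁ := hs₁.card_schemeEdges
    have hk₂ := hs₂.card_schemeEdges
    rw [he₁] at hk₁
    rw [he₂] at hk₂
    have hd₁ := card_pickers_matchingScheme hD hG h₁
    have hd₂ := card_pickers_matchingScheme hD hG h₂
    refine ⟨o, ⟨⟨?_, ?_, ?_⟩, ?_, ?_, ?_⟩, ?_⟩
    · rwa [ho.1]
    · rwa [ho.2]
    · intro v u hv hv'
      rw [ho.1, matchingScheme_eq_some h₁] at hv
      rw [ho.2, matchingScheme_eq_some h₂] at hv'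
      exact Finset.disjoint_left.1 hdisj hv.2 hv'.2
    · rw [totalWeight, ho.1, ho.2, ← hs₁.sum_schemeEdges, ← hs₂.sum_schemeEdges, he₁, he₂, ← hw,
        Finset.sum_union hdisj]
    · rw [pickCount, ho.1, ho.2]; omega
    · rw [downCount, ho.1, ho.2]; omega
    · rw [ho.1, ho.2]; exact ⟨he₁, he₂⟩
  · rintro ⟨o, ⟨ho, hw, hp, hd⟩, rfl, rfl⟩
    have hGD : ∀ v u, D v u → G.Adj v u := fun v u h => (hG v u).2 (Or.inl h)
    have h₁ := ho.fst.card_downs_le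
    have h₂ := ho.snd.card_downs_le
    -- Both sides count the covered vertices. Together with marks ≤ picks in each scheme and equal
    -- totals `ℓ`, this forces all four cardinalities to be `ℓ / 2`.
    have hsum : (pickers (scheme₁ o)).card + (downs (scheme₁ o)).card =
        (pickers (scheme₂ o)).card + (downs (scheme₂ o)).card := by
      rw [card_pickers_add_downs, card_pickers_add_downs]
      simp only [ne_eq, scheme_none]
    rw [pickCount] at hp
    rw [downCount] at hd
    refine ⟨ho.fst.isEdgeMatching hGD (by omega), ho.snd.isEdgeMatching hGD (by omega),
      ⟨ho.disjoint hD, ?_⟩, ?_, ?_, ?_⟩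
    · rw [ho.fst.covered, ho.snd.covered]
      simp only [ne_eq, scheme_none]
    · rw [ho.fst.card_schemeEdges]; omega
    · rw [ho.snd.card_schemeEdges]; omega
    · rw [Finset.sum_union (ho.disjoint hD), ho.fst.sum_schemeEdges, ho.snd.sum_schemeEdges, ← hw,
        totalWeight]

theorem ncard_consistentMatchingPairs (hD : ∀ v u, D v u → ¬ D u v)
    (hG : ∀ v u, G.Adj v u ↔ D v u ∨ D u v) (wt : Sym2 V → ℕ) (w ℓ : ℕ) :
    (consistentMatchingPairs G wt w ℓ).ncard =
      {o : V → Choice V | IsSchemePair D o ∧ totalWeight wt o = w ∧ pickCount o = ℓ ∧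
        downCount o = ℓ}.ncard := by
  rw [consistentMatchingPairs_eq_image hD hG]
  refine Set.InjOn.ncard_image fun o ho o' ho' h => ?_
  simp only [Prod.mk.injEq] at h
  exact scheme_ext (ho.1.fst.ext_of_edges hD ho'.1.fst h.1) (ho.1.snd.ext_of_edges hD ho'.1.snd h.2)

/-! ### Expanding the product of the local weights -/

/-- The contribution of the vertex `v` to the sign of a choice `a`, where `y` tells which vertices
may be picked. -/
def schemeSign (v : V) (a : Option (Option V)) (y : V → Bool) : ℤ :=
  match a with
  | none => if y v then 0 else 1
  | some none => if y v then 1 else -1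
  | some (some u) => if y v then 0 else (y u).toInt

/-- Writing the sign as a product over all `u` makes it possible to regroup by the vertex whose bit
is used. -/
theorem schemeSign_eq (φ : V → Option (Option V)) (v : V) (y : V → Bool) :
    schemeSign v (φ v) y = (if φ v = some none then (if y v then 1 else -1) else
      (if y v then 0 else 1)) * ∏ u, if φ v = some (some u) then (y u).toInt else 1 := by
  rcases h : φ v with _ | _ | u
  · simp [schemeSign]
  · simp [schemeSign]
  · simp [schemeSign, Finset.prod_ite_eq]

/-- Inclusion-exclusion over the sets of vertices that may be picked. -/
theorem sum_prod_schemeSign (φ : V → Option (Option V))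
    [Decidable (∀ u, φ u = some none ↔ ∃ v, φ v = some (some u))] :
    ∑ y : V → Bool, ∏ v, schemeSign v (φ v) y =
      if ∀ u, φ u = some none ↔ ∃ v, φ v = some (some u) then 1 else 0 := by
  -- All factors that involve the bit of `u`: its own choice, and one factor for all vertices that
  -- pick it.
  let h : V → Bool → ℤ := fun u b => (if φ u = some none then (if b then 1 else -1) else
    (if b then 0 else 1)) * if ∃ v, φ v = some (some u) then b.toInt else 1
  have h1 : ∀ y : V → Bool, ∏ v, schemeSign v (φ v) y = ∏ u, h u (y u) := fun y => by
    simp only [h, Finset.prod_mul_distrib, schemeSign_eq]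
    rw [Finset.prod_comm]
    congr 1
    refine Finset.prod_congr rfl fun u _ => ?_
    split_ifs with hu
    · obtain ⟨v, hv⟩ := hu
      cases hy : y u
      · refine Finset.prod_eq_zero (Finset.mem_univ v) ?_
        simp [hv]
      · refine Finset.prod_eq_one fun v _ => ?_
        simp
    · refine Finset.prod_eq_one fun v _ => ?_
      rw [if_neg fun hv => hu ⟨v, hv⟩]
  have h2 : ∑ y : V → Bool, ∏ u, h u (y u) = ∏ u, ∑ b : Bool, h u b := by
    rw [Finset.prod_univ_sum, Fintype.piFinset_univ]
  -- For a marked `u` the sum is 1 minus the indicator that nobody picks `u`; for an unmarked `u`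
  -- only the bit `false` survives, and it gives that indicator.
  have h3 : ∀ u, ∑ b : Bool, h u b =
      if φ u = some none ↔ ∃ v, φ v = some (some u) then 1 else 0 := fun u => by
    simp only [h, Fintype.sum_bool]
    by_cases ha : φ u = some none <;> by_cases hb : ∃ v, φ v = some (some u) <;> simp [ha, hb]
  simp only [h1, h2, h3]
  split_ifs with hall
  · exact Finset.prod_eq_one fun u _ => if_pos (hall u)
  · push Not at hall
    obtain ⟨u, hu⟩ := hall
    refine Finset.prod_eq_zero (Finset.mem_univ u) (if_neg ?_)
    tauto

end Choice

section Choice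

variable {V : Type*} [Fintype V] [DecidableEq V]

/-- The exponent of a choice in one scheme. -/
def optionExp (wt : Sym2 V → ℕ) (M : ℕ) (v : V) : Option V → ℕ
  | none => M ^ 2
  | some u => wt s(v, u) + M

/-- The exponent of a choice. -/
def choiceExp (wt : Sym2 V → ℕ) (M : ℕ) (v : V) : Choice V → ℕ
  | none => 0
  | some (a, b) => optionExp wt M v a + optionExp wt M v b

/-- The choices that are compatible with the orientation. -/
def Choice.Allowed (D : V → V → Prop) (v : V) : Choice V → Prop
  | none => True
  | some (a, b) => (∀ u, a = some u → D v u ∧ b ≠ some u) ∧ ∀ u, b = some u → D v u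

open Classical in
/-- The weight of a choice. -/
noncomputable def choiceWeight (D : V → V → Prop) (wt : Sym2 V → ℕ) (M : ℕ) (v : V)
    (o : Choice V) : ℤ :=
  if o.Allowed D v then 2 ^ (M * choiceExp wt M v o) else 0

open Classical in
/-- The factor of the edge between `v` and `u`. -/
noncomputable def upFactor (D : V → V → Prop) (wt : Sym2 V → ℕ) (M : ℕ) (v u : V) : ℤ :=
  if D v u then 2 ^ ((wt s(v, u) + M) * M) else 0

/-- The local weight of `v`, as a function of the sets of vertices that may be picked. -/
noncomputable def vertexWeight (D : V → V → Prop) (wt : Sym2 V → ℕ) (M : ℕ) (v : V)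
    (x : V → Bool × Bool) : ℤ :=
  (if (x v).1 then (2 ^ M ^ 3 : ℤ) else
    (∑ u, (x u).1.toInt * upFactor D wt M v u) - 2 ^ M ^ 3) *
  (if (x v).2 then (2 ^ M ^ 3 : ℤ) else
    (∑ u, (x u).2.toInt * upFactor D wt M v u) - 2 ^ M ^ 3) +
  (if x v = (false, false) then
    1 - ∑ u, (x u).1.toInt * upFactor D wt M v u * ((x u).2.toInt * upFactor D wt M v u) else 0)

variable {D : V → V → Prop}

/-- For a covered vertex the choices in the two schemes are independent except that equal picks are
forbidden. So the sum is a product of two sums minus a diagonal, plus 1 for the uncovered choice if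
both bits are `false`. -/
theorem vertexWeight_eq_sum (D : V → V → Prop) (wt : Sym2 V → ℕ) (M : ℕ) (v : V)
    (x : V → Bool × Bool) :
    vertexWeight D wt M v x = ∑ o : Choice V, choiceWeight D wt M v o *
      (schemeSign v (o.map Prod.fst) (fun u => (x u).1) *
        schemeSign v (o.map Prod.snd) (fun u => (x u).2)) := by
  -- The signed weight of a choice in a single scheme.
  let A : (V → Bool) → Option V → ℤ := fun y a =>
    (match a with
      | none => 2 ^ M ^ 3
      | some u => upFactor D wt M v u) * schemeSign v (some a) y
  have hA : ∀ y : V → Bool, ∑ a, A y a = if y v then (2 ^ M ^ 3 : ℤ) else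
      (∑ u, (y u).toInt * upFactor D wt M v u) - 2 ^ M ^ 3 := fun y => by
    simp only [A, Fintype.sum_option, schemeSign]
    cases y v
    · simp [mul_comm]; ring
    · simp
  set y₁ : V → Bool := fun u => (x u).1
  set y₂ : V → Bool := fun u => (x u).2
  have hZ : (2 : ℤ) ^ (M * (M ^ 2 + M ^ 2)) = 2 ^ M ^ 3 * 2 ^ M ^ 3 := by
    rw [← pow_add]; ring_nf
  have key : ∀ a b : Option V, choiceWeight D wt M v (some (a, b)) *
      (schemeSign v (some a) y₁ * schemeSign v (some b) y₂) =
      A y₁ a * A y₂ b - (match a with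
        | none => 0
        | some u => if b = some u then A y₁ (some u) * A y₂ (some u) else 0) := by
    intro a b
    rcases a with _ | u <;> rcases b with _ | u'
    · simp only [choiceWeight, Choice.Allowed, choiceExp, optionExp, A, hZ]
      simp
      ring
    · simp only [choiceWeight, Choice.Allowed, choiceExp, optionExp, A, upFactor]
      by_cases h : D v u'
      · simp [h]
        ring
      · simp [h]
    · simp only [choiceWeight, Choice.Allowed, choiceExp, optionExp, A, upFactor]
      by_cases h : D v u
      · simp [h]
        ring
      · simp [h]
    · simp only [choiceWeight, Choice.Allowed, choiceExp, optionExp, A, upFactor]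
      by_cases h : D v u
      · by_cases h' : D v u'
        · by_cases he : u' = u
          · simp [h, he]
          · simp [h, h', he]
            ring
        · have : ¬ u' = u := fun e => h' (e ▸ h)
          simp [h', this]
      · simp only [h, if_false, zero_mul, ite_self]
        simp [h]
  have hdiag : ∑ a : Option V, ∑ b : Option V, (match a with
        | none => (0 : ℤ)
        | some u => if b = some u then A y₁ (some u) * A y₂ (some u) else 0) =
      if x v = (false, false) then
        ∑ u, (x u).1.toInt * upFactor D wt M v u * ((x u).2.toInt * upFactor D wt M v u) else 0 := by
    rw [Fintype.sum_option]
    simp only [Finset.sum_const_zero, zero_add, Finset.sum_ite_eq', Finset.mem_univ, if_true]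
    simp only [A, schemeSign, y₁, y₂]
    rcases hx : x v with ⟨_ | _, _ | _⟩ <;> simp [mul_comm]
  rw [Fintype.sum_option, Fintype.sum_prod_type]
  simp only [Option.map_some, Option.map_none, key, Finset.sum_sub_distrib, hdiag]
  rw [← Fintype.sum_mul_sum, hA, hA]
  simp only [vertexWeight, choiceWeight, Choice.Allowed, choiceExp, schemeSign, y₁, y₂, if_true,
    mul_zero, pow_zero]
  obtain ⟨b₁, b₂, hx⟩ : ∃ b₁ b₂, x v = (b₁, b₂) := ⟨_, _, rfl⟩
  simp only [hx]
  cases b₁ <;> cases b₂ <;> simp <;> ring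

open Classical in
/-- The sum over all contexts counts the pairs of schemes by their exponents. -/
theorem sum_prod_vertexWeight (D : V → V → Prop) (wt : Sym2 V → ℕ) (M : ℕ) :
    ∑ x : V → Bool × Bool, ∏ v, vertexWeight D wt M v x =
      ∑ o ∈ Finset.univ.filter (fun o : V → Choice V => IsSchemePair D o),
        2 ^ (M * ∑ v, choiceExp wt M v (o v)) := by
  have h1 : ∀ x : V → Bool × Bool, ∏ v, vertexWeight D wt M v x =
      ∑ o : V → Choice V, (∏ v, choiceWeight D wt M v (o v)) *
        ((∏ v, schemeSign v (scheme₁ o v) fun u => (x u).1) *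
          ∏ v, schemeSign v (scheme₂ o v) fun u => (x u).2) := fun x => by
    simp only [vertexWeight_eq_sum]
    rw [Finset.prod_univ_sum, Fintype.piFinset_univ]
    simp only [Finset.prod_mul_distrib, scheme₁, scheme₂]
  -- The bits of the two schemes vary independently, so inclusion-exclusion applies to each scheme
  -- separately.
  have h2 : ∀ F F' : (V → Bool) → ℤ, ∑ x : V → Bool × Bool, F (fun u => (x u).1) *
      F' (fun u => (x u).2) = (∑ y, F y) * ∑ y, F' y := fun F F' => by
    rw [Fintype.sum_mul_sum, ← Fintype.sum_prod_type']
    exact Fintype.sum_equiv (Equiv.arrowProdEquivProdArrow V (fun _ => Bool) (fun _ => Bool))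
      _ _ fun x => rfl
  simp only [h1]
  rw [Finset.sum_comm, Finset.sum_filter]
  refine Finset.sum_congr rfl fun o _ => ?_
  rw [← Finset.mul_sum, h2 (fun y => ∏ v, schemeSign v (scheme₁ o v) y)
    (fun y => ∏ v, schemeSign v (scheme₂ o v) y), sum_prod_schemeSign, sum_prod_schemeSign]
  -- If all choices are allowed, only the two conditions "marked iff picked" remain to be tested;
  -- otherwise some factor of the weight is 0.
  by_cases hall : ∀ v, (o v).Allowed D v
  · have hw : ∏ v, choiceWeight D wt M v (o v) = 2 ^ (M * ∑ v, choiceExp wt M v (o v)) := by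
      rw [Finset.mul_sum, ← Finset.prod_pow_eq_pow_sum]
      exact Finset.prod_congr rfl fun v _ => if_pos (hall v)
    have hup : ∀ v u, (scheme₁ o v = some (some u) → D v u ∧ scheme₂ o v ≠ some (some u)) ∧
        (scheme₂ o v = some (some u) → D v u) := fun v u => by
      have := hall v
      simp only [scheme₁, scheme₂]
      rcases h : o v with _ | ⟨a, b⟩
      · simp
      · rw [h] at this
        simpa using ⟨this.1 u, this.2 u⟩
    have hiff : IsSchemePair D o ↔
        (∀ u, scheme₁ o u = some none ↔ ∃ v, scheme₁ o v = some (some u)) ∧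
        ∀ u, scheme₂ o u = some none ↔ ∃ v, scheme₂ o v = some (some u) :=
      ⟨fun h => ⟨h.fst.picked, h.snd.picked⟩, fun h => ⟨⟨fun v u hv => ((hup v u).1 hv).1, h.1⟩,
        ⟨fun v u hv => (hup v u).2 hv, h.2⟩, fun v u hv => ((hup v u).1 hv).2⟩⟩
    rw [hw]
    by_cases hp : IsSchemePair D o
    · rw [if_pos hp, if_pos (hiff.1 hp).1, if_pos (hiff.1 hp).2, one_mul, mul_one]
    · rw [if_neg hp]
      rw [hiff, not_and_or] at hp
      rcases hp with hp | hp <;> simp only [if_neg hp, zero_mul, mul_zero]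
  · have hp : ¬ IsSchemePair D o := fun h => hall fun v => by
      rcases ho : o v with _ | ⟨a, b⟩
      · trivial
      · refine ⟨fun u hu => ⟨h.fst.up v u (by simp [scheme₁, ho, hu]), fun hb => h.ne v u
          (by simp [scheme₁, ho, hu]) (by simp [scheme₂, ho, hb])⟩,
          fun u hu => h.snd.up v u (by simp [scheme₂, ho, hu])⟩
    rw [if_neg hp]
    push Not at hall
    obtain ⟨v, hv⟩ := hall
    rw [Finset.prod_eq_zero (Finset.mem_univ v) (if_neg hv), zero_mul]

/-- The exponent of a pair of schemes. -/
theorem sum_choiceExp (wt : Sym2 V → ℕ) (M : ℕ) (o : V → Choice V) :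
    ∑ v, choiceExp wt M v (o v) = totalWeight wt o + pickCount o * M + downCount o * M ^ 2 := by
  have h : ∀ φ : V → Option (Option V), ∑ v, (match φ v with
      | none => 0
      | some a => optionExp wt M v a) =
      (∑ v ∈ pickers φ, wt s(v, pick φ v)) + (pickers φ).card * M + (downs φ).card * M ^ 2 := by
    intro φ
    rw [← smul_eq_mul, ← Finset.sum_const, ← smul_eq_mul, ← Finset.sum_const,
      ← Finset.sum_add_distrib]
    simp only [pickers, downs, Finset.sum_filter]
    rw [← Finset.sum_add_distrib]
    refine Finset.sum_congr rfl fun v _ => ?_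
    rcases h : φ v with _ | _ | u <;> simp [optionExp, pick, h]
  have h' : ∀ v, choiceExp wt M v (o v) = (match scheme₁ o v with
      | none => 0
      | some a => optionExp wt M v a) + (match scheme₂ o v with
      | none => 0
      | some a => optionExp wt M v a) := fun v => by
    simp only [scheme₁, scheme₂]
    rcases h : o v with _ | ⟨a, b⟩ <;> simp [choiceExp]
  simp only [h', Finset.sum_add_distrib, h, totalWeight, pickCount, downCount]
  ring

end Choice

/-! ### Recovering the number of consistent pairs from a digit of the sum. -/

section Choice

variable {V : Type*} [Fintype V] [DecidableEq V] {D : V → V → Prop} {G : SimpleGraph V}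

theorem totalWeight_le {wt : Sym2 V → ℕ} {s : ℕ} (hwt : ∀ v u, D v u → wt s(v, u) ≤ s)
    {o : V → Choice V} (ho : IsSchemePair D o) : totalWeight wt o ≤ 2 * Fintype.card V * s := by
  have h : ∀ φ, IsScheme D φ → ∑ v ∈ pickers φ, wt s(v, pick φ v) ≤ Fintype.card V * s :=
    fun φ hφ => by
    refine (Finset.sum_le_card_nsmul _ _ s fun v hv => ?_).trans
      (Nat.mul_le_mul_right _ (Finset.card_le_univ _))
    obtain ⟨u, hu⟩ := mem_pickers.1 hv
    rw [pick_eq hu]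
    exact hwt _ _ (hφ.up _ _ hu)
  have h₁ := h _ ho.fst
  have h₂ := h _ ho.snd
  rw [totalWeight]
  linarith

theorem pickCount_le (o : V → Choice V) : pickCount o ≤ 2 * Fintype.card V := by
  have h₁ := Finset.card_le_univ (pickers (scheme₁ o))
  have h₂ := Finset.card_le_univ (pickers (scheme₂ o))
  rw [pickCount]
  omega

theorem downCount_le (o : V → Choice V) : downCount o ≤ 2 * Fintype.card V := by
  have h₁ := Finset.card_le_univ (downs (scheme₁ o))
  have h₂ := Finset.card_le_univ (downs (scheme₂ o))
  rw [downCount]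
  omega

/-- Each vertex has `(n + 1) ^ 2 + 1` choices, at most `2 ^ (2 * n + 1)`, and `(2 * n + 1) * n` is
below `M`. -/
theorem card_choice_lt {n M : ℕ} (hn : Fintype.card V = n) (hM : 2 * (n + 1) ^ 2 ≤ M) :
    Fintype.card (V → Choice V) < 2 ^ M := by
  simp only [Fintype.card_fun, Fintype.card_option, Fintype.card_prod, hn]
  have h1 : n + 1 ≤ 2 ^ n := Nat.lt_two_pow_self
  have h2 : (n + 1) * (n + 1) + 1 ≤ 2 ^ (2 * n + 1) := by
    have := Nat.mul_le_mul h1 h1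
    have h3 : (2 : ℕ) ^ (2 * n + 1) = 2 * (2 ^ n * 2 ^ n) := by ring
    have : 1 ≤ 2 ^ n * 2 ^ n := Nat.one_le_iff_ne_zero.2 (by positivity)
    omega
  calc ((n + 1) * (n + 1) + 1) ^ n ≤ (2 ^ (2 * n + 1)) ^ n := Nat.pow_le_pow_left h2 n
    _ = 2 ^ ((2 * n + 1) * n) := (pow_mul _ _ _).symm
    _ < 2 ^ M := Nat.pow_lt_pow_right (by norm_num) (lt_of_lt_of_le (by nlinarith) hM)

/-- The sum over all contexts encodes the numbers of consistent pairs of matchings. -/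
theorem exists_sum_prod_vertexWeight (hD : ∀ v u, D v u → ¬ D u v)
    (hG : ∀ v u, G.Adj v u ↔ D v u ∨ D u v) {wt : Sym2 V → ℕ} {n s M : ℕ}
    (hn : Fintype.card V = n) (hwt : ∀ v u, D v u → wt s(v, u) ≤ s)
    (hM : M = 2 * (n + 1) ^ 2 * (s + 1)) (w ℓ : ℕ) :
    ∃ Q : ℕ, Q < 2 ^ M ^ 5 ∧ ∑ x : V → Bool × Bool, ∏ v, vertexWeight D wt M v x = Q ∧
      (w < M → ℓ < M → Q / 2 ^ ((w + ℓ * M + ℓ * M ^ 2) * M) % 2 ^ M =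
        (consistentMatchingPairs G wt w ℓ).ncard) ∧
      (¬ (w < M ∧ ℓ < M) → (consistentMatchingPairs G wt w ℓ).ncard = 0) := by
  classical
  have hM' : 2 * (n + 1) ^ 2 ≤ M := by
    rw [hM]
    exact Nat.le_mul_of_pos_right _ (Nat.succ_pos s)
  have hM2 : 2 * n < M := lt_of_lt_of_le (by nlinarith) hM'
  have hM3 : 2 * n * s < M := by
    rw [hM]
    nlinarith
  have htw : ∀ o : V → Choice V, IsSchemePair D o → totalWeight wt o < M := fun o ho =>
    (totalWeight_le hwt ho).trans_lt (by rwa [hn])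
  have hpc : ∀ o : V → Choice V, pickCount o < M := fun o =>
    (pickCount_le o).trans_lt (by rwa [hn])
  have hdc : ∀ o : V → Choice V, downCount o < M := fun o =>
    (downCount_le o).trans_lt (by rwa [hn])
  set O := Finset.univ.filter (fun o : V → Choice V => IsSchemePair D o) with hO
  have hcard : O.card < 2 ^ M := (Finset.card_le_univ _).trans_lt (card_choice_lt hn hM')
  refine ⟨∑ o ∈ O, 2 ^ (M * ∑ v, choiceExp wt M v (o v)), ?_, ?_, fun hw hℓ => ?_, fun hlt => ?_⟩
  -- Weight, picks and marks are digits to the base `M`, so the combined exponent is below `M ^ 3`.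
  · have h1 : ∀ o ∈ O, 2 ^ (M * ∑ v, choiceExp wt M v (o v)) ≤ 2 ^ (M * (M ^ 3 - 1)) :=
      fun o ho => by
      refine Nat.pow_le_pow_right (by norm_num) (Nat.mul_le_mul_left _ ?_)
      rw [sum_choiceExp]
      have h1 := htw o (Finset.mem_filter.1 ho).2
      have h2 : (pickCount o + 1) * M ≤ M * M := Nat.mul_le_mul_right _ (hpc o)
      have h3 : (downCount o + 1) * M ^ 2 ≤ M * M ^ 2 := Nat.mul_le_mul_right _ (hdc o)
      have h4 : M * M ^ 2 = M ^ 3 := by ring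
      have h5 : M * M = M ^ 2 := by ring
      rw [add_mul, one_mul] at h2 h3
      omega
    calc _ ≤ O.card * 2 ^ (M * (M ^ 3 - 1)) := Finset.sum_le_card_nsmul _ _ _ h1
      _ < 2 ^ M * 2 ^ (M * (M ^ 3 - 1)) := Nat.mul_lt_mul_of_pos_right hcard (by positivity)
      _ = 2 ^ M ^ 4 := by
        rw [← pow_add]
        congr 1
        have : 1 ≤ M ^ 3 := Nat.one_le_pow _ _ (by omega)
        obtain ⟨k, hk⟩ := Nat.exists_eq_add_of_le this
        rw [show M ^ 4 = M * M ^ 3 by ring, hk]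
        simp
        ring
      _ ≤ 2 ^ M ^ 5 := Nat.pow_le_pow_right (by norm_num)
        (Nat.pow_le_pow_right (by omega) (by norm_num))
  · rw [sum_prod_vertexWeight]
    push_cast
    rfl
  · rw [sum_pow_digit O _ M _ hcard, ncard_consistentMatchingPairs hD hG, ← Set.ncard_coe_finset]
    congr 1
    ext o
    simp only [hO, Finset.filter_filter, Finset.coe_filter, Finset.mem_univ, true_and,
      Set.mem_ofPred_eq, sum_choiceExp]
    refine and_congr_right fun ho => ⟨fun h => ?_, fun ⟨h1, h2, h3⟩ => by rw [h1, h2, h3]⟩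
    -- Uniqueness of digits to the base `M`: compare residues, cancel, divide by `M`, and repeat.
    have h' : totalWeight wt o + M * (pickCount o + M * downCount o) = w + M * (ℓ + M * ℓ) := by
      linarith
    have e1 := congrArg (· % M) h'
    simp only [Nat.add_mul_mod_self_left, Nat.mod_eq_of_lt hw, Nat.mod_eq_of_lt (htw o ho)] at e1
    rw [e1] at h'
    have h'' := Nat.eq_of_mul_eq_mul_left (by omega) (Nat.add_left_cancel h')
    have e2 := congrArg (· % M) h''
    simp only [Nat.add_mul_mod_self_left, Nat.mod_eq_of_lt hℓ, Nat.mod_eq_of_lt (hpc o)] at e2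
    rw [e2] at h''
    exact ⟨e1, e2, Nat.eq_of_mul_eq_mul_left (by omega) (Nat.add_left_cancel h'')⟩
  · rw [ncard_consistentMatchingPairs hD hG, Set.ncard_eq_zero, Set.eq_empty_iff_forall_notMem]
    rintro o ⟨ho, h1, h2, -⟩
    have := htw o ho
    have := hpc o
    exact hlt ⟨by omega, by omega⟩

end Choice

/-! ### The forest on the identifiers -/

/-- The sum over all contexts as a sum over all functions on the vertices. -/
theorem sumOver_eq_sum_piFinset {S : Type*} [Fintype S] [DecidableEq S] {n : ℕ}
    (H : (Fin n → S) → ℤ) (l : List ℕ) (hl : l.Nodup) (hln : ∀ x ∈ l, 1 ≤ x ∧ x ≤ n)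
    (c : ℕ → S) :
    sumOver l (fun c => H fun u => c (u + 1)) c =
      ∑ x ∈ Fintype.piFinset (fun u : Fin n => if (u : ℕ) + 1 ∈ l then Finset.univ else {c (u + 1)}),
        H x := by
  induction l generalizing c with
  | nil =>
    simp only [sumOver, List.not_mem_nil, if_false, Fintype.piFinset_singleton,
      Finset.sum_singleton]
  | cons v l ih =>
    obtain ⟨hv, hl⟩ := List.nodup_cons.1 hl
    obtain ⟨hv1, hvn⟩ := hln v (by simp)
    have hk : v - 1 < n := by omega
    have hv' : ((⟨v - 1, hk⟩ : Fin n) : ℕ) + 1 = v := by simp; omega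
    -- The functions are sorted by their value at the vertex with identifier `v`, matching the
    -- outermost sum.
    rw [sumOver, ← Finset.sum_fiberwise _ (fun x : Fin n → S => x ⟨v - 1, hk⟩)]
    refine Finset.sum_congr rfl fun s _ => ?_
    rw [ih hl fun x hx => hln x (by simp [hx])]
    refine Finset.sum_congr ?_ fun _ _ => rfl
    ext x
    simp only [Fintype.mem_piFinset, Finset.mem_filter]
    constructor
    · intro h
      refine ⟨fun u => ?_, ?_⟩
      · have hu := h u
        by_cases huv : (u : ℕ) + 1 = v
        · simp [huv]
        · by_cases hul : (u : ℕ) + 1 ∈ l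
          · simp [hul]
          · simpa [huv, hul] using hu
      · have hu := h ⟨v - 1, hk⟩
        rw [hv', if_neg hv] at hu
        simpa using hu
    · rintro ⟨h, rfl⟩ u
      have hu := h u
      by_cases huv : (u : ℕ) + 1 = v
      · have : u = ⟨v - 1, hk⟩ := by ext; simp; omega
        subst this
        have hv'' : v - 1 + 1 = v := by omega
        simp [hv'', hv]
      · by_cases hul : (u : ℕ) + 1 ∈ l
        · simp [hul]
        · simpa [huv, hul] using hu

theorem sumOver_eq_sum {S : Type*} [Fintype S] [DecidableEq S] {n : ℕ} (H : (Fin n → S) → ℤ)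
    (l : List ℕ) (hl : l.Nodup) (hln : ∀ x, x ∈ l ↔ 1 ≤ x ∧ x ≤ n) (c : ℕ → S) :
    sumOver l (fun c => H fun u => c (u + 1)) c = ∑ x, H x := by
  rw [sumOver_eq_sum_piFinset H l hl (fun x hx => (hln x).1 hx)]
  have : ∀ u : Fin n, (u : ℕ) + 1 ∈ l := fun u => (hln _).2 ⟨by omega, u.2⟩
  simp [this]

theorem list_prod_eq_prod {n : ℕ} (f : ℕ → ℤ) (l : List ℕ) (hl : l.Nodup)
    (hln : ∀ x, x ∈ l ↔ 1 ≤ x ∧ x ≤ n) : (l.map f).prod = ∏ v : Fin n, f (v + 1) := by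
  rw [← List.prod_toFinset f hl, ← Finset.prod_range fun i => f (i + 1)]
  have : l.toFinset = (Finset.range n).image (· + 1) := by
    ext x
    simp only [List.mem_toFinset, hln, Finset.mem_image, Finset.mem_range]
    exact ⟨fun h => ⟨x - 1, by omega, by omega⟩, fun ⟨i, hi, h⟩ => by omega⟩
  rw [this, Finset.prod_image fun i _ j _ h => by simpa using h]

namespace RootedForest

section Ancestors

variable {V : Type*} (T : RootedForest V)

theorem isAncestor_iff {u v : V} :
    T.IsAncestor u v ↔ u = v ∨ ∃ p, T.parent v = some p ∧ T.IsAncestor u p := by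
  constructor
  · intro h
    rcases Relation.ReflTransGen.cases_tail h with h | ⟨p, hp, hv⟩
    · exact Or.inl h.symm
    · exact Or.inr ⟨p, hv, hp⟩
  · rintro (rfl | ⟨p, hv, hp⟩)
    · exact Relation.ReflTransGen.refl
    · exact Relation.ReflTransGen.tail hp hv

theorem not_isAncestor_parent {v p : V} (h : T.parent v = some p) : ¬ T.IsAncestor v p :=
  fun hp => T.acyclic v (Relation.TransGen.tail' hp h)

theorem IsAncestor.antisymm {u v : V} (h : T.IsAncestor u v) (h' : T.IsAncestor v u) : u = v := by
  rcases T.isAncestor_iff.1 h with h | ⟨p, hp, hu⟩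
  · exact h
  · exact absurd (Relation.ReflTransGen.trans h' hu) (T.not_isAncestor_parent hp)

variable [Fintype V] [DecidableEq V]

open Classical in
/-- The ancestors of a node. -/
noncomputable def ancestors (v : V) : Finset V := Finset.univ.filter fun u => T.IsAncestor u v

theorem mem_ancestors {u v : V} : u ∈ T.ancestors v ↔ T.IsAncestor u v := by
  simp [ancestors]

theorem self_mem_ancestors (v : V) : v ∈ T.ancestors v :=
  T.mem_ancestors.2 Relation.ReflTransGen.refl

theorem ancestors_erase_of_none {v : V} (h : T.parent v = none) : (T.ancestors v).erase v = ∅ := by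
  ext u
  simp only [Finset.mem_erase, mem_ancestors, Finset.notMem_empty, iff_false, not_and]
  intro hne hu
  rcases T.isAncestor_iff.1 hu with hu | ⟨p, hp, -⟩
  · exact hne hu
  · simp [h] at hp

theorem ancestors_erase_of_some {v p : V} (h : T.parent v = some p) :
    (T.ancestors v).erase v = T.ancestors p := by
  ext u
  simp only [Finset.mem_erase, mem_ancestors]
  constructor
  · rintro ⟨hne, hu⟩
    rcases T.isAncestor_iff.1 hu with hu | ⟨q, hq, hu⟩
    · exact absurd hu hne
    · rw [h, Option.some.injEq] at hq
      rwa [hq]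
  · intro hu
    refine ⟨?_, T.isAncestor_iff.2 (Or.inr ⟨p, h, hu⟩)⟩
    rintro rfl
    exact T.not_isAncestor_parent h hu

theorem card_ancestors_le_depth (v : V) : (T.ancestors v).card ≤ T.depth := by
  have h : (T.ancestors v).card = Set.ncard {u : V | T.IsAncestor u v} := by
    rw [← Set.ncard_coe_finset]
    congr 1
    ext u
    simp [mem_ancestors]
  rw [h]
  exact Finset.le_sup (f := fun v : V => Set.ncard {u : V | T.IsAncestor u v}) (Finset.mem_univ v)

theorem depth_le_card : T.depth ≤ Fintype.card V := by
  refine Finset.sup_le fun v _ => ?_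
  rw [← Nat.card_eq_fintype_card]
  exact Set.ncard_le_card _

end Ancestors

variable {n : ℕ} (T : RootedForest (Fin n))

/-- The identifier of the parent, where the identifier of `v` is `v + 1` and `0` stands for none. -/
def parentId (a : ℕ) : ℕ :=
  if h : a - 1 < n ∧ 1 ≤ a then
    match T.parent ⟨a - 1, h.1⟩ with
    | none => 0
    | some u => u + 1
  else 0

/-- The number of ancestors of a node, by identifiers. -/
noncomputable def depthId (a : ℕ) : ℕ :=
  if h : a - 1 < n ∧ 1 ≤ a then (T.ancestors ⟨a - 1, h.1⟩).card else 0

theorem parentId_succ (v : Fin n) : T.parentId (v + 1) =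
    match T.parent v with
    | none => 0
    | some u => (u : ℕ) + 1 := by
  simp [parentId]

theorem depthId_succ (v : Fin n) : T.depthId (v + 1) = (T.ancestors v).card := by
  simp [depthId]

theorem depthId_zero : T.depthId 0 = 0 := by simp [depthId]

theorem depthId_eq_add_one (v : Fin n) : T.depthId (v + 1) = T.depthId (T.parentId (v + 1)) + 1 := by
  rw [depthId_succ, parentId_succ, ← Finset.card_erase_add_one (T.self_mem_ancestors v)]
  rcases h : T.parent v with _ | p
  · simp [T.ancestors_erase_of_none h, depthId_zero]
  · simp [T.ancestors_erase_of_some h, depthId_succ]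

theorem exists_fin_of_id {a : ℕ} (h1 : 1 ≤ a) (h : a ≤ n) : ∃ v : Fin n, a = v + 1 :=
  ⟨⟨a - 1, by omega⟩, by simp; omega⟩

theorem idTree : IdTree n T.depth T.parentId T.depthId where
  dep_zero := T.depthId_zero
  par_zero := by simp [parentId]
  par_le b h1 hb := by
    obtain ⟨v, rfl⟩ := exists_fin_of_id h1 hb
    rw [parentId_succ]
    rcases T.parent v with _ | p
    · simp
    · exact p.2
  dep_par b h1 hb := by
    obtain ⟨v, rfl⟩ := exists_fin_of_id h1 hb
    exact T.depthId_eq_add_one v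
  dep_le b hb := by
    rcases Nat.eq_zero_or_pos b with rfl | h1
    · simp [depthId_zero]
    · obtain ⟨v, rfl⟩ := exists_fin_of_id h1 hb
      rw [depthId_succ]
      exact T.card_ancestors_le_depth v

/-- The iterated parents list every ancestor once. The induction is on the depth, removing `v` from
its set of ancestors at each step. -/
theorem sum_iterate_parentId (g : ℕ → ℤ) (v : Fin n) :
    ∑ i ∈ Finset.range (T.depthId (v + 1)), g (T.parentId^[i] (v + 1)) =
      ∑ u ∈ T.ancestors v, g (u + 1) := by
  induction h : T.depthId (v + 1) generalizing v with
  | zero =>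
    rw [depthId_eq_add_one] at h
    omega
  | succ k ih =>
    have hk : T.depthId (T.parentId (v + 1)) = k := by
      have := T.depthId_eq_add_one v
      omega
    rw [Finset.sum_range_succ', ← Finset.sum_erase_add _ _ (T.self_mem_ancestors v)]
    simp only [Function.iterate_succ_apply, Function.iterate_zero, id]
    congr 1
    rw [parentId_succ] at hk ⊢
    rcases hp : T.parent v with _ | p
    · rw [hp] at hk
      simp only [depthId_zero] at hk
      simp [← hk, T.ancestors_erase_of_none hp]
    · rw [hp] at hk
      rw [T.ancestors_erase_of_some hp]
      exact ih p hk

theorem ancSum_succ (g : ℕ → ℤ) (v : Fin n) :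
    ancSum T.parentId T.depthId g (v + 1) = ∑ u ∈ (T.ancestors v).erase v, g (u + 1) := by
  rw [ancSum, parentId_succ]
  rcases hp : T.parent v with _ | p
  · simp [T.ancestors_erase_of_none hp, depthId_zero]
  · rw [T.ancestors_erase_of_some hp]
    exact T.sum_iterate_parentId g p

end RootedForest

/-! ### Local weights on identifiers and on vertices agree. -/

section Weights

variable {n : ℕ} (G : SimpleGraph (Fin n)) (wt : Sym2 (Fin n) → ℕ) (T : RootedForest (Fin n))

open Classical in
/-- The entry of the weighted adjacency matrix, by identifiers. -/
noncomputable def weightId (a u : ℕ) : ℕ :=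
  if h : (a - 1 < n ∧ 1 ≤ a) ∧ (u - 1 < n ∧ 1 ≤ u) then
    if G.Adj ⟨a - 1, h.1.1⟩ ⟨u - 1, h.2.1⟩ then wt s(⟨a - 1, h.1.1⟩, ⟨u - 1, h.2.1⟩) else 0
  else 0

open Classical in
theorem weightId_succ (v u : Fin n) :
    weightId G wt (v + 1) (u + 1) = if G.Adj v u then wt s(v, u) else 0 := by
  simp [weightId]

/-- The edges of `G`, directed towards the root. -/
def upEdge (v u : Fin n) : Prop := G.Adj v u ∧ T.IsAncestor u v

theorem upEdge_asymm (v u : Fin n) (h : upEdge G T v u) : ¬ upEdge G T u v :=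
  fun h' => h.1.ne (RootedForest.IsAncestor.antisymm T h'.2 h.2)

theorem adj_iff_upEdge (hT : T.IsEliminationForest G) (v u : Fin n) :
    G.Adj v u ↔ upEdge G T v u ∨ upEdge G T u v := by
  constructor
  · intro h
    rcases hT v u h with h' | h'
    · exact Or.inr ⟨h.symm, h'⟩
    · exact Or.inl ⟨h, h'⟩
  · rintro (h | h)
    · exact h.1
    · exact h.1.symm

variable {G wt}

theorem edgeFactor_weightId (hwt : ∀ e ∈ G.edgeSet, 1 ≤ wt e) (M : ℕ) {v u : Fin n}
    (h : T.IsAncestor u v) :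
    (edgeFactor M (weightId G wt) (v + 1) (u + 1) : ℤ) = upFactor (upEdge G T) wt M v u := by
  rw [edgeFactor, weightId_succ, upFactor]
  by_cases ha : G.Adj v u
  · have h1 : 0 < wt s(v, u) := hwt _ ha
    rw [if_pos ha, if_pos h1, if_pos ⟨ha, h⟩]
    push_cast
    rfl
  · rw [if_neg ha, if_neg (lt_irrefl 0), if_neg fun h' : upEdge G T v u => ha h'.1]
    simp

/-- The sum over proper ancestors extends to all vertices, since the added terms belong to no upward
edge and vanish. -/
theorem ancSum_eq_sum (g : ℕ → ℤ) (f : Fin n → ℤ) (v : Fin n)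
    (h1 : ∀ u, T.IsAncestor u v → g (u + 1) = f u) (h0 : ∀ u, ¬ upEdge G T v u → f u = 0) :
    ancSum T.parentId T.depthId g (v + 1) = ∑ u, f u := by
  rw [T.ancSum_succ, Finset.sum_congr rfl fun u hu => h1 u
    (T.mem_ancestors.1 (Finset.mem_of_mem_erase hu))]
  refine Finset.sum_subset (Finset.subset_univ _) fun u _ hu => h0 u fun h => hu ?_
  exact Finset.mem_erase.2 ⟨h.1.ne', T.mem_ancestors.2 h.2⟩

theorem localWeight_eq_vertexWeight (hwt : ∀ e ∈ G.edgeSet, 1 ≤ wt e) (M : ℕ) (v : Fin n)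
    (c : ℕ → Bool × Bool) :
    localWeight T.parentId T.depthId (weightId G wt) M (v + 1) c =
      vertexWeight (upEdge G T) wt M v fun u => c (u + 1) := by
  have h0 : ∀ u, ¬ upEdge G T v u → upFactor (upEdge G T) wt M v u = 0 := fun u h => if_neg h
  rw [localWeight, vertexWeight,
    ancSum_eq_sum (G := G) T _ (fun u => (c (u + 1)).1.toInt * upFactor (upEdge G T) wt M v u) v
      (fun u hu => by rw [edgeFactor_weightId T hwt M hu]) (fun u hu => by rw [h0 u hu, mul_zero]),
    ancSum_eq_sum (G := G) T _ (fun u => (c (u + 1)).2.toInt * upFactor (upEdge G T) wt M v u) v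
      (fun u hu => by rw [edgeFactor_weightId T hwt M hu]) (fun u hu => by rw [h0 u hu, mul_zero]),
    ancSum_eq_sum (G := G) T _ (fun u => (c (u + 1)).1.toInt * upFactor (upEdge G T) wt M v u *
      ((c (u + 1)).2.toInt * upFactor (upEdge G T) wt M v u)) v
      (fun u hu => by rw [edgeFactor_weightId T hwt M hu])
      (fun u hu => by rw [h0 u hu, mul_zero, zero_mul])]

/-- The sum over all contexts that the algorithm computes. -/
theorem sumOver_localWeight (hwt : ∀ e ∈ G.edgeSet, 1 ≤ wt e) (M : ℕ) :
    sumOver (belowList n T.parentId T.depth 0) (fun c => ((belowList n T.parentId T.depth 0).map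
      (localWeight T.parentId T.depthId (weightId G wt) M · c)).prod) (fun _ => (false, false)) =
    ∑ x : Fin n → Bool × Bool, ∏ v, vertexWeight (upEdge G T) wt M v x := by
  have hn := T.idTree.nodup_belowList
  have hm := fun x => T.idTree.mem_belowList (x := x)
  simp only [list_prod_eq_prod _ _ hn hm, localWeight_eq_vertexWeight T hwt]
  exact sumOver_eq_sum (fun x => ∏ v, vertexWeight (upEdge G T) wt M v x) _ hn hm _

end Weights

/-! ### The encoding of instances -/

section Encoding

variable {n : ℕ} (G : SimpleGraph (Fin n)) (wt : Sym2 (Fin n) → ℕ) (w ℓ : ℕ)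
  (T : RootedForest (Fin n))

theorem encodeInstance_zero : (encodeInstance G wt w ℓ T).getD 0 0 = n := by
  simp [encodeInstance]

theorem encodeInstance_one : (encodeInstance G wt w ℓ T).getD 1 0 = w := by
  simp [encodeInstance]

theorem encodeInstance_two : (encodeInstance G wt w ℓ T).getD 2 0 = ℓ := by
  simp [encodeInstance]

theorem encodeInstance_parent (v : Fin n) :
    (encodeInstance G wt w ℓ T).getD (2 + (v + 1)) 0 = T.parentId (v + 1) := by
  rw [encodeInstance, List.append_assoc, List.getD_append_right _ _ _ _ (by simp; omega),
    List.getD_append _ _ _ _ (by simp; omega), T.parentId_succ]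
  simp only [List.length_cons, List.length_nil]
  rw [show 2 + ((v : ℕ) + 1) - (0 + 1 + 1 + 1) = v by omega]
  rcases h : T.parent v with _ | p <;> simp [List.getD_eq_getElem?_getD, h]

theorem encodeInstance_weight (v u : Fin n) :
    (encodeInstance G wt w ℓ T).getD (n + 3 + (v * n + u)) 0 =
      weightId G wt (v + 1) (u + 1) := by
  have hlt : (v : ℕ) * n + u < n * n := by
    have h : ((v : ℕ) + 1) * n ≤ n * n := Nat.mul_le_mul_right _ v.2
    have := u.2
    rw [add_mul, one_mul] at h
    omega
  rw [encodeInstance, List.getD_append_right _ _ _ _ (by simp), weightId_succ]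
  simp only [List.length_append, List.length_cons, List.length_nil, List.length_ofFn]
  rw [show n + 3 + ((v : ℕ) * n + u) - (0 + 1 + 1 + 1 + n) = v * n + u by omega,
    List.getD_eq_getElem _ _ (by simpa using hlt), List.getElem_ofFn]
  have hn : 0 < n := v.pos
  have h1 : Fin.divNat (⟨v * n + u, hlt⟩ : Fin (n * n)) = v := by
    ext
    simp [Fin.divNat, mul_comm (v : ℕ) n, Nat.mul_add_div hn, Nat.div_eq_of_lt u.2]
  have h2 : Fin.modNat (⟨v * n + u, hlt⟩ : Fin (n * n)) = u := by
    ext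
    simp [Fin.modNat, mul_comm (v : ℕ) n, Nat.mod_eq_of_lt u.2]
  rw [h1, h2]

/-- The sum of all entries of the weighted adjacency matrix. -/
noncomputable def entrySum : ℕ :=
  ∑ i ∈ Finset.range (n * n), (encodeInstance G wt w ℓ T).getD (n + 3 + i) 0

theorem weightId_le_entrySum (v u : Fin n) :
    weightId G wt (v + 1) (u + 1) ≤ entrySum G wt w ℓ T := by
  rw [← encodeInstance_weight G wt w ℓ T v u]
  refine Finset.single_le_sum (f := fun i => (encodeInstance G wt w ℓ T).getD (n + 3 + i) 0)
    (fun _ _ => Nat.zero_le _) ?_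
  have h : ((v : ℕ) + 1) * n ≤ n * n := Nat.mul_le_mul_right _ v.2
  have := u.2
  rw [add_mul, one_mul] at h
  exact Finset.mem_range.2 (by omega)

theorem entrySum_le {N : ℕ} (hwt : ∀ e ∈ G.edgeSet, wt e ≤ N) :
    entrySum G wt w ℓ T ≤ n * n * N := by
  refine (Finset.sum_le_card_nsmul _ _ N fun i hi => ?_).trans (by simp)
  have hi := Finset.mem_range.1 hi
  have hn : 0 < n := Nat.pos_of_ne_zero fun h => by simp [h] at hi
  have h := encodeInstance_weight G wt w ℓ T ⟨i / n, Nat.div_lt_of_lt_mul hi⟩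
    ⟨i % n, Nat.mod_lt _ hn⟩
  simp only [Nat.div_add_mod'] at h
  rw [h, weightId_succ G wt ⟨i / n, Nat.div_lt_of_lt_mul hi⟩ ⟨i % n, Nat.mod_lt _ hn⟩]
  split_ifs with hadj
  · exact hwt _ hadj
  · exact Nat.zero_le _

end Encoding

/-! ### The resource bounds -/

/-- The largest values have about `2 * M ^ 3 * (n + 1)` bits, so with `n + 1 ≤ M` the choice `B = M
^ 6 + 100` is generous; 100 covers the numerical constants. -/
theorem setting_bounds {n M : ℕ} (hM : 2 * (n + 1) ^ 2 ≤ M) :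
    1000000 * M ^ 7 ≤ 2 ^ (M ^ 6 + 100) ∧
      100 * (4 * (M * (2 ^ M ^ 3) ^ 2)) ^ (n + 1) ≤ 2 ^ (M ^ 6 + 100) ∧ M ^ 5 + 2 ≤ M ^ 6 + 100 := by
  have hM2 : 2 ≤ M := (Nat.le_mul_of_pos_right 2 (by positivity)).trans hM
  have hnM : n + 1 ≤ M := le_trans (by nlinarith) hM
  have hlt : M ≤ 2 ^ M := Nat.lt_two_pow_self.le
  have h2 : 2 * M ≤ M ^ 2 := by nlinarith
  have h4 : 4 * M ^ 2 ≤ M ^ 4 := by nlinarith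
  have h6 : 4 * M ^ 4 ≤ M ^ 6 := by
    calc 4 * M ^ 4 ≤ M ^ 2 * M ^ 4 := Nat.mul_le_mul_right _ (by nlinarith)
      _ = M ^ 6 := by ring
  refine ⟨?_, ?_, ?_⟩
  · calc 1000000 * M ^ 7 ≤ 2 ^ 20 * (2 ^ M) ^ 7 :=
        Nat.mul_le_mul (by norm_num) (Nat.pow_le_pow_left hlt 7)
      _ = 2 ^ (20 + M * 7) := by rw [← pow_mul, ← pow_add]
      _ ≤ 2 ^ (M ^ 6 + 100) := Nat.pow_le_pow_right (by norm_num) (by omega)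
  · have h5 : 4 * (M * (2 ^ M ^ 3) ^ 2) ≤ 2 ^ (2 + (M + M ^ 3 * 2)) := by
      rw [pow_add, pow_add, pow_mul]
      exact Nat.mul_le_mul (by norm_num) (Nat.mul_le_mul_right _ hlt)
    have h7 : (2 + (M + M ^ 3 * 2)) * M = 2 * M + M ^ 2 + 2 * M ^ 4 := by ring
    calc _ ≤ 2 ^ 7 * (2 ^ (2 + (M + M ^ 3 * 2))) ^ M :=
        Nat.mul_le_mul (by norm_num) ((Nat.pow_le_pow_left h5 _).trans
          (Nat.pow_le_pow_right (by positivity) hnM))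
      _ = 2 ^ (7 + (2 + (M + M ^ 3 * 2)) * M) := by rw [← pow_mul, ← pow_add]
      _ ≤ 2 ^ (M ^ 6 + 100) := Nat.pow_le_pow_right (by norm_num) (by omega)
  · have : M ^ 5 ≤ M ^ 6 := Nat.pow_le_pow_right (by omega) (by norm_num)
    omega

/-- The number of steps in terms of `M`. -/
theorem steps_le {n M τ : ℕ} (hM : n + 1 ≤ M) :
    6 * (n * n) + 28 + ((n + 3) * (n + 1) * 4 ^ τ * (28 * n + 61) + 32 * M ^ 5 + 108) ≤
      4 ^ τ * (600 * M ^ 5) := by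
  have h1 : 1 ≤ M := by omega
  have hp : 1 ≤ 4 ^ τ := Nat.one_le_pow _ _ (by norm_num)
  have h5 : 1 ≤ M ^ 5 := Nat.one_le_pow _ _ h1
  have h2 : n * n ≤ M ^ 5 := by
    calc n * n ≤ M * M := Nat.mul_le_mul (by omega) (by omega)
      _ = M ^ 2 := (sq M).symm
      _ ≤ M ^ 5 := Nat.pow_le_pow_right h1 (by norm_num)
  have h3 : (n + 3) * (n + 1) * (28 * n + 61) ≤ 267 * M ^ 5 := by
    calc (n + 3) * (n + 1) * (28 * n + 61) ≤ (3 * M) * M * (89 * M) :=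
        Nat.mul_le_mul (Nat.mul_le_mul (by omega) hM) (by omega)
      _ = 267 * M ^ 3 := by ring
      _ ≤ 267 * M ^ 5 := Nat.mul_le_mul_left _ (Nat.pow_le_pow_right h1 (by norm_num))
  have h4 := Nat.mul_le_mul_left (4 ^ τ) h3
  have h6 : M ^ 5 ≤ 4 ^ τ * M ^ 5 := Nat.le_mul_of_pos_left _ hp
  calc _ = 6 * (n * n) + 136 + 32 * M ^ 5 + 4 ^ τ * ((n + 3) * (n + 1) * (28 * n + 61)) := by ring
    _ ≤ 6 * M ^ 5 + 136 * M ^ 5 + 32 * M ^ 5 + 4 ^ τ * (267 * M ^ 5) := by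
      have := Nat.mul_le_mul_left 6 h2
      omega
    _ ≤ 4 ^ τ * (600 * M ^ 5) := by
      have e1 : 4 ^ τ * (267 * M ^ 5) = 267 * (4 ^ τ * M ^ 5) := by ring
      have e2 : 4 ^ τ * (600 * M ^ 5) = 600 * (4 ^ τ * M ^ 5) := by ring
      omega

/-- The exponent 17 is 5 for the number of steps plus 12 for the square of the bit length. -/
theorem time_le {k M τ : ℕ} (hM : 1 ≤ M) (hk : k ≤ 4 ^ τ * (600 * M ^ 5)) :
    k * (1 + (M ^ 6 + 100) * (M ^ 6 + 100)) ≤ 4 ^ τ * (10000000 * M ^ 17) := by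
  have h6 : 1 ≤ M ^ 6 := Nat.one_le_pow _ _ hM
  have h1 : 1 + (M ^ 6 + 100) * (M ^ 6 + 100) ≤ 10202 * M ^ 12 := by
    have : M ^ 12 = M ^ 6 * M ^ 6 := by ring
    rw [this]
    nlinarith
  calc _ ≤ 4 ^ τ * (600 * M ^ 5) * (10202 * M ^ 12) := Nat.mul_le_mul hk h1
    _ = 4 ^ τ * (6121200 * M ^ 17) := by ring
    _ ≤ _ := Nat.mul_le_mul_left _ (Nat.mul_le_mul_right _ (by norm_num))

theorem space_le {M x : ℕ} (hM : 1 ≤ M) :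
    (M ^ 5 + M + 3) * 32 * ((M ^ 5 + M + 3) * 32 + (M ^ 6 + 100 + x) + 1) ≤
      50000 * M ^ 11 * (1 + x) := by
  have h5 : 1 ≤ M ^ 5 := Nat.one_le_pow _ _ hM
  have h6 : M ^ 5 ≤ M ^ 6 := Nat.pow_le_pow_right hM (by norm_num)
  have h1 : M ≤ M ^ 5 := Nat.le_self_pow (by norm_num) M
  calc _ ≤ 160 * M ^ 5 * (262 * M ^ 6 * (1 + x)) := by
        refine Nat.mul_le_mul (by omega) ?_
        have : x ≤ M ^ 6 * x := Nat.le_mul_of_pos_left _ (by omega)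
        have e : 262 * M ^ 6 * (1 + x) = 262 * M ^ 6 + 262 * (M ^ 6 * x) := by ring
        omega
    _ = 41920 * M ^ 11 * (1 + x) := by ring
    _ ≤ _ := Nat.mul_le_mul_right _ (Nat.mul_le_mul_right _ (by norm_num))

/-- Only here does the polynomial bound on the weights enter, and it makes `M` polynomial in `n`. -/
theorem parameter_le {n N c s : ℕ} (hN : N ≤ c * (n + 1) ^ c) (hs : s ≤ n * n * N) :
    2 * (n + 1) ^ 2 * (s + 1) ≤ 2 * (c + 1) * (n + 1) ^ (c + 4) := by
  have h1 : s + 1 ≤ (c + 1) * (n + 1) ^ (c + 2) := by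
    have h2 : s ≤ (n + 1) ^ 2 * (c * (n + 1) ^ c) :=
      hs.trans (Nat.mul_le_mul (by nlinarith) hN)
    have h3 : 1 ≤ (n + 1) ^ (c + 2) := Nat.one_le_pow _ _ (by omega)
    have h4 : (n + 1) ^ 2 * (c * (n + 1) ^ c) = c * (n + 1) ^ (c + 2) := by ring
    rw [add_mul, one_mul]
    omega
  calc 2 * (n + 1) ^ 2 * (s + 1) ≤ 2 * (n + 1) ^ 2 * ((c + 1) * (n + 1) ^ (c + 2)) :=
      Nat.mul_le_mul_left _ h1
    _ = _ := by ring

theorem polynomial_bounds {n x K e M d : ℕ} (hM : M ≤ K * (n + 1) ^ e)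
    (hd : d = 10000000 * K ^ 17 + 17 * (e + 1)) :
    10000000 * M ^ 17 ≤ d * (n + 1) ^ d ∧
      50000 * M ^ 11 * (1 + x) ≤ d * (n + x + 1) ^ d := by
  have hd1 : 10000000 * K ^ 17 ≤ d := by omega
  have hd2 : 17 * (e + 1) ≤ d := by omega
  constructor
  · calc 10000000 * M ^ 17 ≤ 10000000 * (K * (n + 1) ^ e) ^ 17 :=
        Nat.mul_le_mul_left _ (Nat.pow_le_pow_left hM _)
      _ = 10000000 * K ^ 17 * (n + 1) ^ (e * 17) := by rw [mul_pow, ← pow_mul]; ring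
      _ ≤ _ := Nat.mul_le_mul hd1 (Nat.pow_le_pow_right (by omega) (by omega))
  · have hK : K ^ 11 ≤ K ^ 17 := by
      rcases Nat.eq_zero_or_pos K with rfl | hK
      · norm_num
      · exact Nat.pow_le_pow_right hK (by norm_num)
    calc 50000 * M ^ 11 * (1 + x) ≤ 50000 * (K * (n + x + 1) ^ e) ^ 11 * (n + x + 1) := by
          refine Nat.mul_le_mul (Nat.mul_le_mul_left _ (Nat.pow_le_pow_left (hM.trans ?_) _))
            (by omega)
          exact Nat.mul_le_mul_left _ (Nat.pow_le_pow_left (by omega) _)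
      _ = 50000 * K ^ 11 * (n + x + 1) ^ (e * 11 + 1) := by rw [mul_pow, ← pow_mul]; ring
      _ ≤ _ := Nat.mul_le_mul (by omega) (Nat.pow_le_pow_right (by omega) (by omega))

/-! ### The main theorem. -/

theorem mainTheorem2 :
    ∃ A : RAM.Program, ∀ c : ℕ, ∃ d : ℕ,
      ∀ (n N : ℕ) (G : SimpleGraph (Fin n)) (wt : Sym2 (Fin n) → ℕ) (w ℓ τ : ℕ)
        (T : RootedForest (Fin n)),
        N ≤ c * (n + 1) ^ c →
        (∀ e ∈ G.edgeSet, 1 ≤ wt e ∧ wt e ≤ N) →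
        T.IsEliminationForest G →
        T.depth = τ →
        ∃ (m : RAM.Memory) (t s : ℕ),
          RAM.Runs (encodeInstance G wt w ℓ T) A 0 m t s ∧
          m 0 = ((consistentMatchingPairs G wt w ℓ).ncard : ℤ) ∧
          t ≤ 4 ^ τ * (d * (n + 1) ^ d) ∧
          s ≤ d * (n + Nat.size w + Nat.size ℓ + 1) ^ d := by
  -- The constant `d` serves both as coefficient and as exponent, with `M ≤ 2 * (c + 1) * (n + 1) ^
  -- (c + 4)` substituted into bounds of degree 17 and 11 in `M`.
  refine ⟨RAM.countingProgram, fun c => ⟨10000000 * (2 * (c + 1)) ^ 17 + 17 * (c + 4 + 1), ?_⟩⟩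
  intro n N G wt w ℓ τ T hN hwt hT hτ
  subst hτ
  have hwt1 : ∀ e ∈ G.edgeSet, 1 ≤ wt e := fun e he => (hwt e he).1
  set inp := encodeInstance G wt w ℓ T with hinp
  obtain ⟨s₀, hs₀⟩ : ∃ s₀, s₀ = entrySum G wt w ℓ T := ⟨_, rfl⟩
  obtain ⟨M, hM⟩ : ∃ M, M = 2 * (n + 1) ^ 2 * (s₀ + 1) := ⟨_, rfl⟩
  have hM' : 2 * (n + 1) ^ 2 ≤ M := by
    rw [hM]
    exact Nat.le_mul_of_pos_right _ (Nat.succ_pos s₀)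
  have hnM : n + 1 ≤ M := le_trans (by nlinarith) hM'
  have hM1 : 1 ≤ M := by omega
  have hsM : s₀ < M := by
    rw [hM]
    exact (Nat.lt_succ_self s₀).trans_le (Nat.le_mul_of_pos_left _ (by positivity))
  have hMle : M ≤ 2 * (c + 1) * (n + 1) ^ (c + 4) := by
    rw [hM, hs₀]
    exact parameter_le hN (entrySum_le G wt w ℓ T fun e he => (hwt e he).2)
  have hwts : ∀ v u, upEdge G T v u → wt s(v, u) ≤ s₀ := fun v u h => by
    have := weightId_le_entrySum G wt w ℓ T v u
    rw [weightId_succ, if_pos h.1] at this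
    rwa [hs₀]
  obtain ⟨Q, hQ, hval, hcount, hzero⟩ := exists_sum_prod_vertexWeight (upEdge_asymm G T)
    (adj_iff_upEdge G T hT) (Fintype.card_fin n) hwts hM w ℓ
  obtain ⟨hsmall, hbig, hpow⟩ := setting_bounds hM'
  obtain ⟨htime, hspace⟩ := polynomial_bounds (x := Nat.size w + Nat.size ℓ) hMle rfl
  by_cases hlt : w < M ∧ ℓ < M
  · have S : Setting inp n M w ℓ T.depth ((M ^ 5 + M + 3) * 32) (M ^ 6 + 100) T.parentId T.depthId
        (weightId G wt) :=
      { tree := T.idTree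
        τ_le := by simpa using T.depth_le_card
        M_ge := hM'
        w_lt := hlt.1
        ℓ_lt := hlt.2
        inp_par := fun b h1 hb => by
          obtain ⟨v, rfl⟩ := RootedForest.exists_fin_of_id h1 hb
          exact encodeInstance_parent G wt w ℓ T v
        inp_wg := fun a u ha1 ha hu1 hu => by
          obtain ⟨v, rfl⟩ := RootedForest.exists_fin_of_id ha1 ha
          obtain ⟨u, rfl⟩ := RootedForest.exists_fin_of_id hu1 hu
          rw [← encodeInstance_weight G wt w ℓ T v u, hinp]
          congr 1
          ring
        wg_lt := fun a u ha1 ha hu1 hu => by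
          obtain ⟨v, rfl⟩ := RootedForest.exists_fin_of_id ha1 ha
          obtain ⟨u, rfl⟩ := RootedForest.exists_fin_of_id hu1 hu
          exact (weightId_le_entrySum G wt w ℓ T v u).trans_lt (hs₀ ▸ hsM)
        A_ge := le_rfl
        small := hsmall
        big := hbig
        pow_le := hpow }
    obtain ⟨m, t, s, hrun, ht, hs, -, hm⟩ := S.countingProgram_spec le_rfl
      (encodeInstance_zero G wt w ℓ T) (encodeInstance_one G wt w ℓ T)
      (encodeInstance_two G wt w ℓ T) hs₀.symm hM hQ ((sumOver_localWeight T hwt1 M).trans hval)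
    refine ⟨m, t, s, hrun, ?_, ?_, ?_⟩
    · rw [hm, hcount hlt.1 hlt.2]
    · exact ht.trans ((time_le hM1 (steps_le hnM)).trans (Nat.mul_le_mul_left _ htime))
    · refine hs.trans (le_trans ?_ ((space_le (x := Nat.size w + Nat.size ℓ) hM1).trans
        (hspace.trans_eq (by rw [← add_assoc]))))
      exact Nat.mul_le_mul_left _ (by omega)
  -- For large `w` or `ℓ` the time bound is the same, and the space grows with the bit lengths of
  -- `w` and `ℓ`.
  · obtain ⟨m, t, s, hrun, ht, hs, -, hm⟩ := RAM.countingProgram_zero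
      (A := (M ^ 5 + M + 3) * 32) (B := M ^ 6 + 100) le_rfl (by omega)
      (encodeInstance_zero G wt w ℓ T) (encodeInstance_one G wt w ℓ T)
      (encodeInstance_two G wt w ℓ T) hs₀.symm hM
      (le_trans (by have := Nat.le_self_pow (n := 7) (by norm_num) M; omega) hsmall) hlt
    refine ⟨m, t, s, hrun, ?_, ?_, ?_⟩
    · rw [hm, hzero hlt, Nat.cast_zero]
    · refine ht.trans ((time_le hM1 (le_trans ?_ (steps_le hnM))).trans
        (Nat.mul_le_mul_left _ htime))
      omega
    · refine hs.trans (le_trans ?_ ((space_le (x := Nat.size w + Nat.size ℓ) hM1).trans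
        (hspace.trans_eq (by rw [← add_assoc]))))
      exact Nat.mul_le_mul_left _ (by omega)
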